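/- **Theorem 5.8.** Let $q_1=(0,0),q_2=(1,0),q_3=(1,1),q_4=(0,1)$, let $F_i(x)=\frac14x+\frac34q_i$ for $1\le i\le4$, $F_5(x)=\frac14x+(\frac14,0)$, $F_6(x)=\frac14x+(\frac12,\frac14)$, $F_7(x)=\frac14x+(\frac14,\frac12)$, $F_8(x)=\frac14x+(\frac12,\frac34)$, and let the Vicsek windmill set $\mathcal V^w$ be the unique nonempty compact set with $\mathcal V^w=\bigcup_{i=1}^8F_i\mathcal V^w$. Put $$K_1=\mathcal V^w,\quad K_2=F_1\mathcal V^w\cup F_5\mathcal V^w,\quad K_3=F_1F_8\mathcal V^w\cup F_1F_3\mathcal V^w\cup F_5F_4\mathcal V^w .$$ Let $\sigma_1=1,\sigma_2=\frac14,\sigma_3=\frac1{16}$ be the side lengths of the copies of $\mathcal V^w$ in $K_1,K_2,K_3$, and let $o_1=o_2=(0,0)$, $o_3=(\frac18,\frac3{16})$, so that $K_s$ spans the rectangle $o_s+[0,s\sigma_s]\times[0,\sigma_s]$. Cut this rectangle into squares of side $\sigma_s/4$, numbered by column and row from $(0,0)$ at the lower left. The nested structure of $\mathcal V^w$ is given by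 the directed multigraph with states $1,2,3$ and an edge $e$ from $s$ to $t$, carrying the homothety $\psi_e(x)=o_s+\frac{\sigma_s}4(i,j)+\frac{\sigma_s}{4\sigma_t}(x-o_t)$, for each position $(i,j)$ in the following list: - $1\to2$: $(0,0),(2,3)$; $1\to1$: $(3,0),(2,1),(1,2),(0,3)$; - $2\to2$: $(0,0),(6,3)$; $2\to3$: $(3,0),(2,3)$; $2\to1$: $(2,1),(1,2),(0,3),(7,0),(6,1),(5,2)$; - $3\to2$: $(0,0),(10,3)$; $3\to3$: $(3,0),(7,0),(2,3),(6,3)$; $3\to1$: $(2,1),(1,2),(0,3),(6,1),(5,2),(11,0),(10,1),(9,2)$. One has $K_s=\bigcup_{e:\,s\to t}\psi_eK_t$. For a walk $w=e_1\cdots e_n$ from $1$ to $t$ put $\psi_w=\psi_{e_1}\circ\cdots\circ\psi_{e_n}$; the sets $K_w=\psi_wK_t$ are the islands, $t$ is the type of $K_w$, and the children of $K_w$ are the islands $K_{we}$. Let $C_w$ be the union of the intersections of pairs of distinct children of $K_w$, and let $$V_t=\bigcup_{w}\psi_w^{-1}\Big(K_w\cap\bigcup_{u}C_u\Big),$$ where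 $w$ runs over the walks of positive length from $1$ to $t$ and $u$ over the proper initial segments of $w$. For finite sets $B=(B_1,B_2,B_3)$ of points, a *harmonic structure* with boundary sets $B$ is a pair $((D_s)_{s},(r_e)_e)$, where $D_s$ is a discrete Laplacian on $B_s$ (a symmetric nonpositive definite matrix with nonnegative off-diagonal entries whose kernel consists of the constants), with form $\mathcal E_s(u)=\sum_{\{x,y\}}(D_s)_{xy}(u(x)-u(y))^2$, and $r_e>0$, such that for every $s$ one has $B_s\subseteq B_{s,1}:=\bigcup_{e:\,s\to t}\psi_eB_t$ and $$\mathcal E_s(v)=\min\Big\{\sum_{e:\,s\to t}r_e^{-1}\mathcal E_t(u\circ\psi_e)\ :\ u:B_{s,1}\to\mathbb R,\ u|_{B_s}=v\Big\}\qquad\text{for all } v:B_s\to\mathbb R .$$ With $r_w=r_{e_1}\cdots r_{e_n}$, it is *regular* if $r_w<1$ for every cycle $w$ of the graph, *homogeneous* if $r_w=r_{w'}$ whenever $K_w,K_{w'}$ are islands of the same type and the same diameter, and *rotationally symmetric* if each $D_s$ is invariant under the rotation by $\pi$ of the rectangle of $K_s$ about its centre. Then $V_1,V_2,V_3$ are finite.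 Moreover, let $B$ be either the triple of vertex sets of the rectangles, $$\{q_1,q_2,q_3,q_4\},\quad\{q_1,F_5q_2,F_5q_3,F_1q_4\},\quad\{F_1F_8q_1,F_5F_4q_2,F_5F_4q_3,F_1F_8q_4\},$$ or the triple $(V_1,V_2,V_3)$. In both cases there is a triple $(D^0_s)$ of Laplacians on the sets $B_s$ such that the following hold. 1. $((D^0_s),\,r_e\equiv\frac14)$ is a rotationally symmetric homogeneous regular harmonic structure. 2. Put $a=1$, $b=\frac{13+\sqrt{73}}{16}$, $c=2$, $d=\frac{3(13+\sqrt{73})}{16}$, $e=\frac{11+7\sqrt{73}}{16}$. The restriction (trace) of $D^0_1$ to $\{q_4,q_3,q_2\}$ is the $Y$-shaped network whose arms at $q_4,q_3,q_2$ have resistances $a,b,c$, and its restriction to $\{q_2,q_1,q_4\}$ is the $Y$-shaped network whose arms at $q_2,q_1,q_4$ have resistances $a,b,c$. The restriction of $D^0_2$ to $\{q_1,F_5q_3\}$ is a resistor of resistance $d$. The restrictions of $D^0_3$ to $\{F_1F_8q_1,F_5F_4q_2\}$ and to $\{F_1F_8q_4,F_5F_4q_3\}$ are resistors of resistance $e$.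 3. For a real number $\rho$, a pair $((D_s),\,r_e\equiv\rho)$ is a rotationally symmetric homogeneous regular harmonic structure if and only if $\rho=\frac14$ and there is $\kappa>0$ with $D_s=\kappa D^0_s$ for all $s$. 4. Without requiring $r$ to be constant, $((D_s),(r_e))$ is a rotationally symmetric homogeneous regular harmonic structure if and only if there are $\kappa_1,\kappa_2,\kappa_3>0$ with $D_s=\kappa_sD^0_s$ for all $s$ and $r_e=\frac14\,\kappa_t/\kappa_s$ for every edge $e$ from $s$ to $t$. -/

import Mathlib

noncomputable section

namespace Windmill

/-- The Euclidean plane. -/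
abbrev Plane := EuclideanSpace ℝ (Fin 2)

/-! ### Walks in a directed multigraph -/

section Walks

variable {S E : Type}

/-- `IsWalk ini fin s w t`: the list of edges `w` is a walk from the state `s` to the state `t`
(the empty list is the walk of length zero from `s` to `s`). -/
def IsWalk (ini fin : E → S) : S → List E → S → Prop
  | s, [], t => s = t
  | s, e :: w, t => ini e = s ∧ IsWalk ini fin (fin e) w t

/-- The composition `ψ_{e₁} ∘ ⋯ ∘ ψ_{eₙ}` along a list of edges. -/
def walkMap (ψ : E → Plane → Plane) : List E → Plane → Plane
  | [] => id
  | e :: w => ψ e ∘ walkMap ψ w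

/-- The product of edge weights `r_{e₁} ⋯ r_{eₙ}` along a list of edges. -/
def walkProd (r : E → ℝ) (w : List E) : ℝ := (w.map r).prod

end Walks

/-! ### Graph-directed families and the nested structure of a state -/

/-- A graph-directed construction in the plane (finite directed multigraph whose edges carry
similitudes, every state having an outgoing edge, every cycle being contracting), together with
its vector of nonempty compact invariant sets `K`. -/
structure GraphDirectedFamily (S E : Type) where
  /-- initial state of an edge -/
  ini : E → S
  /-- final state of an edge -/
  fin : E → S
  /-- the similitude of an edge -/
  ψ : E → Plane → Plane
  /-- the similarity ratio of an edge -/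
  ratio : E → ℝ
  /-- the invariant sets -/
  K : S → Set Plane
  ratio_pos : ∀ e, 0 < ratio e
  similitude : ∀ e x y, dist (ψ e x) (ψ e y) = ratio e * dist x y
  exists_edge : ∀ s, ∃ e, ini e = s
  cycle_lt_one : ∀ s w, w ≠ [] → IsWalk ini fin s w s → walkProd ratio w < 1
  isCompact_K : ∀ s, IsCompact (K s)
  nonempty_K : ∀ s, (K s).Nonempty
  K_eq : ∀ s, K s = ⋃ e, ⋃ _ : ini e = s, ψ e '' K (fin e)

namespace GraphDirectedFamily

variable {S E : Type} (G : GraphDirectedFamily S E)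

/-- The island `ψ_w K_t` of a walk `w` that ends at the state `t`.  The islands of the nested
structure of `K_o` are those of the walks `w` that start at `o`; the type of such an island is the
final state `t` of `w`, its children are the islands of the walks `w ++ [e]`, and `ψ_w` is the
chosen similitude from the representative `K_t` of its type onto it. -/
def island (w : List E) (t : S) : Set Plane := walkMap G.ψ w '' G.K t

/-- The union of the pairwise intersections of the distinct children of the island of the walk `w`
with final state `t`. -/
def childIntersections (w : List E) (t : S) : Set Plane :=
  {x | ∃ e e' : E, e ≠ e' ∧ G.ini e = t ∧ G.ini e' = t ∧
    x ∈ G.island (w ++ [e]) (G.fin e) ∧ x ∈ G.island (w ++ [e']) (G.fin e')}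

/-- The boundary `V_t` of the representative `K_t` of the type `t` in the nested structure with
root state `o`: the union over all islands `β` of type `t` other than the root of the pull-backs to
`K_t` of `K_β ∩ ⋃_{n ≥ 1} C_{Pⁿ(β)}`, where the `Pⁿ(β)` are the proper ancestors of `β` and
`C_γ` is the union of the pairwise intersections of the children of `γ`. -/
def boundary (o t : S) : Set Plane :=
  {x | ∃ w : List E, w ≠ [] ∧ IsWalk G.ini G.fin o w t ∧ x ∈ G.K t ∧
    ∃ (u v : List E) (s : S), w = u ++ v ∧ v ≠ [] ∧ IsWalk G.ini G.fin o u s ∧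
      walkMap G.ψ w x ∈ G.childIntersections u s}

end GraphDirectedFamily

/-! ### Finite resistance networks -/

/-- A discrete Laplacian on the finite set `V`. -/
structure IsLaplacian {V : Finset Plane} (H : Matrix V V ℝ) : Prop where
  symm : H.IsSymm
  nonpos : ∀ u : V → ℝ, u ⬝ᵥ H.mulVec u ≤ 0
  ker : ∀ u : V → ℝ, H.mulVec u = 0 ↔ ∃ c : ℝ, ∀ x, u x = c
  offDiag : ∀ x y : V, x ≠ y → 0 ≤ H x y

/-- The Dirichlet form `ℰ_H(u) = ∑ H_{xy} (u(x) - u(y))²`, each unordered pair `{x, y}` being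
counted once. -/
def energy {V : Finset Plane} (H : Matrix V V ℝ) (u : V → ℝ) : ℝ :=
  (1 / 2) * ∑ x, ∑ y, H x y * (u x - u y) ^ 2

/-- The quadratic form `Q` is the trace of `ℰ_H` on the subset `T` of `V`: the restriction of the
network to `T`.  Functions on `T` and the values of `Q` on them are written through functions on
the plane. -/
def HasTrace {V : Finset Plane} (H : Matrix V V ℝ) (T : Set Plane) (Q : (Plane → ℝ) → ℝ) : Prop :=
  T ⊆ (V : Set Plane) ∧ ∀ v : Plane → ℝ,
    IsLeast {m : ℝ | ∃ u : V → ℝ, (∀ x : V, (x : Plane) ∈ T → u x = v x) ∧ energy H u = m} (Q v)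

/-- The restriction of the network to the two distinct points `p`, `q` is a single resistor of
resistance `ρ > 0`. -/
def HasResistance {V : Finset Plane} (H : Matrix V V ℝ) (p q : Plane) (ρ : ℝ) : Prop :=
  p ≠ q ∧ 0 < ρ ∧ HasTrace H {p, q} (fun v => (v p - v q) ^ 2 / ρ)

/-- The restriction of the network to the three distinct points `p₁`, `p₂`, `p₃` is a `Y`-shaped
network: an additional centre is joined to `p₁`, `p₂`, `p₃` by resistors of resistances
`ρ₁, ρ₂, ρ₃ > 0` (the infimum runs over the potential of the centre). -/
def HasYRestriction {V : Finset Plane} (H : Matrix V V ℝ) (p₁ p₂ p₃ : Plane) (ρ₁ ρ₂ ρ₃ : ℝ) :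
    Prop :=
  (p₁ ≠ p₂ ∧ p₁ ≠ p₃ ∧ p₂ ≠ p₃) ∧ (0 < ρ₁ ∧ 0 < ρ₂ ∧ 0 < ρ₃) ∧
    HasTrace H {p₁, p₂, p₃}
      (fun v => ⨅ z : ℝ, ((v p₁ - z) ^ 2 / ρ₁ + (v p₂ - z) ^ 2 / ρ₂ + (v p₃ - z) ^ 2 / ρ₃))

/-! ### Harmonic structures -/

section Harmonic

variable {S E : Type} [DecidableEq S] [Fintype E] (G : GraphDirectedFamily S E)
  (B : S → Finset Plane) (D : ∀ s, Matrix (B s) (B s) ℝ) (r : E → ℝ)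

/-- The vertices of level one, `V_{s,1} = ⋃_{i(e) = s} ψ_e V_{f(e)}`. -/
def levelOneVertices (s : S) : Set Plane :=
  ⋃ e, ⋃ _ : G.ini e = s, G.ψ e '' (B (G.fin e) : Set Plane)

/-- The form of level one,
`ℰ_{s,1}(u) = ∑_{i(e) = s} r_e⁻¹ ℰ_{f(e),0}(u ∘ ψ_e)`.
It depends only on the restriction of `u` to `V_{s,1}`. -/
def levelOneEnergy (s : S) (u : Plane → ℝ) : ℝ :=
  ∑ e with G.ini e = s, (r e)⁻¹ * energy (D (G.fin e)) (fun x => u (G.ψ e x))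

/-- Harmonic structures with respect to boundary sets `B`: Laplacians `D_s` on `B_s` and positive
renormalization factors `r_e` that satisfy the renormalization equations
`(V_s, D_s) ≤ (V_{s,1}, H_{s,1})`. -/
structure IsHarmonicStructure : Prop where
  isLaplacian : ∀ s, IsLaplacian (D s)
  pos : ∀ e, 0 < r e
  subset : ∀ s, (B s : Set Plane) ⊆ levelOneVertices G B s
  renormalization : ∀ (s : S) (v : B s → ℝ),
    IsLeast {m : ℝ | ∃ u : Plane → ℝ, (∀ x : B s, u x = v x) ∧ levelOneEnergy G B D r s u = m}
      (energy (D s) v)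

/-- Regularity: the product of the renormalization factors along every cycle is less than one. -/
def IsRegular : Prop :=
  ∀ (s : S) (w : List E), w ≠ [] → IsWalk G.ini G.fin s w s → walkProd r w < 1

/-- Homogeneity for the nested structure with root state `o`: islands of the same type and the same
size have the same product of renormalization factors along their walks from the root. -/
def IsHomogeneous (o : S) : Prop :=
  ∀ (t : S) (w w' : List E), IsWalk G.ini G.fin o w t → IsWalk G.ini G.fin o w' t →
    Metric.diam (G.island w t) = Metric.diam (G.island w' t) → walkProd r w = walkProd r w'

end Harmonic

/-! ### The Vicsek windmill set -/

/-- The translation parts of the eight contractions. -/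
def shift : Fin 8 → Plane :=
  ![!₂[0, 0], !₂[3 / 4, 0], !₂[3 / 4, 3 / 4], !₂[0, 3 / 4],
    !₂[1 / 4, 0], !₂[1 / 2, 1 / 4], !₂[1 / 4, 1 / 2], !₂[1 / 2, 3 / 4]]

/-- The eight contractions; `F i` is the map usually written with the index `i + 1`. -/
def F (i : Fin 8) (x : Plane) : Plane := (1 / 4 : ℝ) • x + shift i

/-- The vertices of the unit square, numbered counterclockwise from the origin (`q i` is the vertex
usually written with the index `i + 1`). -/
def q : Fin 4 → Plane := ![!₂[0, 0], !₂[1, 0], !₂[1, 1], !₂[0, 1]]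

lemma dist_F (i : Fin 8) (x y : Plane) : dist (F i x) (F i y) = 1 / 4 * dist x y := by
  simp [F, dist_smul₀]

lemma continuous_F (i : Fin 8) : Continuous (F i) := by unfold F; fun_prop

open TopologicalSpace in
/-- The Hutchinson operator on nonempty compact sets. -/
def hutchinson (A : NonemptyCompacts Plane) : NonemptyCompacts Plane where
  carrier := ⋃ i, F i '' (A : Set Plane)
  isCompact' := isCompact_iUnion fun i => A.isCompact.image (continuous_F i)
  nonempty' := Set.nonempty_iUnion.2 ⟨0, A.nonempty.image _⟩

open TopologicalSpace in
lemma contracting_hutchinson : ContractingWith (1 / 4) hutchinson := by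
  refine ⟨by rw [← NNReal.coe_lt_coe]; norm_num, fun A A' => ?_⟩
  change Metric.hausdorffEDist (⋃ i, F i '' (A : Set Plane)) (⋃ i, F i '' (A' : Set Plane)) ≤ _
  refine Metric.hausdorffEDist_iUnion_le.trans (iSup_le fun i => ?_)
  have h4 : ∀ x y : Plane, edist (F i x) (F i y) = ((1 / 4 : NNReal) : ENNReal) * edist x y := by
    intro x y
    rw [edist_nndist, edist_nndist, ← ENNReal.coe_mul]
    congr 1
    apply NNReal.coe_injective
    push_cast
    simpa using dist_F i x y
  have key : ∀ A A' : NonemptyCompacts Plane, ∀ x ∈ (F i '' (A : Set Plane)),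
      Metric.infEDist x (F i '' (A' : Set Plane)) ≤ ((1 / 4 : NNReal) : ENNReal) *
        Metric.hausdorffEDist (A : Set Plane) A' := by
    rintro A A' _ ⟨x, hx, rfl⟩
    obtain ⟨y, hy, hxy⟩ := A'.isCompact.exists_infEDist_eq_edist A'.nonempty x
    calc _ ≤ edist (F i x) (F i y) :=
          Metric.infEDist_le_edist_of_mem (Set.mem_image_of_mem _ hy)
      _ = ((1 / 4 : NNReal) : ENNReal) * Metric.infEDist x A' := by rw [h4, hxy]
      _ ≤ _ := by gcongr; exact Metric.infEDist_le_hausdorffEDist_of_mem hx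
  refine Metric.hausdorffEDist_le_of_infEDist (key A A') fun x hx => ?_
  rw [show edist A A' = Metric.hausdorffEDist (A' : Set Plane) A from Metric.hausdorffEDist_comm]
  exact key A' A x hx

open TopologicalSpace in
/-- There is exactly one nonempty compact set that is invariant under the eight contractions. -/
theorem existsUnique_invariant :
    ∃! A : Set Plane, IsCompact A ∧ A.Nonempty ∧ A = ⋃ i, F i '' A := by
  have : Nonempty (NonemptyCompacts Plane) := ⟨⟨⟨{0}, isCompact_singleton⟩, by simp⟩⟩
  let A := ContractingWith.fixedPoint hutchinson contracting_hutchinson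
  have hA : hutchinson A = A := contracting_hutchinson.fixedPoint_isFixedPt
  refine ⟨A, ⟨A.isCompact, A.nonempty, (congrArg SetLike.coe hA).symm⟩, ?_⟩
  rintro A' ⟨hc, hn, he⟩
  have := contracting_hutchinson.fixedPoint_unique (x := ⟨⟨A', hc⟩, hn⟩)
    (NonemptyCompacts.ext he.symm)
  exact congrArg SetLike.coe this

/-- The Vicsek windmill set. -/
def windmillSet : Set Plane := existsUnique_invariant.choose

lemma windmillSet_spec : IsCompact windmillSet ∧ windmillSet.Nonempty ∧
    windmillSet = ⋃ i, F i '' windmillSet := existsUnique_invariant.choose_spec.1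

/-! ### The nested structure of the windmill set -/

/-- The representatives of the three types of islands: the windmill set, two adjacent copies of it,
and three adjacent copies of it in a row. -/
def windmillK : Fin 3 → Set Plane :=
  ![windmillSet,
    F 0 '' windmillSet ∪ F 4 '' windmillSet,
    F 0 '' (F 7 '' windmillSet) ∪ F 0 '' (F 2 '' windmillSet) ∪ F 4 '' (F 3 '' windmillSet)]

/-- The side length of the copies of the windmill set that make up the representatives. -/
def side : Fin 3 → ℝ := ![1, 1 / 4, 1 / 16]

/-- The lower left vertices of the rectangles spanned by the representatives. -/
def corner : Fin 3 → Plane := ![!₂[0, 0], !₂[0, 0], !₂[1 / 8, 3 / 16]]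

/-- The cutting rule.  The rectangle spanned by the representative of type `s` is cut into small
squares of side `side s / 4`; a quadruple `(s, t, i, j)` stands for a child of type `t` whose lower
left small square is the one in column `i` and row `j` (counted from zero). -/
def windmillCuts : Finset (Fin 3 × Fin 3 × ℕ × ℕ) :=
  {(0, 1, 0, 0), (0, 1, 2, 3),
   (0, 0, 3, 0), (0, 0, 2, 1), (0, 0, 1, 2), (0, 0, 0, 3),
   (1, 1, 0, 0), (1, 1, 6, 3), (1, 2, 3, 0), (1, 2, 2, 3),
   (1, 0, 2, 1), (1, 0, 1, 2), (1, 0, 0, 3), (1, 0, 7, 0), (1, 0, 6, 1), (1, 0, 5, 2),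
   (2, 1, 0, 0), (2, 1, 10, 3), (2, 2, 3, 0), (2, 2, 7, 0), (2, 2, 2, 3), (2, 2, 6, 3),
   (2, 0, 2, 1), (2, 0, 1, 2), (2, 0, 0, 3), (2, 0, 6, 1), (2, 0, 5, 2),
   (2, 0, 11, 0), (2, 0, 10, 1), (2, 0, 9, 2)}

/-- The edges of the directed graph: one for each child of a representative. -/
abbrev WindmillEdge := {e // e ∈ windmillCuts}

/-- The orientation-preserving homothety that maps the representative of type `t` onto the child
`(s, t, i, j)` of the representative of type `s`. -/
def windmillPsi (e : Fin 3 × Fin 3 × ℕ × ℕ) (x : Plane) : Plane :=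
  corner e.1 + (side e.1 / 4) • !₂[(e.2.2.1 : ℝ), (e.2.2.2 : ℝ)] +
    (side e.1 / (4 * side e.2.1)) • (x - corner e.2.1)

lemma shift_apply :
    (shift 0 0 = 0 ∧ shift 1 0 = 3 / 4 ∧ shift 2 0 = 3 / 4 ∧ shift 3 0 = 0 ∧
      shift 4 0 = 1 / 4 ∧ shift 5 0 = 1 / 2 ∧ shift 6 0 = 1 / 4 ∧ shift 7 0 = 1 / 2) ∧
    (shift 0 1 = 0 ∧ shift 1 1 = 0 ∧ shift 2 1 = 3 / 4 ∧ shift 3 1 = 3 / 4 ∧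
      shift 4 1 = 0 ∧ shift 5 1 = 1 / 4 ∧ shift 6 1 = 1 / 2 ∧ shift 7 1 = 3 / 4) :=
  ⟨⟨rfl, rfl, rfl, rfl, rfl, rfl, rfl, rfl⟩, ⟨rfl, rfl, rfl, rfl, rfl, rfl, rfl, rfl⟩⟩

lemma corner_side_apply :
    (corner 0 0 = 0 ∧ corner 1 0 = 0 ∧ corner 2 0 = 1 / 8) ∧
    (corner 0 1 = 0 ∧ corner 1 1 = 0 ∧ corner 2 1 = 3 / 16) ∧
    (side 0 = 1 ∧ side 1 = 1 / 4 ∧ side 2 = 1 / 16) :=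
  ⟨⟨rfl, rfl, rfl⟩, ⟨rfl, rfl, rfl⟩, ⟨rfl, rfl, rfl⟩⟩

lemma side_pos (s : Fin 3) : 0 < side s := by
  fin_cases s <;> norm_num [side]

lemma walkProd_ratio {t : Fin 3} (w : List WindmillEdge) : ∀ s,
    IsWalk (fun e : WindmillEdge => e.1.1) (fun e => e.1.2.1) s w t →
    walkProd (fun e : WindmillEdge => side e.1.1 / (4 * side e.1.2.1)) w =
      side s / side t * (1 / 4) ^ w.length := by
  induction w with
  | nil =>
    rintro s rfl
    simp [walkProd, (side_pos s).ne']
  | cons e w ih =>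
    rintro s ⟨rfl, h⟩
    have := ih _ h
    simp only [walkProd, List.map_cons, List.prod_cons, List.length_cons] at this ⊢
    rw [this]
    have h1 := (side_pos e.1.2.1).ne'
    have h2 := (side_pos t).ne'
    rw [pow_succ]
    field_simp

/-- The copy of the windmill set in the square with lower left vertex `(a, b)` and side `c`. -/
def cell (a b c : ℝ) : Set Plane := {x | ∃ y ∈ windmillSet, x = !₂[a + c * y 0, b + c * y 1]}

lemma cell_eq (a b c : ℝ) : cell a b c =
    ⋃ i, cell (a + c * shift i 0) (b + c * shift i 1) (c / 4) := by
  ext x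
  simp only [cell, Set.mem_iUnion, Set.mem_ofPred_eq]
  constructor
  · rintro ⟨y, hy, rfl⟩
    rw [windmillSet_spec.2.2] at hy
    obtain ⟨i, z, hz, rfl⟩ := Set.mem_iUnion.1 hy
    refine ⟨i, z, hz, ?_⟩
    ext k; fin_cases k <;> simp [F] <;> ring
  · rintro ⟨i, z, hz, rfl⟩
    refine ⟨F i z, ?_, ?_⟩
    · rw [windmillSet_spec.2.2]
      exact Set.mem_iUnion.2 ⟨i, z, hz, rfl⟩
    · ext k; fin_cases k <;> simp [F] <;> ring

lemma windmillPsi_image_cell (e : Fin 3 × Fin 3 × ℕ × ℕ) (a b c : ℝ) :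
    windmillPsi e '' cell a b c =
      cell (corner e.1 0 + side e.1 / 4 * e.2.2.1 +
          side e.1 / (4 * side e.2.1) * (a - corner e.2.1 0))
        (corner e.1 1 + side e.1 / 4 * e.2.2.2 +
          side e.1 / (4 * side e.2.1) * (b - corner e.2.1 1))
        (side e.1 / (4 * side e.2.1) * c) := by
  ext x
  simp only [cell, Set.mem_image, Set.mem_ofPred_eq]
  constructor
  · rintro ⟨_, ⟨y, hy, rfl⟩, rfl⟩
    refine ⟨y, hy, ?_⟩
    ext k; fin_cases k <;> simp [windmillPsi] <;> ring
  · rintro ⟨y, hy, rfl⟩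
    refine ⟨_, ⟨y, hy, rfl⟩, ?_⟩
    ext k; fin_cases k <;> simp [windmillPsi] <;> ring

lemma F_image_cell (i : Fin 8) (a b c : ℝ) :
    F i '' cell a b c = cell (a / 4 + shift i 0) (b / 4 + shift i 1) (c / 4) := by
  ext x
  simp only [cell, Set.mem_image, Set.mem_ofPred_eq]
  constructor
  · rintro ⟨_, ⟨y, hy, rfl⟩, rfl⟩
    refine ⟨y, hy, ?_⟩
    ext k; fin_cases k <;> simp [F] <;> ring
  · rintro ⟨y, hy, rfl⟩
    refine ⟨_, ⟨y, hy, rfl⟩, ?_⟩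
    ext k; fin_cases k <;> simp [F] <;> ring

lemma windmillSet_eq_cell : windmillSet = cell 0 0 1 := by
  ext x
  simp only [cell, Set.mem_ofPred_eq]
  constructor
  · intro hx
    refine ⟨x, hx, ?_⟩
    ext k; fin_cases k <;> simp
  · rintro ⟨y, hy, rfl⟩
    have : (!₂[0 + 1 * y 0, 0 + 1 * y 1] : Plane) = y := by
      ext k; fin_cases k <;> simp
    rwa [this]

lemma windmillK_zero : windmillK 0 = cell 0 0 1 := windmillSet_eq_cell

lemma windmillK_one : windmillK 1 = cell 0 0 (1 / 4) ∪ cell (1 / 4) 0 (1 / 4) := by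
  change F 0 '' windmillSet ∪ F 4 '' windmillSet = _
  simp only [windmillSet_eq_cell, F_image_cell, shift_apply]
  norm_num

lemma windmillK_two : windmillK 2 = cell (1 / 8) (3 / 16) (1 / 16) ∪
    cell (3 / 16) (3 / 16) (1 / 16) ∪ cell (1 / 4) (3 / 16) (1 / 16) := by
  change F 0 '' (F 7 '' windmillSet) ∪ F 0 '' (F 2 '' windmillSet) ∪
    F 4 '' (F 3 '' windmillSet) = _
  simp only [windmillSet_eq_cell, F_image_cell, shift_apply]
  norm_num

lemma iUnion_fin_eight (A : Fin 8 → Set Plane) : ⋃ i, A i =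
    A 0 ∪ A 1 ∪ A 2 ∪ A 3 ∪ A 4 ∪ A 5 ∪ A 6 ∪ A 7 := by
  ext x
  simp [Fin.exists_fin_succ, or_assoc]

lemma mem_children (s : Fin 3) (x : Plane) :
    (x ∈ ⋃ e : WindmillEdge, ⋃ _ : e.1.1 = s, windmillPsi e.1 '' windmillK e.1.2.1) ↔
      ∃ e ∈ windmillCuts, e.1 = s ∧ x ∈ windmillPsi e '' windmillK e.2.1 := by
  simp only [Set.mem_iUnion, Subtype.exists, exists_prop]

lemma windmillK_eq (s : Fin 3) : windmillK s =
    ⋃ e : WindmillEdge, ⋃ _ : e.1.1 = s, windmillPsi e.1 '' windmillK e.1.2.1 := by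
  ext x
  rw [mem_children]
  fin_cases s
  · change x ∈ windmillK 0 ↔ ∃ e ∈ windmillCuts, e.1 = 0 ∧ _
    rw [windmillK_zero, cell_eq, iUnion_fin_eight]
    simp only [windmillCuts, Finset.mem_insert, Finset.mem_singleton, or_and_right, exists_or,
      exists_eq_left, windmillK_zero, windmillK_one, windmillK_two, Set.image_union,
      windmillPsi_image_cell, shift_apply, corner_side_apply, Set.mem_union, true_and, false_and,
      or_false, Fin.reduceEq, one_ne_zero, Nat.cast_ofNat, Nat.cast_zero, Nat.cast_one]
    norm_num only
    tauto
  · change x ∈ windmillK 1 ↔ ∃ e ∈ windmillCuts, e.1 = 1 ∧ _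
    rw [windmillK_one, cell_eq 0, cell_eq (1 / 4), iUnion_fin_eight, iUnion_fin_eight]
    simp only [windmillCuts, Finset.mem_insert, Finset.mem_singleton, or_and_right, exists_or,
      exists_eq_left, windmillK_zero, windmillK_one, windmillK_two, Set.image_union,
      windmillPsi_image_cell, shift_apply, corner_side_apply, Set.mem_union, true_and, false_and,
      or_false, Fin.reduceEq, zero_ne_one, false_or, Nat.cast_ofNat, Nat.cast_zero, Nat.cast_one]
    norm_num only
    constructor <;> simp only [or_imp] <;> repeat' apply And.intro
    all_goals intro h; simp only [h, true_or, or_true]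
  · change x ∈ windmillK 2 ↔ ∃ e ∈ windmillCuts, e.1 = 2 ∧ _
    rw [windmillK_two, cell_eq (1 / 8), cell_eq (3 / 16), cell_eq (1 / 4), iUnion_fin_eight,
      iUnion_fin_eight, iUnion_fin_eight]
    simp only [windmillCuts, Finset.mem_insert, Finset.mem_singleton, or_and_right, exists_or,
      exists_eq_left, windmillK_zero, windmillK_one, windmillK_two, Set.image_union,
      windmillPsi_image_cell, shift_apply, corner_side_apply, Set.mem_union, true_and, false_and,
      Fin.reduceEq, false_or, Nat.cast_ofNat, Nat.cast_zero, Nat.cast_one]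
    norm_num only
    constructor <;> simp only [or_imp] <;> repeat' apply And.intro
    all_goals intro h; simp only [h, true_or, or_true]

/-- The graph-directed family `(K₁, K₂, K₃)` of the windmill set (with states numbered from zero);
the nested structure of the windmill set is the one with root state `0`. -/
def windmill : GraphDirectedFamily (Fin 3) WindmillEdge where
  ini e := e.1.1
  fin e := e.1.2.1
  ψ e := windmillPsi e.1
  ratio e := side e.1.1 / (4 * side e.1.2.1)
  K := windmillK
  ratio_pos e := div_pos (side_pos _) (mul_pos (by norm_num) (side_pos _))
  similitude e x y := by
    have : 0 ≤ side e.1.1 / (4 * side e.1.2.1) :=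
      (div_pos (side_pos _) (mul_pos (by norm_num) (side_pos _))).le
    simp only [windmillPsi, dist_add_left, dist_smul₀, dist_sub_right, Real.norm_of_nonneg this]
  exists_edge s := by
    fin_cases s
    · exact ⟨⟨(0, 0, 3, 0), by decide⟩, rfl⟩
    · exact ⟨⟨(1, 1, 0, 0), by decide⟩, rfl⟩
    · exact ⟨⟨(2, 1, 0, 0), by decide⟩, rfl⟩
  cycle_lt_one s w hw h := by
    rw [walkProd_ratio w s h, div_self (side_pos s).ne', one_mul]
    exact pow_lt_one₀ (by norm_num) (by norm_num) (by simpa using hw)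
  isCompact_K s := by
    have h := windmillSet_spec.1
    fin_cases s
    · exact h
    · exact (h.image (continuous_F _)).union (h.image (continuous_F _))
    · exact (((h.image (continuous_F _)).image (continuous_F _)).union
        ((h.image (continuous_F _)).image (continuous_F _))).union
        ((h.image (continuous_F _)).image (continuous_F _))
  nonempty_K s := by
    have h := windmillSet_spec.2.1
    fin_cases s
    · exact h
    · exact (h.image _).inl
    · exact ((h.image _).image _).inl.inl
  K_eq := windmillK_eq

/-- The vertices of the rectangles spanned by the representatives. -/
def rectVertices : Fin 3 → Set Plane :=
  ![{q 0, q 1, q 2, q 3},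
    {q 0, F 4 (q 1), F 4 (q 2), F 0 (q 3)},
    {F 0 (F 7 (q 0)), F 4 (F 3 (q 1)), F 4 (F 3 (q 2)), F 0 (F 7 (q 3))}]

/-- The rotation by the angle `π` about the centre of the rectangle spanned by the representative of
type `s`; this rectangle has side lengths `(s + 1) * side s` and `side s`. -/
def halfTurn (s : Fin 3) (x : Plane) : Plane :=
  (2 : ℝ) • corner s + !₂[((s : ℕ) + 1) * side s, side s] - x

/-- Rotational symmetry: every `D s` is invariant under the rotation of the representative. -/
def IsRotationSymmetric (B : Fin 3 → Finset Plane) (D : ∀ s, Matrix (B s) (B s) ℝ) : Prop :=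
  ∀ (s : Fin 3) (x y x' y' : B s), (x' : Plane) = halfTurn s x → (y' : Plane) = halfTurn s y →
    D s x' y' = D s x y

/-- Rotationally symmetric homogeneous regular harmonic structures on the nested structure of the
windmill set, with respect to boundary sets `B`. -/
structure IsWindmillStructure (B : Fin 3 → Finset Plane) (D : ∀ s, Matrix (B s) (B s) ℝ)
    (r : WindmillEdge → ℝ) : Prop where
  harmonic : IsHarmonicStructure windmill B D r
  regular : IsRegular windmill r
  homogeneous : IsHomogeneous windmill r 0
  symmetric : IsRotationSymmetric B D

/-- The restricted networks of `D` have the resistances `a, b, c` (in the `Y`-shaped restrictions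
of `D 0`), `d` (along a diagonal of the second rectangle) and `e` (along a long side of the third
rectangle). -/
structure HasResistances {B : Fin 3 → Finset Plane} (D : ∀ s, Matrix (B s) (B s) ℝ)
    (a b c d e : ℝ) : Prop where
  y_upper : HasYRestriction (D 0) (q 3) (q 2) (q 1) a b c
  y_lower : HasYRestriction (D 0) (q 1) (q 0) (q 3) a b c
  diagonal : HasResistance (D 1) (q 0) (F 4 (q 2)) d
  long_lower : HasResistance (D 2) (F 0 (F 7 (q 0))) (F 4 (F 3 (q 1))) e
  long_upper : HasResistance (D 2) (F 0 (F 7 (q 3))) (F 4 (F 3 (q 2))) e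

end Windmill

end

noncomputable section

namespace Windmill

/-! The children of a representative meet only at vertices of their rectangles, so in a network of
level one each cell matters only through a small restriction: a `Y` with arms `a, b, c` for a cell
of type 0, a diagonal resistor `d` for type 1, and a long-side resistor `e` for type 2. With these
restrictions inserted, series reduction turns the level-one network of state `s` into a ladder with
`s + 1` rungs, pendant resistors `P = b + d` and `M = 2a + c`, rungs `g = 2c` and rails `f = a + e +
b` (`HasTraces.levelSum_iff`). Hence five numbers determine the whole level-one network, and the
renormalization equations say exactly that each `D s` is the restriction of its ladder
(`isHarmonicStructure_iff_isLadderTrace`).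

Restricting the ladders to the same contact vertices gives new values of `a, b, c, d, e`
(`IsLadderTrace.hasTraces`). Self-consistency is a system of five equations: its linear part forces
`ρ = 1/4`, `c = 2a`, `d = 3b`, `e = 7b - 5a`, and what remains is a quadratic equation for `b/a`
with one admissible root (`solve_resistances`). So the resistances are unique up to one scale, and
they determine the ladders and therefore `D`. Conversely, restricting the ladders built from the
solution gives Laplacians with these resistances (`exists_isLadderTrace`, `IsStandard.hasTraces`),
which is existence.

Non-constant factors reduce to a constant one. Islands of equal type have equal diameter exactly
when their walks have equal length, so homogeneity forces `r e = ρ * c t / c s`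
(`exists_eq_of_isHomogeneous`), and dividing each form by `c s` removes the quotient. Both choices
of boundary sets are treated together: all that is used is that they consist of rectangle vertices,
contain the contact vertices and are invariant under the half turn (`IsVertexBoundary`). The set
`V_t` consists of the contact vertices exactly (`boundary_eq`).

Minima are handled throughout by epigraphs: a statement "energy at most `m`" turns restriction to
fewer vertices into an existential quantifier over the forgotten potentials, and networks are
composed by splitting and adding energy budgets. -/

lemma isLeast_iff_epigraph {α : Type*} {P : α → Prop} {f : α → ℝ} {a : ℝ} :
    IsLeast {m : ℝ | ∃ u, P u ∧ f u = m} a ↔ ∀ m, a ≤ m ↔ ∃ u, P u ∧ f u ≤ m := by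
  constructor
  · rintro ⟨⟨u, hu, hf⟩, h⟩ m
    exact ⟨fun hm => ⟨u, hu, hf.trans_le hm⟩, fun ⟨w, hw, hm⟩ => (h ⟨w, hw, rfl⟩).trans hm⟩
  · intro h
    -- The instance `m = a` yields a minimizer, so attainment is part of the epigraph statement.
    obtain ⟨u, hu, hf⟩ := (h a).1 le_rfl
    refine ⟨⟨u, hu, hf.antisymm ((h _).2 ⟨u, hu, le_rfl⟩)⟩, ?_⟩
    rintro m ⟨w, hw, rfl⟩
    exact (h _).2 ⟨w, hw, le_rfl⟩

/-! ### Resistors with energy budgets -/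

/-- A resistor of resistance `r ≥ 0` between the potentials `x` and `y` dissipates at most `t`. -/
def Res (r x y t : ℝ) : Prop := 0 ≤ t ∧ (x - y) ^ 2 ≤ r * t

namespace Res

variable {r s x y z t t' : ℝ}

lemma symm (h : Res r x y t) : Res r y x t := ⟨h.1, by linarith [h.2, sq_nonneg (x - y), sub_sq_comm x y]⟩

lemma comm : Res r x y t ↔ Res r y x t := ⟨symm, symm⟩

lemma refl (r x : ℝ) : Res r x x 0 := ⟨le_rfl, by simp⟩

lemma mono (hr : 0 ≤ r) (h : Res r x y t) (ht : t ≤ t') : Res r x y t' :=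
  ⟨h.1.trans ht, h.2.trans (mul_le_mul_of_nonneg_left ht hr)⟩

lemma of_eq (h : Res r x y t) (hrs : r = s) : Res s x y t := hrs ▸ h

lemma series (hr : 0 ≤ r) (hs : 0 ≤ s) (h : Res r x y t) (h' : Res s y z t') :
    Res (r + s) x z (t + t') := by
  obtain ⟨ht, h1⟩ := h
  obtain ⟨ht', h2⟩ := h'
  refine ⟨add_nonneg ht ht', ?_⟩
  -- AM-GM bound for the cross term of `(x - z)²`, whose double supplies the mixed terms of `(r +
  -- s)(t + t')`.
  have h3 : ((x - y) * (y - z)) ^ 2 ≤ ((r * t' + s * t) / 2) ^ 2 := by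
    have : ((x - y) * (y - z)) ^ 2 ≤ (r * t) * (s * t') := by
      rw [mul_pow]; exact mul_le_mul h1 h2 (sq_nonneg _) (by positivity)
    nlinarith [sq_nonneg (r * t' - s * t)]
  have h4 := (abs_le_of_sq_le_sq' h3 (by positivity)).2
  nlinarith

/-- Voltage divider: the inner potential splits the drop, and the budget is shared, in the ratio `r
: s`. Arms of resistance zero are allowed, so `r + s = 0` is a separate case in which the two ends
coincide. -/
lemma exists_series (hr : 0 ≤ r) (hs : 0 ≤ s) (h : Res (r + s) x z t) :
    ∃ y t₁ t₂, Res r x y t₁ ∧ Res s y z t₂ ∧ t₁ + t₂ = t := by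
  obtain ⟨ht, h1⟩ := h
  rcases (add_nonneg hr hs).eq_or_lt with h0 | h0
  · have hxz : x = z := by
      rw [← h0, zero_mul] at h1
      nlinarith [pow_eq_zero_iff (two_ne_zero) |>.1 (le_antisymm h1 (sq_nonneg _))]
    subst hxz
    exact ⟨x, t, 0, ⟨ht, by simpa using mul_nonneg hr ht⟩, refl _ _, add_zero _⟩
  · refine ⟨x + (z - x) * (r / (r + s)), t * (r / (r + s)), t * (s / (r + s)),
      ⟨by positivity, ?_⟩, ⟨by positivity, ?_⟩, by field_simp⟩
    · calc _ = (x - z) ^ 2 * (r / (r + s)) ^ 2 := by ring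
        _ ≤ (r + s) * t * (r / (r + s)) ^ 2 := by gcongr
        _ = _ := by field_simp
    · calc _ = (x - z) ^ 2 * (s / (r + s)) ^ 2 := by field_simp; ring
        _ ≤ (r + s) * t * (s / (r + s)) ^ 2 := by gcongr
        _ = _ := by field_simp

lemma parallel (hr : 0 ≤ r) (hs : 0 ≤ s) (hrs : 0 < r + s) (h : Res r x y t) (h' : Res s x y t') :
    Res (r * s / (r + s)) x y (t + t') := by
  refine ⟨add_nonneg h.1 h'.1, ?_⟩
  rw [div_mul_eq_mul_div, le_div_iff₀ hrs]
  nlinarith [mul_le_mul_of_nonneg_left h.2 hs, mul_le_mul_of_nonneg_left h'.2 hr]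

/-- Parallel resistors dissipate in inverse proportion to their resistances, which dictates how the
budget is split. -/
lemma exists_parallel (hr : 0 ≤ r) (hs : 0 ≤ s) (hrs : 0 < r + s)
    (h : Res (r * s / (r + s)) x y t) :
    ∃ t₁ t₂, Res r x y t₁ ∧ Res s x y t₂ ∧ t₁ + t₂ = t := by
  obtain ⟨ht, h1⟩ := h
  refine ⟨t * (s / (r + s)), t * (r / (r + s)), ⟨by positivity, h1.trans_eq (by ring)⟩,
    ⟨by positivity, h1.trans_eq (by ring)⟩, by field_simp; ring⟩

lemma midpoint_left (h : Res (r + r) x y t) : Res r x ((x + y) / 2) (t / 2) :=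
  ⟨by linarith [h.1], by linarith [h.2, show (x - (x + y) / 2) ^ 2 = (x - y) ^ 2 / 4 by ring]⟩

lemma midpoint_right (h : Res (r + r) x y t) : Res r ((x + y) / 2) y (t / 2) :=
  ⟨by linarith [h.1], by linarith [h.2, show ((x + y) / 2 - y) ^ 2 = (x - y) ^ 2 / 4 by ring]⟩

lemma iff_div (hr : 0 < r) : Res r x y t ↔ (x - y) ^ 2 / r ≤ t := by
  rw [div_le_iff₀ hr, mul_comm]
  exact ⟨fun h => h.2, fun h => ⟨nonneg_of_mul_nonneg_right ((sq_nonneg _).trans h) hr, h⟩⟩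

/-- The dual (Thomson) bound for a current `I` through the resistor. -/
lemma two_mul_le (I : ℝ) (hr : 0 ≤ r) (h : Res r x y t) :
    2 * (I * (x - y)) ≤ r * I ^ 2 + t := by
  -- The left side is at most `4 * (r * I ^ 2) * t`, so AM-GM applies.
  have h3 : (2 * (I * (x - y))) ^ 2 ≤ (r * I ^ 2 + t) ^ 2 := by
    nlinarith [mul_le_mul_of_nonneg_left h.2 (sq_nonneg I), sq_nonneg (r * I ^ 2 - t)]
  exact (abs_le_of_sq_le_sq' h3 (add_nonneg (by positivity) h.1)).2

lemma scale (k : ℝ) (hk : 0 < k) : Res (k * r) x y t ↔ Res r x y (k * t) := by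
  simp only [Res, mul_nonneg_iff_of_pos_left hk]
  rw [show k * r * t = r * (k * t) by ring]

/-- A unit drop with the critical budget `1 / r` gives `r ≤ s`, and with `1 / s` it gives the
converse. -/
lemma eq_of_forall (hr : 0 < r) (h : ∀ x y t, Res r x y t ↔ Res s x y t) : r = s := by
  have h1 := ((h 1 0 (1 / r)).1 ⟨by positivity, by field_simp; norm_num⟩).2
  have hs : 0 < s := by
    by_contra hs
    have : s * (1 / r) ≤ 0 := mul_nonpos_of_nonpos_of_nonneg (not_lt.1 hs) (by positivity)
    linarith
  have h2 := ((h 1 0 (1 / s)).2 ⟨by positivity, by field_simp; norm_num⟩).2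
  rw [mul_one_div, le_div_iff₀ ‹_›] at h1 h2
  linarith

end Res

/-- A `Y`-shaped network with arms of resistances `a, b, c` dissipates at most `m`. -/
def Star (a b c x y z m : ℝ) : Prop :=
  ∃ w t₁ t₂ t₃, Res a x w t₁ ∧ Res b y w t₂ ∧ Res c z w t₃ ∧ t₁ + t₂ + t₃ ≤ m

/-! ### `Y`-shaped networks with energy budgets -/

namespace Star

variable {a b c a' b' c' x y z m : ℝ}

lemma scale (k : ℝ) (hk : 0 < k) :
    Star (k * a) (k * b) (k * c) x y z m ↔ Star a b c x y z (k * m) := by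
  constructor
  · rintro ⟨w, t₁, t₂, t₃, h1, h2, h3, h⟩
    exact ⟨w, _, _, _, (Res.scale k hk).1 h1, (Res.scale k hk).1 h2, (Res.scale k hk).1 h3,
      by nlinarith⟩
  · rintro ⟨w, t₁, t₂, t₃, h1, h2, h3, h⟩
    refine ⟨w, t₁ / k, t₂ / k, t₃ / k, (Res.scale k hk).2 ?_, (Res.scale k hk).2 ?_,
      (Res.scale k hk).2 ?_, ?_⟩
    · rwa [mul_div_cancel₀ _ hk.ne']
    · rwa [mul_div_cancel₀ _ hk.ne']
    · rwa [mul_div_cancel₀ _ hk.ne']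
    · rw [← add_div, ← add_div, div_le_iff₀ hk]; linarith

/-- A floating terminal takes the potential of the centre and carries no current, so its arm
disappears and the other two are in series. -/
lemma exists_first (hb : 0 ≤ b) (hc : 0 ≤ c) :
    (∃ x, Star a b c x y z m) ↔ Res (b + c) y z m := by
  constructor
  · rintro ⟨x, w, t₁, t₂, t₃, h1, h2, h3, h⟩
    exact (Res.series hb hc h2 h3.symm).mono (by positivity) (by linarith [h1.1])
  · intro h
    obtain ⟨w, t₁, t₂, h1, h2, h3⟩ := h.exists_series hb hc
    exact ⟨w, w, 0, t₁, t₂, Res.refl _ _, h1, h2.symm, by linarith⟩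

lemma rotate : Star a b c x y z m ↔ Star b c a y z x m := by
  constructor
  · rintro ⟨w, t₁, t₂, t₃, h1, h2, h3, h⟩
    exact ⟨w, t₂, t₃, t₁, h2, h3, h1, by linarith⟩
  · rintro ⟨w, t₁, t₂, t₃, h1, h2, h3, h⟩
    exact ⟨w, t₃, t₁, t₂, h3, h1, h2, by linarith⟩

lemma exists_second (ha : 0 ≤ a) (hc : 0 ≤ c) :
    (∃ y, Star a b c x y z m) ↔ Res (a + c) x z m := by
  simp only [rotate (a := a)]
  rw [exists_first hc ha, Res.comm, add_comm]

lemma exists_third (ha : 0 ≤ a) (hb : 0 ≤ b) :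
    (∃ z, Star a b c x y z m) ↔ Res (a + b) x y m := by
  simp only [rotate (a := a)]
  rw [exists_second hb ha, Res.comm, add_comm]

/-- Freeing one terminal at a time reveals the three pairwise sums, and these determine the arms.
Only the sums need be positive: a single arm may vanish. -/
lemma eq_of_forall (ha : 0 ≤ a) (hb : 0 ≤ b) (hc : 0 ≤ c) (ha' : 0 ≤ a') (hb' : 0 ≤ b')
    (hc' : 0 ≤ c') (hab : 0 < a + b) (hac : 0 < a + c) (hbc : 0 < b + c)
    (h : ∀ x y z m, Star a b c x y z m ↔ Star a' b' c' x y z m) : a = a' ∧ b = b' ∧ c = c' := by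
  have h1 := Res.eq_of_forall (s := a' + b') hab fun x y t => by
    simp only [← exists_third (c := c) ha hb, ← exists_third (c := c') ha' hb', h]
  have h2 := Res.eq_of_forall (s := a' + c') hac fun x y t => by
    simp only [← exists_second (b := b) ha hc, ← exists_second (b := b') ha' hc', h]
  have h3 := Res.eq_of_forall (s := b' + c') hbc fun x y t => by
    simp only [← exists_first (a := a) hb hc, ← exists_first (a := a') hb' hc', h]
  exact ⟨by linarith, by linarith, by linarith⟩

end Star

/-! ### Quadratic forms of resistance networks -/

/-- `Q` is the energy form of a network with nonnegative conductances. -/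
def IsNet {α : Type} [Fintype α] (Q : (α → ℝ) → ℝ) : Prop :=
  ∃ g : α → α → ℝ, (∀ i j, 0 ≤ g i j) ∧ ∀ x, Q x = ∑ i, ∑ j, g i j * (x i - x j) ^ 2

namespace IsNet

variable {α β : Type} [Fintype α] [Fintype β]

lemma zero : IsNet (fun _ : α → ℝ => 0) := ⟨0, by simp, by simp⟩

lemma add {Q Q' : (α → ℝ) → ℝ} (h : IsNet Q) (h' : IsNet Q') : IsNet (fun x => Q x + Q' x) := by
  obtain ⟨g, hg, hQ⟩ := h
  obtain ⟨g', hg', hQ'⟩ := h'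
  refine ⟨fun i j => g i j + g' i j, fun i j => add_nonneg (hg i j) (hg' i j), fun x => ?_⟩
  simp only [hQ, hQ', add_mul, Finset.sum_add_distrib]

lemma const_mul {Q : (α → ℝ) → ℝ} (h : IsNet Q) {c : ℝ} (hc : 0 ≤ c) :
    IsNet (fun x => c * Q x) := by
  obtain ⟨g, hg, hQ⟩ := h
  refine ⟨fun i j => c * g i j, fun i j => mul_nonneg hc (hg i j), fun x => ?_⟩
  simp only [hQ, Finset.mul_sum, mul_assoc]

lemma sum {ι : Type*} (s : Finset ι) {Q : ι → (α → ℝ) → ℝ} (h : ∀ i ∈ s, IsNet (Q i)) :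
    IsNet (fun x => ∑ i ∈ s, Q i x) := by
  classical
  induction s using Finset.induction_on with
  | empty => simpa using zero
  | insert a s ha ih =>
    simp only [Finset.sum_insert ha]
    exact (h a (by simp)).add (ih fun i hi => h i (by simp [hi]))

lemma edge (i j : α) {w : ℝ} (hw : 0 ≤ w) : IsNet (fun x : α → ℝ => w * (x i - x j) ^ 2) := by
  classical
  refine ⟨fun k l => if k = i ∧ l = j then w else 0, fun k l => by positivity, fun x => ?_⟩
  rw [Finset.sum_eq_single i, Finset.sum_eq_single j] <;> simp +contextual

lemma resistor (i j : α) {r : ℝ} (hr : 0 ≤ r) : IsNet (fun x : α → ℝ => (x i - x j) ^ 2 / r) := by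
  simpa only [div_eq_inv_mul] using edge i j (inv_nonneg.2 hr)

lemma comp (f : α → β) {Q : (α → ℝ) → ℝ} (h : IsNet Q) : IsNet (fun x : β → ℝ => Q (x ∘ f)) := by
  obtain ⟨g, hg, hQ⟩ := h
  simp only [hQ]
  exact sum _ fun i _ => sum _ fun j _ => edge (f i) (f j) (hg i j)

lemma nonneg {Q : (α → ℝ) → ℝ} (h : IsNet Q) (x : α → ℝ) : 0 ≤ Q x := by
  obtain ⟨g, hg, hQ⟩ := h
  rw [hQ]
  exact Finset.sum_nonneg fun i _ => Finset.sum_nonneg fun j _ => mul_nonneg (hg i j) (sq_nonneg _)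

/-- The star-mesh identity. -/
lemma star_mesh (h x : α → ℝ) (w : ℝ) :
    (∑ i, h i) * ∑ i, h i * (w - x i) ^ 2 =
      ((∑ i, h i) * w - ∑ i, h i * x i) ^ 2 +
        1 / 2 * ∑ i, ∑ j, h i * h j * (x i - x j) ^ 2 := by
  have h1 : ∑ i, ∑ j, h i * h j * (x i - x j) ^ 2 =
      2 * ((∑ i, h i) * (∑ i, h i * x i ^ 2)) - 2 * (∑ i, h i * x i) ^ 2 := by
    have e1 : ∑ i, ∑ j, h i * h j * (x i - x j) ^ 2 =
        ∑ i, ∑ j, ((h i * x i ^ 2) * h j + h i * (h j * x j ^ 2) -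
          2 * ((h i * x i) * (h j * x j))) :=
      Finset.sum_congr rfl fun i _ => Finset.sum_congr rfl fun j _ => by ring
    rw [e1]
    simp only [Finset.sum_sub_distrib, Finset.sum_add_distrib, ← Finset.mul_sum,
      ← Finset.sum_mul]
    ring
  have h2 : ∑ i, h i * (w - x i) ^ 2 =
      (∑ i, h i) * w ^ 2 - 2 * w * (∑ i, h i * x i) + ∑ i, h i * x i ^ 2 := by
    simp only [Finset.sum_mul, Finset.mul_sum, ← Finset.sum_sub_distrib, ← Finset.sum_add_distrib]
    exact Finset.sum_congr rfl fun i _ => by ring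
  rw [h1, h2]
  ring

/-- Eliminates the vertex `none` by the star-mesh identity: its optimal potential is the
conductance-weighted mean of its neighbours, and what remains is a mesh with conductances
proportional to `h i * h j`. The factor 2 in the denominator accounts for the sum over ordered
pairs. -/
lemma exists_trace_option {Q : (Option α → ℝ) → ℝ} (h : IsNet Q) :
    ∃ Q' : (α → ℝ) → ℝ, IsNet Q' ∧
      ∀ x m, Q' x ≤ m ↔ ∃ y : Option α → ℝ, (∀ i, y (some i) = x i) ∧ Q y ≤ m := by
  obtain ⟨g, hg, hQ⟩ := h
  set h : α → ℝ := fun i => g none (some i) + g (some i) none with hh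
  set S := ∑ i, h i with hS
  have h0 : ∀ i, 0 ≤ h i := fun i => add_nonneg (hg _ _) (hg _ _)
  have hQy : ∀ y : Option α → ℝ, Q y = (∑ i, ∑ j, g (some i) (some j) * (y (some i) - y (some j)) ^ 2)
      + ∑ i, h i * (y none - y (some i)) ^ 2 := by
    intro y
    rw [hQ]
    simp only [Fintype.sum_option, hh, add_mul, Finset.sum_add_distrib, sub_self]
    have : ∀ i, (y (some i) - y none) ^ 2 = (y none - y (some i)) ^ 2 := fun i => by ring
    simp only [this]
    ring
  have hS0 : 0 ≤ S := Finset.sum_nonneg fun i _ => h0 i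
  refine ⟨fun x => (∑ i, ∑ j, g (some i) (some j) * (x i - x j) ^ 2) +
    ∑ i, ∑ j, (h i * h j / (2 * S)) * (x i - x j) ^ 2,
    add ⟨_, fun i j => hg _ _, fun x => rfl⟩
      ⟨_, fun i j => div_nonneg (mul_nonneg (h0 i) (h0 j)) (by positivity), fun x => rfl⟩, ?_⟩
  have key : ∀ (x : α → ℝ) (w : ℝ), ∑ i, h i * (w - x i) ^ 2 =
      S * (w - (∑ i, h i * x i) / S) ^ 2 + ∑ i, ∑ j, (h i * h j / (2 * S)) * (x i - x j) ^ 2 := by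
    intro x w
    rcases hS0.eq_or_lt with hz | hp
    -- If `S = 0` the vertex is isolated; all mesh terms vanish, and division by zero is harmless.
    · have : ∀ i, h i = 0 := fun i =>
        (Finset.sum_eq_zero_iff_of_nonneg fun i _ => h0 i).1 hz.symm i (Finset.mem_univ i)
      simp [this, ← hz]
    · have := star_mesh h x w
      have e : ∑ i, ∑ j, (h i * h j / (2 * S)) * (x i - x j) ^ 2 =
          (1 / 2 * ∑ i, ∑ j, h i * h j * (x i - x j) ^ 2) / S := by
        simp only [Finset.mul_sum, Finset.sum_div]
        exact Finset.sum_congr rfl fun i _ => Finset.sum_congr rfl fun j _ => by field_simp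
      rw [e]
      field_simp
      rw [← hS] at this
      linarith
  intro x m
  constructor
  · intro hm
    refine ⟨fun o => o.elim ((∑ i, h i * x i) / S) x, fun i => rfl, ?_⟩
    rw [hQy]
    simpa [key] using hm
  · rintro ⟨y, hy, hm⟩
    rw [hQy] at hm
    obtain rfl : (fun i => y (some i)) = x := funext hy
    have := key (fun i => y (some i)) (y none)
    have h2 : 0 ≤ S * (y none - (∑ i, h i * y (some i)) / S) ^ 2 := by positivity
    simp only at this ⊢
    linarith

/-- Vertices outside the range of `f` are eliminated one by one, by induction on their number; a
trace of a trace is a trace. -/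
lemma exists_trace (f : α → β) (hf : Function.Injective f) {Q : (β → ℝ) → ℝ} (h : IsNet Q) :
    ∃ Q' : (α → ℝ) → ℝ, IsNet Q' ∧
      ∀ x m, Q' x ≤ m ↔ ∃ y : β → ℝ, (∀ i, y (f i) = x i) ∧ Q y ≤ m := by
  classical
  induction hk : Fintype.card β - Fintype.card α generalizing β with
  | zero =>
    have hb : Function.Bijective f := (Fintype.bijective_iff_injective_and_card f).2
      ⟨hf, (Fintype.card_le_of_injective f hf).antisymm (by omega)⟩
    let e := Equiv.ofBijective f hb
    refine ⟨fun x => Q (x ∘ e.symm), h.comp _, fun x m => ⟨fun hm => ⟨x ∘ e.symm, fun i => ?_, hm⟩, ?_⟩⟩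
    · simp [show f i = e i from rfl]
    · rintro ⟨y, hy, hm⟩
      convert hm using 2
      ext j
      obtain ⟨i, rfl⟩ := hb.2 j
      simp only [Function.comp, ← hy, show f i = e i from rfl, Equiv.symm_apply_apply]
  | succ k ih =>
    have hs : ¬ Function.Surjective f := fun hs => by
      have := Fintype.card_le_of_surjective f hs
      omega
    obtain ⟨b, hb⟩ := not_forall.1 hs
    have hb' : ∀ i, f i ≠ b := fun i hi => hb ⟨i, hi⟩
    let e := Equiv.optionSubtypeNe b
    obtain ⟨Q₁, h₁, hQ₁⟩ := (h.comp e.symm).exists_trace_option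
    have hc : Fintype.card {x // x ≠ b} = Fintype.card β - 1 := by
      rw [Fintype.card_subtype_compl]; simp
    obtain ⟨Q₂, h₂, hQ₂⟩ := ih (β := {x // x ≠ b}) (fun i => ⟨f i, hb' i⟩)
      (fun i j hij => hf (congrArg Subtype.val hij)) h₁ (by omega)
    refine ⟨Q₂, h₂, fun x m => ?_⟩
    rw [hQ₂]
    constructor
    · rintro ⟨y, hy, hm⟩
      obtain ⟨z, hz, hm⟩ := (hQ₁ _ _).1 hm
      refine ⟨z ∘ e.symm, fun i => ?_, hm⟩
      rw [← hy i, ← hz, Function.comp]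
      congr 1
      rw [Equiv.symm_apply_eq]
      rfl
    · rintro ⟨y, hy, hm⟩
      refine ⟨fun i => y i, hy, (hQ₁ _ _).2 ⟨y ∘ e, fun i => rfl, ?_⟩⟩
      convert hm using 2
      ext j
      simp

lemma exists_resistance {Q : (Fin 2 → ℝ) → ℝ} (h : IsNet Q) (hQ : 0 < Q ![1, 0]) :
    ∃ r, 0 < r ∧ ∀ x y m, Q ![x, y] ≤ m ↔ Res r x y m := by
  obtain ⟨g, hg, hx⟩ := h
  have hk : ∀ x y, Q ![x, y] = (g 0 1 + g 1 0) * (x - y) ^ 2 := by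
    intro x y
    simp [hx, Fin.sum_univ_two]
    ring
  rw [hk] at hQ
  have hp : 0 < g 0 1 + g 1 0 := by simpa using hQ
  refine ⟨(g 0 1 + g 1 0)⁻¹, by positivity, fun x y m => ?_⟩
  rw [Res.iff_div (by positivity), hk, div_inv_eq_mul, mul_comm]

/-- The Δ-Y transformation: each arm is the conductance of the opposite side divided by `S = pq + pr
+ qr`. Connectedness makes at least two sides conduct, hence `S > 0`, but one side may be missing;
this is why the arms are only nonnegative, with positive pairwise sums. -/
lemma exists_star {Q : (Fin 3 → ℝ) → ℝ} (h : IsNet Q) (hQ : ∀ x, Q x ≤ 0 → x 0 = x 1 ∧ x 0 = x 2) :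
    ∃ a b c, 0 ≤ a ∧ 0 ≤ b ∧ 0 ≤ c ∧ 0 < a + b ∧ 0 < a + c ∧ 0 < b + c ∧
      ∀ x y z m, Q ![x, y, z] ≤ m ↔ Star a b c x y z m := by
  obtain ⟨g, hg, hx⟩ := h
  obtain ⟨p, hp⟩ : ∃ p, p = g 1 2 + g 2 1 := ⟨_, rfl⟩
  obtain ⟨q, hq⟩ : ∃ q, q = g 0 2 + g 2 0 := ⟨_, rfl⟩
  obtain ⟨r, hr⟩ : ∃ r, r = g 0 1 + g 1 0 := ⟨_, rfl⟩
  have hk : ∀ x y z, Q ![x, y, z] = p * (y - z) ^ 2 + q * (x - z) ^ 2 + r * (x - y) ^ 2 := by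
    intro x y z
    simp [hx, Fin.sum_univ_three, hp, hq, hr]
    ring
  have hp0 : 0 ≤ p := hp ▸ add_nonneg (hg _ _) (hg _ _)
  have hq0 : 0 ≤ q := hq ▸ add_nonneg (hg _ _) (hg _ _)
  have hr0 : 0 ≤ r := hr ▸ add_nonneg (hg _ _) (hg _ _)
  have hqr : 0 < q + r := by
    by_contra hn
    have := hQ ![1, 0, 0] (by rw [hk]; simp; linarith)
    simp at this
  have hpr : 0 < p + r := by
    by_contra hn
    have := hQ ![0, 1, 0] (by rw [hk]; simp; linarith)
    simp at this
  have hpq : 0 < p + q := by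
    by_contra hn
    have := hQ ![0, 0, 1] (by rw [hk]; simp; linarith)
    simp at this
  have hS : 0 < p * q + p * r + q * r := by
    rcases hp0.eq_or_lt with h0 | h0
    · subst h0
      nlinarith [mul_pos (show 0 < q by linarith) (show 0 < r by linarith)]
    · nlinarith [mul_pos h0 hqr, mul_nonneg hq0 hr0]
  obtain ⟨S, hSe⟩ : ∃ S, S = p * q + p * r + q * r := ⟨_, rfl⟩
  rw [← hSe] at hS
  refine ⟨p / S, q / S, r / S, by positivity, by positivity, by positivity, ?_, ?_, ?_, ?_⟩
  · rw [← add_div]; positivity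
  · rw [← add_div]; positivity
  · rw [← add_div]; positivity
  intro x y z m
  have hT : p + q + r ≠ 0 := by positivity
  constructor
  · intro hm
    rw [hk] at hm
    -- the currents through the arms
    obtain ⟨I, hI⟩ : ∃ I, I = r * (x - y) + q * (x - z) := ⟨_, rfl⟩
    obtain ⟨J, hJ⟩ : ∃ J, J = r * (y - x) + p * (y - z) := ⟨_, rfl⟩
    obtain ⟨L, hL⟩ : ∃ L, L = q * (z - x) + p * (z - y) := ⟨_, rfl⟩
    -- The centre potential is read off from the drop along the first arm, and each arm receives the
    -- Joule heat of its current as budget.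
    refine ⟨x - p / S * I, p / S * I ^ 2, q / S * J ^ 2, r / S * L ^ 2,
      ⟨by positivity, ?_⟩, ⟨by positivity, ?_⟩, ⟨by positivity, ?_⟩, ?_⟩
    · apply le_of_eq; ring
    · apply le_of_eq
      have : y - (x - p / S * I) = q / S * J := by
        field_simp; rw [hI, hJ, hSe]; ring
      rw [this]; ring
    · apply le_of_eq
      have : z - (x - p / S * I) = r / S * L := by
        field_simp; rw [hI, hL, hSe]; ring
      rw [this]; ring
    · refine le_trans (le_of_eq ?_) hm
      field_simp
      rw [hI, hJ, hL, hSe]; ring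
  · rintro ⟨w, t₁, t₂, t₃, ⟨a1, h1⟩, ⟨a2, h2⟩, ⟨a3, h3⟩, hm⟩
    rw [hk]
    -- Thomson's bound with the currents of the Δ network. They sum to zero, so the centre potential
    -- cancels when the three bounds are added.
    have k1 := Res.two_mul_le (r * (x - y) + q * (x - z)) (by positivity) ⟨a1, h1⟩
    have k2 := Res.two_mul_le (r * (y - x) + p * (y - z)) (by positivity) ⟨a2, h2⟩
    have k3 := Res.two_mul_le (q * (z - x) + p * (z - y)) (by positivity) ⟨a3, h3⟩
    have e1 : p / S * (r * (x - y) + q * (x - z)) ^ 2 + q / S * (r * (y - x) + p * (y - z)) ^ 2 +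
        r / S * (q * (z - x) + p * (z - y)) ^ 2 =
        p * (y - z) ^ 2 + q * (x - z) ^ 2 + r * (x - y) ^ 2 := by
      field_simp
      rw [hSe]; ring
    linarith

end IsNet

/-! ### Ladder networks

The terminals `z₀, z₁, z₂, z₃` are attached to the lower left, lower right, upper right and upper left
ends of a ladder by pendant resistors `P, M, P, M`; the rungs have resistance `g`, the rails `f`. -/

/-- The ladder with one rung. -/
def LadderOne (P M g z₀ z₁ z₂ z₃ m : ℝ) : Prop :=
  ∃ c₁ c₂ t₀ t₁ t₂ t₃ s, Res P z₀ c₁ t₀ ∧ Res M z₁ c₁ t₁ ∧ Res P z₂ c₂ t₂ ∧ Res M z₃ c₂ t₃ ∧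
    Res g c₁ c₂ s ∧ t₀ + t₁ + t₂ + t₃ + s ≤ m

/-- The ladder with two rungs. -/
def LadderTwo (P M g f z₀ z₁ z₂ z₃ m : ℝ) : Prop :=
  ∃ c₁ c₂ c₃ c₄ t₀ t₁ t₂ t₃ s s' l u, Res P z₀ c₁ t₀ ∧ Res M z₁ c₃ t₁ ∧ Res P z₂ c₄ t₂ ∧
    Res M z₃ c₂ t₃ ∧ Res g c₁ c₂ s ∧ Res g c₃ c₄ s' ∧ Res f c₁ c₃ l ∧ Res f c₂ c₄ u ∧
    t₀ + t₁ + t₂ + t₃ + s + s' + l + u ≤ m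

/-- The ladder with three rungs. -/
def LadderThree (P M g f z₀ z₁ z₂ z₃ m : ℝ) : Prop :=
  ∃ c₁ c₂ c₃ c₄ c₅ c₆ t₀ t₁ t₂ t₃ s s' s'' l l' u u', Res P z₀ c₁ t₀ ∧ Res M z₁ c₅ t₁ ∧
    Res P z₂ c₆ t₂ ∧ Res M z₃ c₂ t₃ ∧ Res g c₁ c₂ s ∧ Res g c₃ c₄ s' ∧ Res g c₅ c₆ s'' ∧
    Res f c₁ c₃ l ∧ Res f c₃ c₅ l' ∧ Res f c₂ c₄ u ∧ Res f c₄ c₆ u' ∧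
    t₀ + t₁ + t₂ + t₃ + s + s' + s'' + l + l' + u + u' ≤ m

/-- The ladder of the state `s`. -/
def Ladder (s : Fin 3) (P M g f : ℝ) (z : Fin 4 → ℝ) (m : ℝ) : Prop :=
  (![LadderOne P M g (z 0) (z 1) (z 2) (z 3) m, LadderTwo P M g f (z 0) (z 1) (z 2) (z 3) m,
    LadderThree P M g f (z 0) (z 1) (z 2) (z 3) m] : Fin 3 → Prop) s

/-! ### Symmetry of the ladders and their restrictions to contact vertices -/

section Traces

variable {P M g f z₀ z₁ z₂ z₃ m : ℝ}

lemma LadderOne.rotate (h : LadderOne P M g z₀ z₁ z₂ z₃ m) : LadderOne P M g z₂ z₃ z₀ z₁ m := by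
  obtain ⟨c₁, c₂, t₀, t₁, t₂, t₃, s, h0, h1, h2, h3, h4, h⟩ := h
  exact ⟨c₂, c₁, t₂, t₃, t₀, t₁, s, h2, h3, h0, h1, h4.symm, by linarith⟩

lemma LadderTwo.rotate (h : LadderTwo P M g f z₀ z₁ z₂ z₃ m) :
    LadderTwo P M g f z₂ z₃ z₀ z₁ m := by
  obtain ⟨c₁, c₂, c₃, c₄, t₀, t₁, t₂, t₃, s, s', l, u, h0, h1, h2, h3, h4, h5, h6, h7, h⟩ := h
  exact ⟨c₄, c₃, c₂, c₁, t₂, t₃, t₀, t₁, s', s, u, l, h2, h3, h0, h1, h5.symm, h4.symm, h7.symm,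
    h6.symm, by linarith⟩

lemma LadderThree.rotate (h : LadderThree P M g f z₀ z₁ z₂ z₃ m) :
    LadderThree P M g f z₂ z₃ z₀ z₁ m := by
  obtain ⟨c₁, c₂, c₃, c₄, c₅, c₆, t₀, t₁, t₂, t₃, s, s', s'', l, l', u, u', h0, h1, h2, h3, h4, h5,
    h6, h7, h8, h9, h10, h⟩ := h
  exact ⟨c₆, c₅, c₄, c₃, c₂, c₁, t₂, t₃, t₀, t₁, s'', s', s, u', u, l', l, h2, h3, h0, h1, h6.symm,
    h5.symm, h4.symm, h10.symm, h9.symm, h8.symm, h7.symm, by linarith⟩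

lemma Ladder.rotate (s : Fin 3) (z : Fin 4 → ℝ) :
    Ladder s P M g f z m ↔ Ladder s P M g f ![z 2, z 3, z 0, z 1] m := by
  fin_cases s
  · exact ⟨LadderOne.rotate, LadderOne.rotate⟩
  · exact ⟨LadderTwo.rotate, LadderTwo.rotate⟩
  · exact ⟨LadderThree.rotate, LadderThree.rotate⟩

/-- With the upper right terminal free, its pendant resistor is dead, so the rung and the other
upper pendant resistor form one arm `g + M` centred at `c₁`. -/
lemma LadderOne.exists_upperRight (hM : 0 ≤ M) (hg : 0 ≤ g) :
    (∃ z₂, LadderOne P M g z₀ z₁ z₂ z₃ m) ↔ Star M P (g + M) z₁ z₀ z₃ m := by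
  constructor
  · rintro ⟨z₂, c₁, c₂, t₀, t₁, t₂, t₃, s, h0, h1, h2, h3, h4, h⟩
    exact ⟨c₁, t₁, t₀, _, h1, h0, (h4.series hg hM h3.symm).symm, by linarith [h2.1]⟩
  · rintro ⟨w, t₁, t₂, t₃, h1, h2, h3, h⟩
    obtain ⟨c₂, s, t, h4, h5, rfl⟩ := h3.symm.exists_series hg hM
    exact ⟨c₂, w, c₂, t₂, t₁, 0, t, s, h2, h1, Res.refl _ _, h5.symm, h4, by linarith⟩

lemma LadderOne.exists_lowerLeft (hM : 0 ≤ M) (hg : 0 ≤ g) :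
    (∃ z₀, LadderOne P M g z₀ z₁ z₂ z₃ m) ↔ Star M P (g + M) z₃ z₂ z₁ m := by
  rw [← LadderOne.exists_upperRight hM hg]
  exact exists_congr fun _ => ⟨LadderOne.rotate, LadderOne.rotate⟩

/-- Between the two remaining corners the ladder is a loop whose halves both consist of one rail and
one rung, that is, two parallel resistors `f + g`. -/
lemma LadderTwo.exists_antidiagonal (hP : 0 ≤ P) (hg : 0 ≤ g) (hf : 0 < f) :
    (∃ z₁ z₃, LadderTwo P M g f z₀ z₁ z₂ z₃ m) ↔ Res (2 * P + (f + g) / 2) z₀ z₂ m := by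
  have hfg : 0 < (f + g) + (g + f) := by positivity
  have e : (f + g) * (g + f) / ((f + g) + (g + f)) = (f + g) / 2 := by field_simp; ring
  have e2 : P + (f + g) / 2 + P = 2 * P + (f + g) / 2 := by ring
  constructor
  · rintro ⟨z₁, z₃, c₁, c₂, c₃, c₄, t₀, t₁, t₂, t₃, s, s', l, u, h0, h1, h2, h3, h4, h5, h6, h7, h⟩
    have k := Res.parallel (by positivity) (by positivity) hfg
      (h6.series hf.le hg h5) (h4.series hg hf.le h7)
    rw [e] at k
    have k' := ((h0.series hP (by positivity) k).series (by positivity) hP h2.symm).of_eq e2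
    exact k'.mono (by positivity) (by linarith [h1.1, h3.1])
  · intro h
    obtain ⟨c₄, r, t₂, k, h2, rfl⟩ := (h.of_eq e2.symm).exists_series (by positivity) hP
    obtain ⟨c₁, t₀, r, h0, k', rfl⟩ := k.exists_series hP (by positivity)
    rw [← e] at k'
    obtain ⟨r, r', hr, hr', rfl⟩ := k'.exists_parallel (by positivity) (by positivity) hfg
    obtain ⟨c₃, l, s', h6, h5, rfl⟩ := hr.exists_series hf.le hg
    obtain ⟨c₂, s, u, h4, h7, rfl⟩ := hr'.exists_series hg hf.le
    exact ⟨c₃, c₂, c₁, c₂, c₃, c₄, t₀, 0, t₂, 0, s, s', l, u, h0, Res.refl _ _, h2.symm,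
      Res.refl _ _, h4, h5, h6, h7, by linarith⟩

/-- By left-right symmetry the middle rung carries no current. What remains is the lower rail pair
`2f` in parallel with the upper detour `2(f + g)`. One direction simply discards the middle rung;
the other gives both its ends the mean of the potentials at `c₁` and `c₅`. -/
lemma LadderThree.exists_upper (hP : 0 ≤ P) (hM : 0 ≤ M) (hg : 0 ≤ g) (hf : 0 < f) :
    (∃ z₂ z₃, LadderThree P M g f z₀ z₁ z₂ z₃ m) ↔
      Res (P + M + 2 * f * (f + g) / (2 * f + g)) z₀ z₁ m := by
  have hfg : 0 < (f + f) + ((f + g) + (f + g)) := by positivity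
  have e : (f + f) * ((f + g) + (f + g)) / ((f + f) + ((f + g) + (f + g))) =
      2 * f * (f + g) / (2 * f + g) := by
    field_simp; ring
  have e2 : P + 2 * f * (f + g) / (2 * f + g) + M = P + M + 2 * f * (f + g) / (2 * f + g) := by ring
  constructor
  · rintro ⟨z₂, z₃, c₁, c₂, c₃, c₄, c₅, c₆, t₀, t₁, t₂, t₃, s, s', s'', l, l', u, u', h0, h1, h2, h3,
      h4, h5, h6, h7, h8, h9, h10, h⟩
    have ku := (h4.series hg hf.le h9).series (by positivity) (by positivity)
      (h10.series hf.le hg h6.symm)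
    have k := Res.parallel (by positivity) (by positivity) hfg
      (h7.series hf.le hf.le h8) (ku.of_eq (by ring : _ = (f + g) + (f + g)))
    rw [e] at k
    have k' := ((h0.series hP (by positivity) k).series (by positivity) hM h1.symm).of_eq e2
    exact k'.mono (by positivity) (by linarith [h2.1, h3.1, h5.1])
  · intro h
    obtain ⟨c₅, r, t₁, k, h1, rfl⟩ := (h.of_eq e2.symm).exists_series (by positivity) hM
    obtain ⟨c₁, t₀, r, h0, k', rfl⟩ := k.exists_series hP (by positivity)
    rw [← e] at k'
    obtain ⟨r, r', hr, hr', rfl⟩ := k'.exists_parallel (by positivity) (by positivity) hfg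
    obtain ⟨c₂, s, u, h4, h9, hsu⟩ :=
      (hr'.midpoint_left.of_eq (add_comm f g)).exists_series hg hf.le
    obtain ⟨c₆, u', s'', h10, h6, hsu'⟩ := hr'.midpoint_right.exists_series hf.le hg
    exact ⟨c₆, c₂, c₁, c₂, (c₁ + c₅) / 2, (c₁ + c₅) / 2, c₅, c₆, t₀, t₁, 0, 0, s, 0, s'', r / 2,
      r / 2, u, u', h0, h1.symm, Res.refl _ _, Res.refl _ _, h4, Res.refl _ _, h6.symm,
      hr.midpoint_left, hr.midpoint_right, h9, h10, by linarith⟩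

lemma LadderThree.exists_lower (hP : 0 ≤ P) (hM : 0 ≤ M) (hg : 0 ≤ g) (hf : 0 < f) :
    (∃ z₀ z₁, LadderThree P M g f z₀ z₁ z₂ z₃ m) ↔
      Res (P + M + 2 * f * (f + g) / (2 * f + g)) z₂ z₃ m := by
  rw [← LadderThree.exists_upper hP hM hg hf]
  exact exists_congr fun _ => exists_congr fun _ => ⟨LadderThree.rotate, LadderThree.rotate⟩

end Traces

/-! ### The reduction of the networks of level one -/

/-- The restrictions of the networks `E` to those vertices of the cells that are needed to connect
the cells of the networks of level one. -/
structure HasTraces (E : Fin 3 → ℝ → ℝ → ℝ → ℝ → ℝ) (a b c d e : ℝ) : Prop where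
  star_lower : ∀ x₀ x₁ x₃ m, (∃ x₂, E 0 x₀ x₁ x₂ x₃ ≤ m) ↔ Star a b c x₁ x₀ x₃ m
  star_upper : ∀ x₁ x₂ x₃ m, (∃ x₀, E 0 x₀ x₁ x₂ x₃ ≤ m) ↔ Star a b c x₃ x₂ x₁ m
  diagonal : ∀ x₀ x₂ m, (∃ x₁ x₃, E 1 x₀ x₁ x₂ x₃ ≤ m) ↔ Res d x₀ x₂ m
  lower : ∀ x₀ x₁ m, (∃ x₂ x₃, E 2 x₀ x₁ x₂ x₃ ≤ m) ↔ Res e x₀ x₁ m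
  upper : ∀ x₂ x₃ m, (∃ x₀ x₁, E 2 x₀ x₁ x₂ x₃ ≤ m) ↔ Res e x₂ x₃ m

/-- The energy of the network of level one of the state `s`, for potentials on a grid. -/
def levelSum (E : Fin 3 → ℝ → ℝ → ℝ → ℝ → ℝ) (s : Fin 3) (U : ℕ → ℕ → ℝ) : ℝ :=
  ∑ e ∈ windmillCuts with e.1 = s,
    E e.2.1 (U e.2.2.1 e.2.2.2) (U (e.2.2.1 + (e.2.1 + 1)) e.2.2.2)
      (U (e.2.2.1 + (e.2.1 + 1)) (e.2.2.2 + 1)) (U e.2.2.1 (e.2.2.2 + 1))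

lemma levelSum_zero (E : Fin 3 → ℝ → ℝ → ℝ → ℝ → ℝ) (U : ℕ → ℕ → ℝ) : levelSum E 0 U =
    E 1 (U 0 0) (U 2 0) (U 2 1) (U 0 1) + E 1 (U 2 3) (U 4 3) (U 4 4) (U 2 4) +
    E 0 (U 3 0) (U 4 0) (U 4 1) (U 3 1) + E 0 (U 2 1) (U 3 1) (U 3 2) (U 2 2) +
    E 0 (U 1 2) (U 2 2) (U 2 3) (U 1 3) + E 0 (U 0 3) (U 1 3) (U 1 4) (U 0 4) := by
  have : windmillCuts.filter (fun e => e.1 = 0) = {(0, 1, 0, 0), (0, 1, 2, 3),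
   (0, 0, 3, 0), (0, 0, 2, 1), (0, 0, 1, 2), (0, 0, 0, 3)} := by decide
  rw [levelSum, this]
  iterate 5 rw [Finset.sum_insert (by decide)]
  rw [Finset.sum_singleton]
  simp [add_assoc]

lemma levelSum_one (E : Fin 3 → ℝ → ℝ → ℝ → ℝ → ℝ) (U : ℕ → ℕ → ℝ) : levelSum E 1 U =
    E 1 (U 0 0) (U 2 0) (U 2 1) (U 0 1) + E 1 (U 6 3) (U 8 3) (U 8 4) (U 6 4) +
    E 2 (U 3 0) (U 6 0) (U 6 1) (U 3 1) + E 2 (U 2 3) (U 5 3) (U 5 4) (U 2 4) +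
    E 0 (U 2 1) (U 3 1) (U 3 2) (U 2 2) + E 0 (U 1 2) (U 2 2) (U 2 3) (U 1 3) +
    E 0 (U 0 3) (U 1 3) (U 1 4) (U 0 4) + E 0 (U 7 0) (U 8 0) (U 8 1) (U 7 1) +
    E 0 (U 6 1) (U 7 1) (U 7 2) (U 6 2) + E 0 (U 5 2) (U 6 2) (U 6 3) (U 5 3) := by
  have : windmillCuts.filter (fun e => e.1 = 1) = {(1, 1, 0, 0), (1, 1, 6, 3), (1, 2, 3, 0),
    (1, 2, 2, 3), (1, 0, 2, 1), (1, 0, 1, 2), (1, 0, 0, 3), (1, 0, 7, 0), (1, 0, 6, 1),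
    (1, 0, 5, 2)} := by decide
  rw [levelSum, this]
  iterate 9 rw [Finset.sum_insert (by decide)]
  rw [Finset.sum_singleton]
  simp [add_assoc]

lemma levelSum_two (E : Fin 3 → ℝ → ℝ → ℝ → ℝ → ℝ) (U : ℕ → ℕ → ℝ) : levelSum E 2 U =
    E 1 (U 0 0) (U 2 0) (U 2 1) (U 0 1) + E 1 (U 10 3) (U 12 3) (U 12 4) (U 10 4) +
    E 2 (U 3 0) (U 6 0) (U 6 1) (U 3 1) + E 2 (U 7 0) (U 10 0) (U 10 1) (U 7 1) +
    E 2 (U 2 3) (U 5 3) (U 5 4) (U 2 4) + E 2 (U 6 3) (U 9 3) (U 9 4) (U 6 4) +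
    E 0 (U 2 1) (U 3 1) (U 3 2) (U 2 2) + E 0 (U 1 2) (U 2 2) (U 2 3) (U 1 3) +
    E 0 (U 0 3) (U 1 3) (U 1 4) (U 0 4) + E 0 (U 6 1) (U 7 1) (U 7 2) (U 6 2) +
    E 0 (U 5 2) (U 6 2) (U 6 3) (U 5 3) + E 0 (U 11 0) (U 12 0) (U 12 1) (U 11 1) +
    E 0 (U 10 1) (U 11 1) (U 11 2) (U 10 2) + E 0 (U 9 2) (U 10 2) (U 10 3) (U 9 3) := by
  have : windmillCuts.filter (fun e => e.1 = 2) = {(2, 1, 0, 0), (2, 1, 10, 3), (2, 2, 3, 0),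
    (2, 2, 7, 0), (2, 2, 2, 3), (2, 2, 6, 3), (2, 0, 2, 1), (2, 0, 1, 2), (2, 0, 0, 3),
    (2, 0, 6, 1), (2, 0, 5, 2), (2, 0, 11, 0), (2, 0, 10, 1), (2, 0, 9, 2)} := by decide
  rw [levelSum, this]
  iterate 13 rw [Finset.sum_insert (by decide)]
  rw [Finset.sum_singleton]
  simp [add_assoc]

/-! ### Level-one networks as ladders -/

namespace HasTraces

variable {E : Fin 3 → ℝ → ℝ → ℝ → ℝ → ℝ} {a b c d e : ℝ}

lemma antidiagonal (T : HasTraces E a b c d e) (ha : 0 ≤ a) (hc : 0 ≤ c)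
    (x₁ x₃ m : ℝ) : (∃ x₀ x₂, E 0 x₀ x₁ x₂ x₃ ≤ m) ↔ Res (a + c) x₁ x₃ m := by
  simp only [T.star_lower, Star.exists_second ha hc]

/-- Two cells that are joined at a vertex form a ladder with one rung. -/
lemma rung (T : HasTraces E a b c d e) (hc : 0 ≤ c)
    (x₀ x₁ x₂ x₃ m : ℝ) :
    (∃ n y y', E 0 x₀ x₁ y n + E 0 y' n x₂ x₃ ≤ m) ↔ LadderOne b a (c + c) x₀ x₁ x₂ x₃ m := by
  constructor
  · rintro ⟨n, y, y', h⟩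
    obtain ⟨w, t₁, t₂, t₃, h1, h2, h3, hl⟩ := (T.star_lower _ _ _ _).1 ⟨_, le_refl (E 0 x₀ x₁ y n)⟩
    obtain ⟨w', t₁', t₂', t₃', h1', h2', h3', hl'⟩ :=
      (T.star_upper _ _ _ _).1 ⟨_, le_refl (E 0 y' n x₂ x₃)⟩
    exact ⟨w, w', t₂, t₁, t₂', t₁', _, h2, h1, h2', h1', h3.symm.series hc hc h3', by linarith⟩
  · rintro ⟨c₁, c₂, t₀, t₁, t₂, t₃, s, h0, h1, h2, h3, h4, h⟩
    obtain ⟨n, s, s', k4, h5, rfl⟩ := h4.exists_series hc hc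
    obtain ⟨y, hy⟩ := (T.star_lower x₀ x₁ n _).2 ⟨c₁, t₁, t₀, s, h1, h0, k4.symm, le_rfl⟩
    obtain ⟨y', hy'⟩ := (T.star_upper n x₂ x₃ _).2 ⟨c₂, t₃, t₂, s', h3, h2, h5, le_rfl⟩
    exact ⟨n, y, y', by linarith⟩

/-- The cells at `(2, 1)` and `(1, 2)` share the grid point `(2, 2)` and form the rung. A type 1
child, seen along its diagonal, extends an arm `b` to `b + d`; a corner cell of type 0, seen along
its antidiagonal, extends an arm `a` to `2a + c`. -/
lemma levelSum_zero_iff (T : HasTraces E a b c d e) (ha : 0 ≤ a) (hb : 0 ≤ b) (hc : 0 ≤ c)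
    (hd : 0 ≤ d) (z₀ z₁ z₂ z₃ m : ℝ) :
    (∃ U : ℕ → ℕ → ℝ, (U 0 0 = z₀ ∧ U 4 0 = z₁ ∧ U 4 4 = z₂ ∧ U 0 4 = z₃) ∧ levelSum E 0 U ≤ m) ↔
      LadderOne (b + d) (2 * a + c) (2 * c) z₀ z₁ z₂ z₃ m := by
  have eP : d + b = b + d := add_comm _ _
  have eM : a + c + a = 2 * a + c := by ring
  have eg : c + c = 2 * c := by ring
  have hac : 0 ≤ a + c := by positivity
  simp only [levelSum_zero]
  constructor
  · rintro ⟨U, ⟨rfl, rfl, rfl, rfl⟩, h⟩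
    obtain ⟨c₁, c₂, t₀, t₁, t₂, t₃, s, h0, h1, h2, h3, h4, hl⟩ :=
      (T.rung hc (U 2 1) (U 3 1) (U 2 3) (U 1 3) _).1 ⟨U 2 2, U 3 2, U 1 2, le_rfl⟩
    have k0 := (T.diagonal (U 0 0) (U 2 1) _).1 ⟨U 2 0, U 0 1, le_rfl⟩
    have k1 := (T.antidiagonal ha hc (U 4 0) (U 3 1) _).1 ⟨U 3 0, U 4 1, le_rfl⟩
    have k2 := (T.diagonal (U 2 3) (U 4 4) _).1 ⟨U 4 3, U 2 4, le_rfl⟩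
    have k3 := (T.antidiagonal ha hc (U 1 3) (U 0 4) _).1 ⟨U 0 3, U 1 4, le_rfl⟩
    exact ⟨c₁, c₂, _, _, _, _, _, (k0.series hd hb h0).of_eq eP, (k1.series hac ha h1).of_eq eM,
      (k2.symm.series hd hb h2).of_eq eP, (k3.symm.series hac ha h3).of_eq eM, h4.of_eq eg,
      by linarith⟩
  · rintro ⟨c₁, c₂, t₀, t₁, t₂, t₃, s, h0, h1, h2, h3, h4, h⟩
    obtain ⟨u21, _, _, k0, l0, rfl⟩ := (h0.of_eq eP.symm).exists_series hd hb
    obtain ⟨u31, _, _, k1, l1, rfl⟩ := (h1.of_eq eM.symm).exists_series hac ha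
    obtain ⟨u23, _, _, k2, l2, rfl⟩ := (h2.of_eq eP.symm).exists_series hd hb
    obtain ⟨u13, _, _, k3, l3, rfl⟩ := (h3.of_eq eM.symm).exists_series hac ha
    obtain ⟨u22, u32, u12, hr⟩ := (T.rung hc u21 u31 u23 u13 _).2
      ⟨c₁, c₂, _, _, _, _, _, l0, l1, l2, l3, h4.of_eq eg.symm, le_rfl⟩
    obtain ⟨u20, u01, k0⟩ := (T.diagonal _ _ _).2 k0
    obtain ⟨u30, u41, k1⟩ := (T.antidiagonal ha hc _ _ _).2 k1
    obtain ⟨u43, u24, k2⟩ := (T.diagonal _ _ _).2 k2.symm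
    obtain ⟨u03, u14, k3⟩ := (T.antidiagonal ha hc _ _ _).2 k3.symm
    -- All grid points that are vertices of children are listed; `levelSum` never reads the default
    -- value.
    let U : ℕ → ℕ → ℝ
      | 0, 0 => z₀ | 4, 0 => z₁ | 4, 4 => z₂ | 0, 4 => z₃
      | 2, 1 => u21 | 3, 1 => u31 | 2, 3 => u23 | 1, 3 => u13 | 2, 2 => u22 | 3, 2 => u32
      | 1, 2 => u12 | 2, 0 => u20 | 0, 1 => u01 | 3, 0 => u30 | 4, 1 => u41
      | 4, 3 => u43 | 2, 4 => u24 | 0, 3 => u03 | 1, 4 => u14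
      | _, _ => 0
    refine ⟨U, ⟨rfl, rfl, rfl, rfl⟩, ?_⟩
    change E 1 z₀ u20 u21 u01 + E 1 u23 u43 z₂ u24 + E 0 u30 z₁ u41 u31 + E 0 u21 u31 u32 u22 +
      E 0 u12 u22 u23 u13 + E 0 u03 u13 u14 z₃ ≤ m
    linarith

lemma levelSum_one_iff (T : HasTraces E a b c d e) (ha : 0 ≤ a) (hb : 0 ≤ b) (hc : 0 ≤ c)
    (hd : 0 ≤ d) (he : 0 ≤ e) (z₀ z₁ z₂ z₃ m : ℝ) :
    (∃ U : ℕ → ℕ → ℝ, (U 0 0 = z₀ ∧ U 8 0 = z₁ ∧ U 8 4 = z₂ ∧ U 0 4 = z₃) ∧ levelSum E 1 U ≤ m) ↔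
      LadderTwo (b + d) (2 * a + c) (2 * c) (a + e + b) z₀ z₁ z₂ z₃ m := by
  have eP : d + b = b + d := add_comm _ _
  have eM : a + c + a = 2 * a + c := by ring
  have eg : c + c = 2 * c := by ring
  have hac : 0 ≤ a + c := by positivity
  have hae : 0 ≤ a + e := by positivity
  simp only [levelSum_one]
  constructor
  · rintro ⟨U, ⟨rfl, rfl, rfl, rfl⟩, h⟩
    obtain ⟨c₁, c₂, t₀, t₁, t₂, t₃, s, h0, h1, h2, h3, h4, hl⟩ :=
      (T.rung hc (U 2 1) (U 3 1) (U 2 3) (U 1 3) _).1 ⟨U 2 2, U 3 2, U 1 2, le_rfl⟩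
    obtain ⟨c₁', c₂', t₀', t₁', t₂', t₃', s', h0', h1', h2', h3', h4', hl'⟩ :=
      (T.rung hc (U 6 1) (U 7 1) (U 6 3) (U 5 3) _).1 ⟨U 6 2, U 7 2, U 5 2, le_rfl⟩
    have k0 := (T.diagonal (U 0 0) (U 2 1) _).1 ⟨U 2 0, U 0 1, le_rfl⟩
    have k1 := (T.antidiagonal ha hc (U 8 0) (U 7 1) _).1 ⟨U 7 0, U 8 1, le_rfl⟩
    have k2 := (T.diagonal (U 6 3) (U 8 4) _).1 ⟨U 8 3, U 6 4, le_rfl⟩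
    have k3 := (T.antidiagonal ha hc (U 1 3) (U 0 4) _).1 ⟨U 0 3, U 1 4, le_rfl⟩
    -- The lower rail passes along the upper side of the type 2 child at `(3, 0)`, the upper rail
    -- along the lower side of the one at `(2, 3)`. From left to right the rails read `a + e + b`
    -- and `b + e + a`, so the upper one is assembled backwards.
    have k4 := (T.upper (U 6 1) (U 3 1) _).1 ⟨U 3 0, U 6 0, le_rfl⟩
    have k5 := (T.lower (U 2 3) (U 5 3) _).1 ⟨U 5 4, U 2 4, le_rfl⟩
    exact ⟨c₁, c₂, c₁', c₂', _, _, _, _, _, _, _, _, (k0.series hd hb h0).of_eq eP,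
      (k1.series hac ha h1').of_eq eM, (k2.symm.series hd hb h2').of_eq eP,
      (k3.symm.series hac ha h3).of_eq eM, h4.of_eq eg, h4'.of_eq eg,
      (h1.symm.series ha he k4.symm).series hae hb h0',
      ((h3'.symm.series ha he k5.symm).series hae hb h2).symm, by linarith⟩
  · rintro ⟨c₁, c₂, c₃, c₄, t₀, t₁, t₂, t₃, s, s', l, u, h0, h1, h2, h3, h4, h5, h6, h7, h⟩
    obtain ⟨u21, _, _, k0, l0, rfl⟩ := (h0.of_eq eP.symm).exists_series hd hb
    obtain ⟨u71, _, _, k1, l1, rfl⟩ := (h1.of_eq eM.symm).exists_series hac ha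
    obtain ⟨u63, _, _, k2, l2, rfl⟩ := (h2.of_eq eP.symm).exists_series hd hb
    obtain ⟨u13, _, _, k3, l3, rfl⟩ := (h3.of_eq eM.symm).exists_series hac ha
    obtain ⟨u61, _, _, j6, r6, rfl⟩ := h6.exists_series hae hb
    obtain ⟨u31, _, _, l6, k6, rfl⟩ := j6.exists_series ha he
    obtain ⟨u23, _, _, j7, r7, rfl⟩ := h7.symm.exists_series hae hb
    obtain ⟨u53, _, _, l7, k7, rfl⟩ := j7.exists_series ha he
    obtain ⟨u22, u32, u12, hr⟩ := (T.rung hc u21 u31 u23 u13 _).2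
      ⟨c₁, c₂, _, _, _, _, _, l0, l6.symm, r7, l3, h4.of_eq eg.symm, le_rfl⟩
    obtain ⟨u62, u72, u52, hr'⟩ := (T.rung hc u61 u71 u63 u53 _).2
      ⟨c₃, c₄, _, _, _, _, _, r6, l1, l2, l7.symm, h5.of_eq eg.symm, le_rfl⟩
    obtain ⟨u20, u01, k0⟩ := (T.diagonal _ _ _).2 k0
    obtain ⟨u70, u81, k1⟩ := (T.antidiagonal ha hc _ _ _).2 k1
    obtain ⟨u83, u64, k2⟩ := (T.diagonal _ _ _).2 k2.symm
    obtain ⟨u03, u14, k3⟩ := (T.antidiagonal ha hc _ _ _).2 k3.symm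
    obtain ⟨u30, u60, k6⟩ := (T.upper _ _ _).2 k6.symm
    obtain ⟨u54, u24, k7⟩ := (T.lower _ _ _).2 k7.symm
    let U : ℕ → ℕ → ℝ
      | 0, 0 => z₀ | 8, 0 => z₁ | 8, 4 => z₂ | 0, 4 => z₃
      | 2, 1 => u21 | 3, 1 => u31 | 2, 3 => u23 | 1, 3 => u13 | 2, 2 => u22 | 3, 2 => u32
      | 1, 2 => u12 | 6, 1 => u61 | 7, 1 => u71 | 6, 3 => u63 | 5, 3 => u53 | 6, 2 => u62
      | 7, 2 => u72 | 5, 2 => u52 | 2, 0 => u20 | 0, 1 => u01 | 7, 0 => u70 | 8, 1 => u81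
      | 8, 3 => u83 | 6, 4 => u64 | 0, 3 => u03 | 1, 4 => u14 | 3, 0 => u30 | 6, 0 => u60
      | 5, 4 => u54 | 2, 4 => u24
      | _, _ => 0
    refine ⟨U, ⟨rfl, rfl, rfl, rfl⟩, ?_⟩
    change E 1 z₀ u20 u21 u01 + E 1 u63 u83 z₂ u64 + E 2 u30 u60 u61 u31 + E 2 u23 u53 u54 u24 +
      E 0 u21 u31 u32 u22 + E 0 u12 u22 u23 u13 + E 0 u03 u13 u14 z₃ + E 0 u70 z₁ u81 u71 +
      E 0 u61 u71 u72 u62 + E 0 u52 u62 u63 u53 ≤ m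
    linarith

lemma levelSum_two_iff (T : HasTraces E a b c d e) (ha : 0 ≤ a) (hb : 0 ≤ b) (hc : 0 ≤ c)
    (hd : 0 ≤ d) (he : 0 ≤ e) (z₀ z₁ z₂ z₃ m : ℝ) :
    (∃ U : ℕ → ℕ → ℝ, (U 0 0 = z₀ ∧ U 12 0 = z₁ ∧ U 12 4 = z₂ ∧ U 0 4 = z₃) ∧
      levelSum E 2 U ≤ m) ↔
      LadderThree (b + d) (2 * a + c) (2 * c) (a + e + b) z₀ z₁ z₂ z₃ m := by
  have eP : d + b = b + d := add_comm _ _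
  have eM : a + c + a = 2 * a + c := by ring
  have eg : c + c = 2 * c := by ring
  have hac : 0 ≤ a + c := by positivity
  have hae : 0 ≤ a + e := by positivity
  simp only [levelSum_two]
  constructor
  · rintro ⟨U, ⟨rfl, rfl, rfl, rfl⟩, h⟩
    obtain ⟨c₁, c₂, t₀, t₁, t₂, t₃, s, h0, h1, h2, h3, h4, hl⟩ :=
      (T.rung hc (U 2 1) (U 3 1) (U 2 3) (U 1 3) _).1 ⟨U 2 2, U 3 2, U 1 2, le_rfl⟩
    obtain ⟨c₁', c₂', t₀', t₁', t₂', t₃', s', h0', h1', h2', h3', h4', hl'⟩ :=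
      (T.rung hc (U 6 1) (U 7 1) (U 6 3) (U 5 3) _).1 ⟨U 6 2, U 7 2, U 5 2, le_rfl⟩
    obtain ⟨c₁'', c₂'', t₀'', t₁'', t₂'', t₃'', s'', h0'', h1'', h2'', h3'', h4'', hl''⟩ :=
      (T.rung hc (U 10 1) (U 11 1) (U 10 3) (U 9 3) _).1 ⟨U 10 2, U 11 2, U 9 2, le_rfl⟩
    have k0 := (T.diagonal (U 0 0) (U 2 1) _).1 ⟨U 2 0, U 0 1, le_rfl⟩
    have k1 := (T.antidiagonal ha hc (U 12 0) (U 11 1) _).1 ⟨U 11 0, U 12 1, le_rfl⟩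
    have k2 := (T.diagonal (U 10 3) (U 12 4) _).1 ⟨U 12 3, U 10 4, le_rfl⟩
    have k3 := (T.antidiagonal ha hc (U 1 3) (U 0 4) _).1 ⟨U 0 3, U 1 4, le_rfl⟩
    have k4 := (T.upper (U 6 1) (U 3 1) _).1 ⟨U 3 0, U 6 0, le_rfl⟩
    have k5 := (T.lower (U 2 3) (U 5 3) _).1 ⟨U 5 4, U 2 4, le_rfl⟩
    have k6 := (T.upper (U 10 1) (U 7 1) _).1 ⟨U 7 0, U 10 0, le_rfl⟩
    have k7 := (T.lower (U 6 3) (U 9 3) _).1 ⟨U 9 4, U 6 4, le_rfl⟩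
    exact ⟨c₁, c₂, c₁', c₂', c₁'', c₂'', _, _, _, _, _, _, _, _, _, _, _,
      (k0.series hd hb h0).of_eq eP, (k1.series hac ha h1'').of_eq eM,
      (k2.symm.series hd hb h2'').of_eq eP, (k3.symm.series hac ha h3).of_eq eM, h4.of_eq eg,
      h4'.of_eq eg, h4''.of_eq eg, (h1.symm.series ha he k4.symm).series hae hb h0',
      (h1'.symm.series ha he k6.symm).series hae hb h0'',
      ((h3'.symm.series ha he k5.symm).series hae hb h2).symm,
      ((h3''.symm.series ha he k7.symm).series hae hb h2').symm, by linarith⟩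
  · rintro ⟨c₁, c₂, c₃, c₄, c₅, c₆, t₀, t₁, t₂, t₃, s, s', s'', l, l', u, u', h0, h1, h2, h3, h4,
      h5, h6, h7, h8, h9, h10, h⟩
    obtain ⟨u21, _, _, k0, l0, rfl⟩ := (h0.of_eq eP.symm).exists_series hd hb
    obtain ⟨u111, _, _, k1, l1, rfl⟩ := (h1.of_eq eM.symm).exists_series hac ha
    obtain ⟨u103, _, _, k2, l2, rfl⟩ := (h2.of_eq eP.symm).exists_series hd hb
    obtain ⟨u13, _, _, k3, l3, rfl⟩ := (h3.of_eq eM.symm).exists_series hac ha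
    obtain ⟨u61, _, _, j7, r7, rfl⟩ := h7.exists_series hae hb
    obtain ⟨u31, _, _, l7, k7, rfl⟩ := j7.exists_series ha he
    obtain ⟨u101, _, _, j8, r8, rfl⟩ := h8.exists_series hae hb
    obtain ⟨u71, _, _, l8, k8, rfl⟩ := j8.exists_series ha he
    obtain ⟨u23, _, _, j9, r9, rfl⟩ := h9.symm.exists_series hae hb
    obtain ⟨u53, _, _, l9, k9, rfl⟩ := j9.exists_series ha he
    obtain ⟨u63, _, _, j10, r10, rfl⟩ := h10.symm.exists_series hae hb
    obtain ⟨u93, _, _, l10, k10, rfl⟩ := j10.exists_series ha he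
    -- Three rungs are rebuilt from their arms; inner arms come from splitting the adjacent rails,
    -- outer ones from splitting the pendant resistors.
    obtain ⟨u22, u32, u12, hr⟩ := (T.rung hc u21 u31 u23 u13 _).2
      ⟨c₁, c₂, _, _, _, _, _, l0, l7.symm, r9, l3, h4.of_eq eg.symm, le_rfl⟩
    obtain ⟨u62, u72, u52, hr'⟩ := (T.rung hc u61 u71 u63 u53 _).2
      ⟨c₃, c₄, _, _, _, _, _, r7, l8.symm, r10, l9.symm, h5.of_eq eg.symm, le_rfl⟩
    obtain ⟨u102, u112, u92, hr''⟩ := (T.rung hc u101 u111 u103 u93 _).2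
      ⟨c₅, c₆, _, _, _, _, _, r8, l1, l2, l10.symm, h6.of_eq eg.symm, le_rfl⟩
    obtain ⟨u20, u01, k0⟩ := (T.diagonal _ _ _).2 k0
    obtain ⟨u110, u121, k1⟩ := (T.antidiagonal ha hc _ _ _).2 k1
    obtain ⟨u123, u104, k2⟩ := (T.diagonal _ _ _).2 k2.symm
    obtain ⟨u03, u14, k3⟩ := (T.antidiagonal ha hc _ _ _).2 k3.symm
    obtain ⟨u30, u60, k7⟩ := (T.upper _ _ _).2 k7.symm
    obtain ⟨u70, u100, k8⟩ := (T.upper _ _ _).2 k8.symm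
    obtain ⟨u54, u24, k9⟩ := (T.lower _ _ _).2 k9.symm
    obtain ⟨u94, u64, k10⟩ := (T.lower _ _ _).2 k10.symm
    let U : ℕ → ℕ → ℝ
      | 0, 0 => z₀ | 12, 0 => z₁ | 12, 4 => z₂ | 0, 4 => z₃
      | 2, 1 => u21 | 3, 1 => u31 | 2, 3 => u23 | 1, 3 => u13 | 2, 2 => u22 | 3, 2 => u32
      | 1, 2 => u12 | 6, 1 => u61 | 7, 1 => u71 | 6, 3 => u63 | 5, 3 => u53 | 6, 2 => u62
      | 7, 2 => u72 | 5, 2 => u52 | 10, 1 => u101 | 11, 1 => u111 | 10, 3 => u103 | 9, 3 => u93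
      | 10, 2 => u102 | 11, 2 => u112 | 9, 2 => u92
      | 2, 0 => u20 | 0, 1 => u01 | 11, 0 => u110 | 12, 1 => u121
      | 12, 3 => u123 | 10, 4 => u104 | 0, 3 => u03 | 1, 4 => u14 | 3, 0 => u30 | 6, 0 => u60
      | 7, 0 => u70 | 10, 0 => u100 | 5, 4 => u54 | 2, 4 => u24 | 9, 4 => u94 | 6, 4 => u64
      | _, _ => 0
    refine ⟨U, ⟨rfl, rfl, rfl, rfl⟩, ?_⟩
    change E 1 z₀ u20 u21 u01 + E 1 u103 u123 z₂ u104 + E 2 u30 u60 u61 u31 +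
      E 2 u70 u100 u101 u71 + E 2 u23 u53 u54 u24 + E 2 u63 u93 u94 u64 +
      E 0 u21 u31 u32 u22 + E 0 u12 u22 u23 u13 + E 0 u03 u13 u14 z₃ + E 0 u61 u71 u72 u62 +
      E 0 u52 u62 u63 u53 + E 0 u110 z₁ u121 u111 + E 0 u101 u111 u112 u102 +
      E 0 u92 u102 u103 u93 ≤ m
    linarith

end HasTraces

/-! ### Walks -/

section Walks

variable {S E : Type} {ini fin : E → S}

lemma isWalk_append {s t : S} {u v : List E} :
    IsWalk ini fin s (u ++ v) t ↔ ∃ m, IsWalk ini fin s u m ∧ IsWalk ini fin m v t := by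
  induction u generalizing s with
  | nil => simp [IsWalk]
  | cons e u ih => simp [IsWalk, ih, and_assoc]

lemma walkMap_append (ψ : E → Plane → Plane) (u v : List E) (x : Plane) :
    walkMap ψ (u ++ v) x = walkMap ψ u (walkMap ψ v x) := by
  induction u with
  | nil => rfl
  | cons e u ih => simp [walkMap, ih]

lemma walkProd_append (r : E → ℝ) (u v : List E) :
    walkProd r (u ++ v) = walkProd r u * walkProd r v := by
  simp [walkProd]

lemma walkProd_singleton (r : E → ℝ) (e : E) : walkProd r [e] = r e := by
  simp [walkProd]

end Walks

namespace GraphDirectedFamily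

variable {S E : Type} (G : GraphDirectedFamily S E)

lemma walkMap_injective (w : List E) : Function.Injective (walkMap G.ψ w) := by
  induction w with
  | nil => exact Function.injective_id
  | cons e w ih =>
    refine Function.Injective.comp (fun x y h => ?_) ih
    have := G.similitude e x y
    rw [h, dist_self, eq_comm, mul_eq_zero, or_iff_right (G.ratio_pos e).ne', dist_eq_zero] at this
    exact this

lemma dist_walkMap (w : List E) (x y : Plane) :
    dist (walkMap G.ψ w x) (walkMap G.ψ w y) = walkProd G.ratio w * dist x y := by
  induction w with
  | nil => simp [walkMap, walkProd]
  | cons e w ih =>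
    simp only [walkProd, List.map_cons, List.prod_cons] at ih ⊢
    simp only [walkMap, Function.comp, G.similitude, ih, mul_assoc]

lemma walkProd_ratio_pos (w : List E) : 0 < walkProd G.ratio w :=
  List.prod_pos (by simp only [List.mem_map]; rintro _ ⟨e, -, rfl⟩; exact G.ratio_pos e)

lemma diam_island (w : List E) (t : S) :
    Metric.diam (G.island w t) = walkProd G.ratio w * Metric.diam (G.K t) := by
  have hr := G.walkProd_ratio_pos w
  have hb := (G.isCompact_K t).isBounded
  have hb' : Bornology.IsBounded (G.island w t) := by
    rw [Metric.isBounded_iff]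
    refine ⟨walkProd G.ratio w * Metric.diam (G.K t), ?_⟩
    rintro _ ⟨x, hx, rfl⟩ _ ⟨y, hy, rfl⟩
    rw [dist_walkMap]
    exact mul_le_mul_of_nonneg_left (Metric.dist_le_diam_of_mem hb hx hy) hr.le
  apply le_antisymm
  · refine Metric.diam_le_of_forall_dist_le (by positivity) ?_
    rintro _ ⟨x, hx, rfl⟩ _ ⟨y, hy, rfl⟩
    rw [dist_walkMap]
    exact mul_le_mul_of_nonneg_left (Metric.dist_le_diam_of_mem hb hx hy) hr.le
  · rw [← le_div_iff₀' hr]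
    refine Metric.diam_le_of_forall_dist_le (by positivity) fun x hx y hy => ?_
    rw [le_div_iff₀' hr, ← dist_walkMap]
    exact Metric.dist_le_diam_of_mem hb' ⟨x, hx, rfl⟩ ⟨y, hy, rfl⟩

end GraphDirectedFamily

/-! ### Grid coordinates -/

/-- The point with coordinates `(x, y)` in the grid of squares of side `side s / 4`. -/
def point (s : Fin 3) (x y : ℝ) : Plane := corner s + (side s / 4) • !₂[x, y]

/-- The column (`0` or `1`) of the vertices of a rectangle. -/
def col : Fin 4 → ℕ := ![0, 1, 1, 0]

/-- The row (`0` or `1`) of the vertices of a rectangle. -/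
def row : Fin 4 → ℕ := ![0, 0, 1, 1]

/-- The vertices of the rectangle spanned by the representative of type `s`. -/
def vertex (s : Fin 3) (k : Fin 4) : Plane :=
  point s ((4 * ((s + 1) * col k) : ℕ) : ℝ) ((4 * row k : ℕ) : ℝ)

lemma point_inj {s : Fin 3} {x y x' y' : ℝ} (h : point s x y = point s x' y') :
    x = x' ∧ y = y' := by
  have hs : side s / 4 ≠ 0 := (div_pos (side_pos s) (by norm_num)).ne'
  have h := smul_right_injective _ hs (add_left_cancel h)
  exact ⟨congrFun (congrArg WithLp.ofLp h) 0, congrFun (congrArg WithLp.ofLp h) 1⟩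

lemma vertex_injective (s : Fin 3) : Function.Injective (vertex s) := by
  intro k l h
  obtain ⟨h1, h2⟩ := point_inj h
  replace h1 := Nat.cast_injective (R := ℝ) h1
  replace h2 := Nat.cast_injective (R := ℝ) h2
  clear h
  revert s k l
  decide

lemma windmillPsi_point (e : Fin 3 × Fin 3 × ℕ × ℕ) (x y : ℝ) :
    windmillPsi e (point e.2.1 x y) = point e.1 (e.2.2.1 + x / 4) (e.2.2.2 + y / 4) := by
  have h1 := (side_pos e.2.1).ne'
  ext k
  fin_cases k <;> simp [windmillPsi, point] <;> field_simp <;> ring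

lemma windmillPsi_vertex (e : Fin 3 × Fin 3 × ℕ × ℕ) (k : Fin 4) :
    windmillPsi e (vertex e.2.1 k) =
      point e.1 ((e.2.2.1 + (e.2.1 + 1) * col k : ℕ) : ℝ) ((e.2.2.2 + row k : ℕ) : ℝ) := by
  rw [vertex, windmillPsi_point]
  push_cast
  congr 1 <;> ring

lemma q_eq_vertex (k : Fin 4) : q k = vertex 0 k := by
  ext i
  fin_cases k <;> fin_cases i <;> simp [q, vertex, point, corner, side, col, row]

lemma rect_one_eq_vertex : F 4 (q 1) = vertex 1 1 ∧ F 4 (q 2) = vertex 1 2 ∧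
    F 0 (q 3) = vertex 1 3 ∧ q 0 = vertex 1 0 := by
  refine ⟨?_, ?_, ?_, ?_⟩ <;> ext i <;> fin_cases i <;>
    simp [F, shift, q, vertex, point, corner, side, col, row] <;> norm_num

lemma rect_two_eq_vertex : F 0 (F 7 (q 0)) = vertex 2 0 ∧ F 4 (F 3 (q 1)) = vertex 2 1 ∧
    F 4 (F 3 (q 2)) = vertex 2 2 ∧ F 0 (F 7 (q 3)) = vertex 2 3 := by
  refine ⟨?_, ?_, ?_, ?_⟩ <;> ext i <;> fin_cases i <;>
    simp [F, shift, q, vertex, point, corner, side, col, row] <;> norm_num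

lemma range_vertex (s : Fin 3) :
    Set.range (vertex s) = {vertex s 0, vertex s 1, vertex s 2, vertex s 3} := by
  ext x
  simp [Fin.exists_fin_succ, eq_comm]

lemma rectVertices_eq (s : Fin 3) : rectVertices s = Set.range (vertex s) := by
  rw [range_vertex]
  fin_cases s
  · simp [rectVertices, q_eq_vertex]
  · change ({_, _, _, _} : Set Plane) = _
    rw [rect_one_eq_vertex.1, rect_one_eq_vertex.2.1, rect_one_eq_vertex.2.2.1,
      rect_one_eq_vertex.2.2.2]
    rfl
  · change ({_, _, _, _} : Set Plane) = _
    rw [rect_two_eq_vertex.1, rect_two_eq_vertex.2.1, rect_two_eq_vertex.2.2.1,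
      rect_two_eq_vertex.2.2.2]
    rfl

/-- The opposite vertex of a rectangle. -/
def opposite : Fin 4 → Fin 4 := ![2, 3, 0, 1]

lemma halfTurn_vertex (s : Fin 3) (k : Fin 4) : halfTurn s (vertex s k) = vertex s (opposite k) := by
  ext i
  fin_cases k <;> fin_cases i <;> simp [halfTurn, vertex, point, col, row, opposite] <;> ring

/-! ### The representatives and their rectangles -/

/-- A point with extremal coordinate is the image of a point of the set under one of the
contractions. For the minimum `m` this gives `m ≥ m / 4`, and for the maximum `m ≤ m / 4 + 3 / 4`.
-/
lemma windmillSet_bounds {y : Plane} (hy : y ∈ windmillSet) (i : Fin 2) : 0 ≤ y i ∧ y i ≤ 1 := by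
  obtain ⟨hc, hn, he⟩ := windmillSet_spec
  have hcont : ContinuousOn (fun y : Plane => y i) windmillSet := by fun_prop
  have hs : ∀ j, 0 ≤ shift j i ∧ shift j i ≤ 3 / 4 := by
    intro j
    fin_cases i <;> fin_cases j <;> norm_num [shift_apply, shift]
  constructor
  · obtain ⟨x, hx, hmin⟩ := hc.exists_isMinOn hn hcont
    refine le_trans ?_ (hmin hy)
    obtain ⟨j, z, hz, hj⟩ := Set.mem_iUnion.1 (he ▸ hx)
    have h1 : x i ≤ z i := hmin hz
    have h2 : x i = 1 / 4 * z i + shift j i := by rw [← hj]; simp [F]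
    have := hs j
    linarith
  · obtain ⟨x, hx, hmax⟩ := hc.exists_isMaxOn hn hcont
    refine le_trans (hmax hy) ?_
    obtain ⟨j, z, hz, hj⟩ := Set.mem_iUnion.1 (he ▸ hx)
    have h1 : z i ≤ x i := hmax hz
    have h2 : x i = 1 / 4 * z i + shift j i := by rw [← hj]; simp [F]
    have := hs j
    linarith

lemma exists_point_of_mem {s : Fin 3} {x : Plane} (hx : x ∈ windmillK s) :
    ∃ a b : ℝ, x = point s a b ∧ 0 ≤ a ∧ a ≤ 4 * (s + 1) ∧ 0 ≤ b ∧ b ≤ 4 := by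
  have key : ∀ a b : ℝ, x ∈ cell (corner s 0 + side s * a) (corner s 1 + side s * b) (side s) →
      ∃ c d : ℝ, x = point s c d ∧ 4 * a ≤ c ∧ c ≤ 4 * (a + 1) ∧ 4 * b ≤ d ∧ d ≤ 4 * (b + 1) := by
    rintro a b ⟨y, hy, rfl⟩
    have h0 := windmillSet_bounds hy 0
    have h1 := windmillSet_bounds hy 1
    refine ⟨4 * (a + y 0), 4 * (b + y 1), ?_, ?_, ?_, ?_, ?_⟩
    · ext i; fin_cases i <;> simp [point] <;> ring
    all_goals linarith
  have h0 : ∀ a : ℝ, x ∈ cell (corner s 0 + side s * a) (corner s 1) (side s) →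
      ∃ c d : ℝ, x = point s c d ∧ 4 * a ≤ c ∧ c ≤ 4 * (a + 1) ∧ 0 ≤ d ∧ d ≤ 4 := by
    intro a ha
    simpa using key a 0 (by simpa using ha)
  fin_cases s
  · change x ∈ windmillK 0 at hx
    rw [windmillK_zero] at hx
    obtain ⟨c, d, h⟩ := h0 0 (by simpa [corner_side_apply] using hx)
    exact ⟨c, d, h.1, by linarith [h.2.1], by norm_num; linarith [h.2.2.1], h.2.2.2⟩
  · change x ∈ windmillK 1 at hx
    rw [windmillK_one] at hx
    rcases hx with hx | hx
    · obtain ⟨c, d, h⟩ := h0 0 (by simpa [corner_side_apply] using hx)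
      exact ⟨c, d, h.1, by linarith [h.2.1], by norm_num; linarith [h.2.2.1], h.2.2.2⟩
    · obtain ⟨c, d, h⟩ := h0 1 (by simpa [corner_side_apply] using hx)
      exact ⟨c, d, h.1, by linarith [h.2.1], by norm_num; linarith [h.2.2.1], h.2.2.2⟩
  · change x ∈ windmillK 2 at hx
    rw [windmillK_two] at hx
    rcases hx with (hx | hx) | hx
    · obtain ⟨c, d, h⟩ := h0 0 (by simpa [corner_side_apply] using hx)
      exact ⟨c, d, h.1, by linarith [h.2.1], by norm_num; linarith [h.2.2.1], h.2.2.2⟩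
    · obtain ⟨c, d, h⟩ := h0 1 (by
        change x ∈ cell (corner 2 0 + side 2 * 1) (corner 2 1) (side 2)
        convert hx using 1; norm_num [corner_side_apply])
      exact ⟨c, d, h.1, by linarith [h.2.1], by norm_num; linarith [h.2.2.1], h.2.2.2⟩
    · obtain ⟨c, d, h⟩ := h0 2 (by
        change x ∈ cell (corner 2 0 + side 2 * 2) (corner 2 1) (side 2)
        convert hx using 1; norm_num [corner_side_apply])
      exact ⟨c, d, h.1, by linarith [h.2.1], by norm_num; linarith [h.2.2.1], h.2.2.2⟩

/-- `q k` is the fixed point of one of the contractions, which quarters distances to it; so the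
distance from `q k` to a nearest point of the set is zero. -/
lemma q_mem_windmillSet (k : Fin 4) : q k ∈ windmillSet := by
  obtain ⟨hc, hn, he⟩ := windmillSet_spec
  obtain ⟨i, hi⟩ : ∃ i, F i (q k) = q k := by
    refine ⟨![0, 1, 2, 3] k, ?_⟩
    ext j
    fin_cases k <;> fin_cases j <;> simp [F, q, shift] <;> norm_num
  obtain ⟨x, hx, hmin⟩ := hc.exists_isMinOn hn (f := fun x => dist x (q k)) (by fun_prop)
  have h1 : dist x (q k) ≤ dist (F i x) (F i (q k)) := by
    rw [hi]
    exact hmin (he ▸ Set.mem_iUnion.2 ⟨i, x, hx, rfl⟩)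
  rw [dist_F] at h1
  have : dist x (q k) = 0 := le_antisymm (by linarith) dist_nonneg
  exact dist_eq_zero.1 this ▸ hx

lemma vertex_mem (s : Fin 3) (k : Fin 4) : vertex s k ∈ windmillK s := by
  have h : vertex s k ∈ rectVertices s := rectVertices_eq s ▸ ⟨k, rfl⟩
  have hq := q_mem_windmillSet
  have hF : ∀ i x, x ∈ windmillSet → F i x ∈ windmillSet := fun i x hx => by
    rw [windmillSet_spec.2.2]; exact Set.mem_iUnion.2 ⟨i, x, hx, rfl⟩
  have h0 : q 0 = F 0 (q 0) := by
    ext i; fin_cases i <;> simp [q, F, shift]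
  fin_cases s
  · rcases h with h | h | h | h <;> exact h ▸ hq _
  · rcases h with h | h | h | h
    · exact h ▸ Or.inl ⟨_, hq 0, h0.symm⟩
    · exact h ▸ Or.inr ⟨_, hq 1, rfl⟩
    · exact h ▸ Or.inr ⟨_, hq 2, rfl⟩
    · exact h ▸ Or.inl ⟨_, hq 3, rfl⟩
  · rcases h with h | h | h | h
    · exact h ▸ Or.inl (Or.inl ⟨_, ⟨_, hq 0, rfl⟩, rfl⟩)
    · exact h ▸ Or.inr ⟨_, ⟨_, hq 1, rfl⟩, rfl⟩
    · exact h ▸ Or.inr ⟨_, ⟨_, hq 2, rfl⟩, rfl⟩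
    · exact h ▸ Or.inl (Or.inl ⟨_, ⟨_, hq 3, rfl⟩, rfl⟩)

lemma diam_windmillK_pos (s : Fin 3) : 0 < Metric.diam (windmillK s) := by
  refine lt_of_lt_of_le (dist_pos.2 ((vertex_injective s).ne (show (0 : Fin 4) ≠ 2 by decide)))
    (Metric.dist_le_diam_of_mem (windmill.isCompact_K s).isBounded (vertex_mem s 0) (vertex_mem s 2))

/-! ### The boundaries -/

/-- The vertices of the rectangle of type `s` that belong to the boundary. -/
def contactVertices (s : Fin 3) : Finset (Fin 4) := if s = 1 then {0, 2} else Finset.univ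

/-- The finite combinatorics of the cutting rule: two sibling rectangles are either strictly
separated in one coordinate or share just a corner. The condition on the type in the last two cases
says that children of type 1 never touch a sibling at the ends of their antidiagonal. -/
lemma children_disjoint_or_contact : ∀ e ∈ windmillCuts, ∀ e' ∈ windmillCuts, e.1 = e'.1 → e ≠ e' →
    (e.2.2.1 + e.2.1 + 1 < e'.2.2.1 ∨ e'.2.2.1 + e'.2.1 + 1 < e.2.2.1 ∨
      e.2.2.2 + 1 < e'.2.2.2 ∨ e'.2.2.2 + 1 < e.2.2.2) ∨
    (e.2.2.1 + e.2.1 + 1 = e'.2.2.1 ∧ e.2.2.2 + 1 = e'.2.2.2) ∨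
    (e'.2.2.1 + e'.2.1 + 1 = e.2.2.1 ∧ e'.2.2.2 + 1 = e.2.2.2) ∨
    (e.2.2.1 + e.2.1 + 1 = e'.2.2.1 ∧ e'.2.2.2 + 1 = e.2.2.2 ∧ e.2.1 ≠ 1) ∨
    (e'.2.2.1 + e'.2.1 + 1 = e.2.2.1 ∧ e.2.2.2 + 1 = e'.2.2.2 ∧ e.2.1 ≠ 1) := by
  decide

lemma vertex_eq_point (s : Fin 3) (k : Fin 4) {x y : ℝ} (hx : x = 4 * ((s + 1) * col k))
    (hy : y = 4 * row k) : point s x y = vertex s k := by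
  rw [vertex, hx, hy]
  push_cast
  rfl

/-- The children of a representative meet at vertices of the children only. -/
lemma exists_contactVertex_of_mem_inter {e e' : Fin 3 × Fin 3 × ℕ × ℕ} (he : e ∈ windmillCuts)
    (he' : e' ∈ windmillCuts) (hs : e.1 = e'.1) (hne : e ≠ e') {x x' : Plane}
    (hx : x ∈ windmillK e.2.1) (hx' : x' ∈ windmillK e'.2.1)
    (h : windmillPsi e x = windmillPsi e' x') : ∃ k ∈ contactVertices e.2.1, x = vertex e.2.1 k := by
  obtain ⟨a, b, rfl, ha, ha', hb, hb'⟩ := exists_point_of_mem hx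
  obtain ⟨c, d, rfl, hc, hc', hd, hd'⟩ := exists_point_of_mem hx'
  rw [windmillPsi_point, windmillPsi_point, ← hs] at h
  obtain ⟨h1, h2⟩ := point_inj h
  rcases children_disjoint_or_contact e he e' he' hs hne with
    (h3 | h3 | h3 | h3) | ⟨h3, h4⟩ | ⟨h3, h4⟩ | ⟨h3, h4, h5⟩ | ⟨h3, h4, h5⟩
  · have := (Nat.cast_lt (α := ℝ)).2 h3
    push_cast at this
    linarith
  · have := (Nat.cast_lt (α := ℝ)).2 h3
    push_cast at this
    linarith
  · have := (Nat.cast_lt (α := ℝ)).2 h3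
    push_cast at this
    linarith
  · have := (Nat.cast_lt (α := ℝ)).2 h3
    push_cast at this
    linarith
  all_goals
    have h3 := congrArg (Nat.cast (R := ℝ)) h3
    have h4 := congrArg (Nat.cast (R := ℝ)) h4
    push_cast at h3 h4
  · exact ⟨2, by rw [contactVertices]; split_ifs <;> simp,
      vertex_eq_point _ _ (by simp [col]; linarith) (by simp [row]; linarith)⟩
  · exact ⟨0, by rw [contactVertices]; split_ifs <;> simp,
      vertex_eq_point _ _ (by simp [col]; linarith) (by simp [row]; linarith)⟩
  · exact ⟨1, by rw [contactVertices, if_neg h5]; simp,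
      vertex_eq_point _ _ (by simp [col]; linarith) (by simp [row]; linarith)⟩
  · exact ⟨3, by rw [contactVertices, if_neg h5]; simp,
      vertex_eq_point _ _ (by simp [col]; linarith) (by simp [row]; linarith)⟩

lemma children_at_vertices : ∀ e ∈ windmillCuts, e.2.2.1 + e.2.1 + 1 ≤ 4 * (e.1 + 1) ∧
    e.2.2.2 + 1 ≤ 4 ∧ ∀ k, k ∈ contactVertices e.1 ∧ (col k = 0 → e.2.2.1 = 0) ∧
      (col k = 1 → e.2.2.1 + e.2.1 + 1 = 4 * (e.1 + 1)) ∧ (row k = 0 → e.2.2.2 = 0) ∧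
      (row k = 1 → e.2.2.2 + 1 = 4) → k ∈ contactVertices e.2.1 := by
  decide

lemma col_row_eq (k : Fin 4) : (col k = 0 ∨ col k = 1) ∧ (row k = 0 ∨ row k = 1) := by
  revert k; decide

/-- The inheritance step for boundaries: a corner of the parent rectangle lying in a child is the
same corner of the child, and `children_at_vertices` checks that it is again a contact vertex for
the type of the child. -/
lemma exists_contactVertex_of_windmillPsi_eq {e : Fin 3 × Fin 3 × ℕ × ℕ} (he : e ∈ windmillCuts)
    {x : Plane} (hx : x ∈ windmillK e.2.1) {k : Fin 4} (hk : k ∈ contactVertices e.1)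
    (h : windmillPsi e x = vertex e.1 k) : ∃ k ∈ contactVertices e.2.1, x = vertex e.2.1 k := by
  obtain ⟨a, b, rfl, ha, ha', hb, hb'⟩ := exists_point_of_mem hx
  rw [windmillPsi_point] at h
  obtain ⟨h1, h2⟩ := point_inj h
  obtain ⟨h3, h4, h5⟩ := children_at_vertices e he
  have h3' := (Nat.cast_le (α := ℝ)).2 h3
  have h4' := (Nat.cast_le (α := ℝ)).2 h4
  have hi : (0 : ℝ) ≤ e.2.2.1 := by positivity
  have hj : (0 : ℝ) ≤ e.2.2.2 := by positivity
  push_cast at h1 h2 h3' h4'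
  obtain ⟨hx1, hx2, hx3⟩ : a = 4 * ((e.2.1 + 1) * col k) ∧ (col k = 0 → e.2.2.1 = 0) ∧
      (col k = 1 → e.2.2.1 + e.2.1 + 1 = 4 * (e.1 + 1)) := by
    rcases (col_row_eq k).1 with hc | hc
    · rw [hc] at h1 ⊢
      push_cast at h1 ⊢
      refine ⟨by linarith, fun _ => ?_, by simp⟩
      rw [← Nat.cast_eq_zero (R := ℝ)]; linarith
    · rw [hc] at h1 ⊢
      push_cast at h1 ⊢
      refine ⟨by linarith, by simp, fun _ => ?_⟩
      rw [← Nat.cast_inj (R := ℝ)]; push_cast; linarith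
  obtain ⟨hy1, hy2, hy3⟩ : b = 4 * row k ∧ (row k = 0 → e.2.2.2 = 0) ∧
      (row k = 1 → e.2.2.2 + 1 = 4) := by
    rcases (col_row_eq k).2 with hc | hc
    · rw [hc] at h2 ⊢
      push_cast at h2 ⊢
      refine ⟨by linarith, fun _ => ?_, by simp⟩
      rw [← Nat.cast_eq_zero (R := ℝ)]; linarith
    · rw [hc] at h2 ⊢
      push_cast at h2 ⊢
      refine ⟨by linarith, by simp, fun _ => ?_⟩
      rw [← Nat.cast_inj (R := ℝ)]; push_cast; linarith
  exact ⟨k, h5 k ⟨hk, hx2, hx3, hy2, hy3⟩, vertex_eq_point _ _ hx1 hy1⟩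

lemma walkMap_mem {s t : Fin 3} {w : List WindmillEdge}
    (hw : IsWalk windmill.ini windmill.fin s w t) {x : Plane} (hx : x ∈ windmillK t) :
    walkMap windmill.ψ w x ∈ windmillK s := by
  induction w generalizing s with
  | nil =>
    obtain rfl : s = t := hw
    exact hx
  | cons e w ih =>
    obtain ⟨rfl, hw⟩ := hw
    change _ ∈ windmill.K _
    rw [windmill.K_eq]
    exact Set.mem_iUnion₂.2 ⟨e, rfl, _, ih hw, rfl⟩

lemma exists_contactVertex_of_walkMap_eq {s t : Fin 3} {w : List WindmillEdge}
    (hw : IsWalk windmill.ini windmill.fin s w t) {x : Plane} (hx : x ∈ windmillK t)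
    (h : ∃ k ∈ contactVertices s, walkMap windmill.ψ w x = vertex s k) :
    ∃ k ∈ contactVertices t, x = vertex t k := by
  induction w generalizing s with
  | nil =>
    obtain rfl : s = t := hw
    exact h
  | cons e w ih =>
    obtain ⟨rfl, hw⟩ := hw
    obtain ⟨k, hk, h⟩ := h
    exact ih hw (exists_contactVertex_of_windmillPsi_eq e.2 (walkMap_mem hw hx) hk h)

lemma vertex_mem_boundary {u : List WindmillEdge} {s : Fin 3}
    (hu : IsWalk windmill.ini windmill.fin 0 u s) (e e' : WindmillEdge) (hs : e.1.1 = s)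
    (hs' : e'.1.1 = s) (hne : e ≠ e') (k k' : Fin 4)
    (h1 : e.1.2.2.1 + (e.1.2.1 + 1) * col k = e'.1.2.2.1 + (e'.1.2.1 + 1) * col k')
    (h2 : e.1.2.2.2 + row k = e'.1.2.2.2 + row k') :
    vertex e.1.2.1 k ∈ windmill.boundary 0 e.1.2.1 := by
  have hv : windmillPsi e.1 (vertex e.1.2.1 k) = windmillPsi e'.1 (vertex e'.1.2.1 k') := by
    rw [windmillPsi_vertex, windmillPsi_vertex, h1, h2, hs, hs']
  refine ⟨u ++ [e], by simp, isWalk_append.2 ⟨s, hu, hs, rfl⟩, vertex_mem _ _, u, [e], s, rfl,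
    by simp, hu, e, e', hne, hs, hs', ⟨_, vertex_mem _ _, rfl⟩, ?_⟩
  refine ⟨_, vertex_mem _ k', ?_⟩
  rw [walkMap_append, walkMap_append]
  exact congrArg _ hv.symm

/-- A boundary point arises where a child `a` of some ancestor meets a sibling; there it is a
contact vertex of `a`, and it remains one along the walk down to the island. Conversely, each
contact vertex is exhibited by an explicit pair of touching siblings. -/
lemma boundary_eq (t : Fin 3) : windmill.boundary 0 t = vertex t '' contactVertices t := by
  apply Set.Subset.antisymm
  · rintro x ⟨w, -, hw, hx, u, v, s, rfl, hv, hu, e, e', hne, hs, hs', h, h'⟩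
    obtain ⟨m, hm, hv'⟩ := isWalk_append.1 hw
    -- the two walks from the root along `u` end at the same state
    have hms : m = s := by
      clear * - hm hu
      generalize (0 : Fin 3) = o at hm hu
      induction u generalizing o with
      | nil => exact hm.symm.trans hu
      | cons a u ih => exact ih _ hm.2 hu.2
    subst hms
    obtain ⟨a, v, rfl⟩ := List.exists_cons_of_ne_nil hv
    obtain ⟨rfl, hv'⟩ := hv'
    -- Of two distinct children containing the point, at least one differs from the child `a`
    -- through which the walk passes.
    obtain ⟨f, hf, hfs, z, hz, hfz⟩ : ∃ f : WindmillEdge, f ≠ a ∧ f.1.1 = a.1.1 ∧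
        ∃ z ∈ windmillK f.1.2.1, walkMap windmill.ψ (u ++ [f]) z =
          walkMap windmill.ψ (u ++ a :: v) x := by
      rcases eq_or_ne e a with rfl | hea
      · exact ⟨e', hne.symm, hs', h'⟩
      · exact ⟨e, hea, hs, h⟩
    rw [walkMap_append, walkMap_append] at hfz
    have hfz := windmill.walkMap_injective _ hfz
    obtain ⟨k, hk, hvk⟩ := exists_contactVertex_of_mem_inter a.2 f.2 hfs.symm
      (fun h => hf (Subtype.ext h).symm) (walkMap_mem hv' hx) hz hfz.symm
    obtain ⟨k, hk, rfl⟩ := exists_contactVertex_of_walkMap_eq hv' hx ⟨k, hk, hvk⟩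
    exact ⟨k, hk, rfl⟩
  · rintro _ ⟨k, hk, rfl⟩
    have root : IsWalk windmill.ini windmill.fin 0 [] 0 := rfl
    -- The root has no children of type 2, so their contacts are found one level down.
    have one : IsWalk windmill.ini windmill.fin 0 [⟨(0, 1, 0, 0), by decide⟩] 1 := ⟨rfl, rfl⟩
    fin_cases t
    · fin_cases k
      · exact vertex_mem_boundary root ⟨(0, 0, 2, 1), by decide⟩ ⟨(0, 1, 0, 0), by decide⟩ rfl rfl
          (by decide) 0 2 rfl rfl
      · exact vertex_mem_boundary root ⟨(0, 0, 2, 1), by decide⟩ ⟨(0, 0, 3, 0), by decide⟩ rfl rfl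
          (by decide) 1 3 rfl rfl
      · exact vertex_mem_boundary root ⟨(0, 0, 1, 2), by decide⟩ ⟨(0, 1, 2, 3), by decide⟩ rfl rfl
          (by decide) 2 0 rfl rfl
      · exact vertex_mem_boundary root ⟨(0, 0, 2, 1), by decide⟩ ⟨(0, 0, 1, 2), by decide⟩ rfl rfl
          (by decide) 3 1 rfl rfl
    · fin_cases k
      · exact vertex_mem_boundary root ⟨(0, 1, 2, 3), by decide⟩ ⟨(0, 0, 1, 2), by decide⟩ rfl rfl
          (by decide) 0 2 rfl rfl
      · exact absurd hk (by decide)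
      · exact vertex_mem_boundary root ⟨(0, 1, 0, 0), by decide⟩ ⟨(0, 0, 2, 1), by decide⟩ rfl rfl
          (by decide) 2 0 rfl rfl
      · exact absurd hk (by decide)
    · fin_cases k
      · exact vertex_mem_boundary one ⟨(1, 2, 2, 3), by decide⟩ ⟨(1, 0, 1, 2), by decide⟩ rfl rfl
          (by decide) 0 2 rfl rfl
      · exact vertex_mem_boundary one ⟨(1, 2, 2, 3), by decide⟩ ⟨(1, 0, 5, 2), by decide⟩ rfl rfl
          (by decide) 1 3 rfl rfl
      · exact vertex_mem_boundary one ⟨(1, 2, 3, 0), by decide⟩ ⟨(1, 0, 6, 1), by decide⟩ rfl rfl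
          (by decide) 2 0 rfl rfl
      · exact vertex_mem_boundary one ⟨(1, 2, 3, 0), by decide⟩ ⟨(1, 0, 2, 1), by decide⟩ rfl rfl
          (by decide) 3 1 rfl rfl

/-! ### Laplacians and their energy forms -/

section Laplacian

variable {V : Finset Plane} {H H' : Matrix V V ℝ}

lemma dotProduct_mulVec_eq_neg_energy (hs : H.IsSymm) (h0 : ∀ x, ∑ y, H x y = 0) (u : V → ℝ) :
    u ⬝ᵥ H.mulVec u = -energy H u := by
  have h1 : ∑ x, ∑ y, H x y * u x ^ 2 = 0 := by
    simp only [← Finset.sum_mul, h0, zero_mul, Finset.sum_const_zero]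
  have h2 : ∑ x, ∑ y, H x y * u y ^ 2 = 0 := by
    rw [Finset.sum_comm, ← h1]
    exact Finset.sum_congr rfl fun x _ => Finset.sum_congr rfl fun y _ => by rw [hs.apply]
  have h3 : ∑ x, ∑ y, H x y * (u x - u y) ^ 2 = ∑ x, ∑ y, H x y * u x ^ 2 +
      ∑ x, ∑ y, H x y * u y ^ 2 - 2 * ∑ x, ∑ y, u x * (H x y * u y) := by
    simp only [Finset.mul_sum, ← Finset.sum_add_distrib, ← Finset.sum_sub_distrib]
    exact Finset.sum_congr rfl fun x _ => Finset.sum_congr rfl fun y _ => by ring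
  rw [energy, h3, h1, h2]
  simp only [dotProduct, Matrix.mulVec]
  simp only [← Finset.mul_sum]
  ring

lemma IsLaplacian.sum_eq_zero (h : IsLaplacian H) (x : V) : ∑ y, H x y = 0 := by
  have := congrFun ((h.ker (fun _ => 1)).2 ⟨1, fun _ => rfl⟩) x
  simpa [Matrix.mulVec, dotProduct] using this

/-- For a positive semidefinite matrix, a vector with vanishing quadratic form lies in the kernel,
which here consists of the constants. -/
lemma IsLaplacian.eq_of_energy_nonpos (h : IsLaplacian H) {u : V → ℝ} (hu : energy H u ≤ 0)
    (x y : V) : u x = u y := by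
  have hq := dotProduct_mulVec_eq_neg_energy h.symm h.sum_eq_zero
  have hpos : (-H).PosSemidef := by
    refine Matrix.PosSemidef.of_dotProduct_mulVec_nonneg ?_ fun w => ?_
    · rw [Matrix.IsHermitian, Matrix.conjTranspose_eq_transpose_of_trivial, Matrix.transpose_neg,
        h.symm]
    · have := h.nonpos w
      simp only [star_trivial, Matrix.neg_mulVec, dotProduct_neg]
      linarith
  have h0 : (-H).mulVec u = 0 := by
    rw [← hpos.dotProduct_mulVec_zero_iff]
    have h1 := h.nonpos u
    have h2 := hq u
    simp only [star_trivial, Matrix.neg_mulVec, dotProduct_neg]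
    linarith
  obtain ⟨c, hc⟩ := (h.ker u).1 (by rwa [Matrix.neg_mulVec, neg_eq_zero] at h0)
  rw [hc, hc]

lemma IsLaplacian.isNet_energy (h : IsLaplacian H) : IsNet (energy H) := by
  refine ⟨fun x y => if x = y then 0 else 1 / 2 * H x y, fun x y => ?_, fun u => ?_⟩
  · dsimp only
    split_ifs with hxy
    · exact le_rfl
    · exact mul_nonneg (by norm_num) (h.offDiag x y hxy)
  · rw [energy, Finset.mul_sum]
    refine Finset.sum_congr rfl fun x _ => ?_
    rw [Finset.mul_sum]
    refine Finset.sum_congr rfl fun y _ => ?_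
    dsimp only
    split_ifs with hxy
    · simp [hxy]
    · ring

lemma IsLaplacian.smul (h : IsLaplacian H) {c : ℝ} (hc : 0 < c) : IsLaplacian (c • H) where
  symm := h.symm.smul c
  nonpos u := by
    rw [Matrix.smul_mulVec, dotProduct_smul, smul_eq_mul]
    exact mul_nonpos_of_nonneg_of_nonpos hc.le (h.nonpos u)
  ker u := by rw [← h.ker u, Matrix.smul_mulVec, smul_eq_zero, or_iff_right hc.ne']
  offDiag x y hxy := mul_nonneg hc.le (h.offDiag x y hxy)

lemma energy_smul (c : ℝ) (u : V → ℝ) : energy (c • H) u = c * energy H u := by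
  simp only [energy, Finset.mul_sum, Matrix.smul_apply, smul_eq_mul]
  exact Finset.sum_congr rfl fun x _ => Finset.sum_congr rfl fun y _ => by ring

lemma energy_submatrix (σ : V ≃ V) (u : V → ℝ) :
    energy (H.submatrix σ σ) (u ∘ σ) = energy H u := by
  simp only [energy, Matrix.submatrix_apply, Function.comp]
  congr 1
  rw [← Equiv.sum_comp σ fun x => ∑ y, H x y * (u x - u y) ^ 2]
  exact Finset.sum_congr rfl fun x _ => Equiv.sum_comp σ fun y => H (σ x) y * (u (σ x) - u y) ^ 2

/-- Polarization on pairs of basis vectors recovers the entries from the form. -/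
lemma eq_of_energy_eq (hs : H.IsSymm) (h0 : ∀ x, ∑ y, H x y = 0) (hs' : H'.IsSymm)
    (h0' : ∀ x, ∑ y, H' x y = 0) (h : ∀ u, energy H u = energy H' u) : H = H' := by
  have hq : ∀ u : V → ℝ, u ⬝ᵥ H.mulVec u = u ⬝ᵥ H'.mulVec u := fun u => by
    rw [dotProduct_mulVec_eq_neg_energy hs h0, dotProduct_mulVec_eq_neg_energy hs' h0', h]
  have key : ∀ (K : Matrix V V ℝ), K.IsSymm → ∀ x y, 2 * K x y =
      (Pi.single x 1 + Pi.single y 1) ⬝ᵥ K.mulVec (Pi.single x 1 + Pi.single y 1) -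
        Pi.single x 1 ⬝ᵥ K.mulVec (Pi.single x 1) - Pi.single y 1 ⬝ᵥ K.mulVec (Pi.single y 1) := by
    intro K hK x y
    simp only [Matrix.mulVec_add, add_dotProduct, dotProduct_add, Matrix.mulVec_single_one,
      single_one_dotProduct, Matrix.col_apply]
    rw [hK.apply]
    ring
  ext x y
  have h1 := key H hs x y
  have h2 := key H' hs' x y
  rw [hq, hq, hq, ← h2] at h1
  linarith

lemma IsNet.exists_laplacian {Q : (V → ℝ) → ℝ} (h : IsNet Q)
    (hQ : ∀ u, Q u ≤ 0 → ∀ x y, u x = u y) : ∃ H : Matrix V V ℝ, IsLaplacian H ∧ energy H = Q := by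
  obtain ⟨g, hg, hgQ⟩ := h
  let k : V → V → ℝ := fun x y => if x = y then 0 else g x y + g y x
  have hk : ∀ x y, 0 ≤ k x y := fun x y => by
    simp only [k]; split_ifs
    exacts [le_rfl, add_nonneg (hg _ _) (hg _ _)]
  let H : Matrix V V ℝ := Matrix.of fun x y => k x y - if x = y then ∑ z, k x z else 0
  have hH : ∀ x y, x ≠ y → H x y = g x y + g y x := fun x y hxy => by simp [H, k, hxy]
  have hs : H.IsSymm := by
    refine Matrix.IsSymm.ext fun x y => ?_
    rcases eq_or_ne x y with rfl | hxy
    · rfl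
    · rw [hH _ _ hxy, hH _ _ hxy.symm, add_comm]
  have h0 : ∀ x, ∑ y, H x y = 0 := fun x => by simp [H, Finset.sum_sub_distrib]
  have hE : ∀ u, energy H u = Q u := by
    intro u
    have e1 : ∑ x, ∑ y, H x y * (u x - u y) ^ 2 = ∑ x, ∑ y, (g x y + g y x) * (u x - u y) ^ 2 :=
      Finset.sum_congr rfl fun x _ => Finset.sum_congr rfl fun y _ => by
        rcases eq_or_ne x y with rfl | hxy
        · simp
        · rw [hH _ _ hxy]
    have e2 : ∑ x, ∑ y, g y x * (u x - u y) ^ 2 = Q u := by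
      rw [Finset.sum_comm, hgQ]
      exact Finset.sum_congr rfl fun x _ => Finset.sum_congr rfl fun y _ => by ring
    rw [energy, e1]
    simp only [add_mul, Finset.sum_add_distrib, e2, ← hgQ]
    ring
  have hq := dotProduct_mulVec_eq_neg_energy hs h0
  refine ⟨H, ⟨hs, fun u => ?_, fun u => ⟨fun hu => ?_, ?_⟩, fun x y hxy => ?_⟩, funext hE⟩
  · rw [hq, hE, neg_nonpos]
    exact IsNet.nonneg ⟨g, hg, hgQ⟩ u
  · have h1 := hq u
    rw [hu, dotProduct_zero, hE] at h1
    have h2 := hQ u (by linarith)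
    rcases isEmpty_or_nonempty V with hV | ⟨⟨x⟩⟩
    · exact ⟨0, fun x => hV.elim x⟩
    · exact ⟨u x, fun y => h2 y x⟩
  · rintro ⟨c, hc⟩
    obtain rfl : u = fun _ => c := funext hc
    ext x
    simp only [Matrix.mulVec, dotProduct, ← Finset.sum_mul, h0, zero_mul, Pi.zero_apply]
  · rw [hH _ _ hxy]
    exact add_nonneg (hg _ _) (hg _ _)

end Laplacian

/-! ### Boundary sets that consist of vertices of the rectangles -/

/-- The boundary sets `B s` consist of the vertices of the rectangles with the numbers in `A s`. -/
structure IsVertexBoundary (B : Fin 3 → Finset Plane) (A : Fin 3 → Finset (Fin 4)) : Prop where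
  coe_eq : ∀ s, (B s : Set Plane) = vertex s '' A s
  contact : ∀ s, contactVertices s ⊆ A s
  opposite_mem : ∀ s, ∀ k ∈ A s, opposite k ∈ A s

/-- The energy of a network on `B s` as a function of the potentials of the vertices of the
rectangle. -/
def form {B : Fin 3 → Finset Plane} (D : ∀ s, Matrix (B s) (B s) ℝ) (s : Fin 3) (x : Fin 4 → ℝ) :
    ℝ :=
  energy (D s) (fun p => Function.extend (vertex s) x 0 p)

namespace IsVertexBoundary

variable {B : Fin 3 → Finset Plane} {A : Fin 3 → Finset (Fin 4)} {D : ∀ s, Matrix (B s) (B s) ℝ}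

lemma vertex_mem (hB : IsVertexBoundary B A) {s : Fin 3} {k : Fin 4} (hk : k ∈ A s) :
    vertex s k ∈ B s := by
  rw [← Finset.mem_coe, hB.coe_eq]
  exact ⟨k, hk, rfl⟩

lemma exists_index (hB : IsVertexBoundary B A) (s : Fin 3) :
    ∃ i : B s → Fin 4, ∀ p, i p ∈ A s ∧ vertex s (i p) = p := by
  have : ∀ p : B s, ∃ k, k ∈ A s ∧ vertex s k = p := fun p => by
    have hp : (p : Plane) ∈ (B s : Set Plane) := p.2
    rw [hB.coe_eq] at hp
    exact hp
  exact ⟨fun p => (this p).choose, fun p => (this p).choose_spec⟩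

lemma energy_eq_form (hB : IsVertexBoundary B A) {s : Fin 3} {u : B s → ℝ} {x : Fin 4 → ℝ}
    (h : ∀ k (hk : k ∈ A s), u ⟨vertex s k, hB.vertex_mem hk⟩ = x k) :
    energy (D s) u = form D s x := by
  rw [form]
  congr 1
  ext p
  obtain ⟨i, hi⟩ := hB.exists_index s
  have h1 := h (i p) (hi p).1
  have h2 : (⟨vertex s (i p), hB.vertex_mem (hi p).1⟩ : B s) = p := Subtype.ext (hi p).2
  rw [h2] at h1
  rw [h1, ← (hi p).2, (vertex_injective s).extend_apply]

lemma isNet_form (hB : IsVertexBoundary B A) {s : Fin 3} (hD : IsLaplacian (D s)) :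
    IsNet (form D s) := by
  obtain ⟨i, hi⟩ := hB.exists_index s
  convert hD.isNet_energy.comp i using 2 with x
  refine (hB.energy_eq_form fun k hk => ?_).symm
  exact congrArg x (vertex_injective s (hi ⟨vertex s k, hB.vertex_mem hk⟩).2)

lemma eq_of_form_nonpos (hB : IsVertexBoundary B A) {s : Fin 3} (hD : IsLaplacian (D s))
    {x : Fin 4 → ℝ} (hx : form D s x ≤ 0) {k l : Fin 4} (hk : k ∈ A s) (hl : l ∈ A s) :
    x k = x l := by
  have := hD.eq_of_energy_nonpos hx ⟨_, hB.vertex_mem hk⟩ ⟨_, hB.vertex_mem hl⟩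
  simpa only [(vertex_injective s).extend_apply] using this

lemma eq_smul_of_form_eq (hB : IsVertexBoundary B A) {D' : ∀ s, Matrix (B s) (B s) ℝ} {s : Fin 3}
    (hD : IsLaplacian (D s)) (hD' : IsLaplacian (D' s)) {c : ℝ} (hc : 0 < c)
    (h : ∀ x, form D s x = c * form D' s x) : D s = c • D' s := by
  have hD'' := hD'.smul hc
  refine eq_of_energy_eq hD.symm hD.sum_eq_zero hD''.symm hD''.sum_eq_zero fun u => ?_
  have hu : ∀ k (hk : k ∈ A s), u ⟨vertex s k, hB.vertex_mem hk⟩ =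
      (fun k => if hk : k ∈ A s then u ⟨vertex s k, hB.vertex_mem hk⟩ else 0) k :=
    fun k hk => by simp [hk]
  rw [energy_smul, hB.energy_eq_form hu, hB.energy_eq_form hu, h]

lemma opposite_opposite (k : Fin 4) : opposite (opposite k) = k := by
  revert k; decide

lemma halfTurn_halfTurn (s : Fin 3) (x : Plane) : halfTurn s (halfTurn s x) = x := by
  simp [halfTurn]

lemma halfTurn_mem (hB : IsVertexBoundary B A) {s : Fin 3} (p : B s) : halfTurn s p ∈ B s := by
  obtain ⟨i, hi⟩ := hB.exists_index s
  rw [← (hi p).2, halfTurn_vertex]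
  exact hB.vertex_mem (hB.opposite_mem s _ (hi p).1)

/-- The half turn permutes `B s`, and Laplacians are determined by their forms, so invariance can be
read off from potentials at the four corners. -/
lemma isRotationSymmetric_iff (hB : IsVertexBoundary B A) (hD : ∀ s, IsLaplacian (D s)) :
    IsRotationSymmetric B D ↔ ∀ s x, form D s (x ∘ opposite) = form D s x := by
  let σ : ∀ s, B s ≃ B s := fun s =>
    ⟨fun p => ⟨halfTurn s p, hB.halfTurn_mem p⟩, fun p => ⟨halfTurn s p, hB.halfTurn_mem p⟩,
      fun p => Subtype.ext (halfTurn_halfTurn s p), fun p => Subtype.ext (halfTurn_halfTurn s p)⟩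
  have hF : ∀ s x, energy (D s) ((fun p : B s => Function.extend (vertex s) x 0 p) ∘ σ s) =
      form D s (x ∘ opposite) := by
    intro s x
    refine hB.energy_eq_form fun k hk => ?_
    simp only [Function.comp, σ, Equiv.coe_fn_mk, halfTurn_vertex,
      (vertex_injective s).extend_apply]
  constructor
  · intro h s x
    have hσ : (D s).submatrix (σ s) (σ s) = D s := by
      ext p r
      exact h s p r (σ s p) (σ s r) rfl rfl
    rw [← hF, form]
    conv_lhs => rw [← hσ]
    exact energy_submatrix _ _
  · intro h s p r p' r' hp hr
    obtain rfl : p' = σ s p := Subtype.ext hp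
    obtain rfl : r' = σ s r := Subtype.ext hr
    have hσ : (D s).submatrix (σ s) (σ s) = D s := by
      refine eq_of_energy_eq ((hD s).symm.submatrix _) (fun x => ?_) (hD s).symm
        (hD s).sum_eq_zero fun u => ?_
      · exact (Equiv.sum_comp (σ s) fun y => D s (σ s x) y).trans ((hD s).sum_eq_zero _)
      · let x : Fin 4 → ℝ := fun k => if hk : k ∈ A s then u ⟨vertex s k, hB.vertex_mem hk⟩ else 0
        have hu : ∀ k (hk : k ∈ A s), u ⟨vertex s k, hB.vertex_mem hk⟩ = x k :=
          fun k hk => by simp [x, hk]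
        have hu' : ∀ k (hk : k ∈ A s), (u ∘ (σ s).symm) ⟨vertex s k, hB.vertex_mem hk⟩ =
            (x ∘ opposite) k := fun k hk => by
          rw [Function.comp_apply, Function.comp_apply, ← hu _ (hB.opposite_mem s k hk)]
          exact congrArg u (Subtype.ext (halfTurn_vertex s k))
        have e1 := energy_submatrix (H := D s) (σ s) (u ∘ (σ s).symm)
        rw [Function.comp_assoc, Equiv.symm_comp_self, Function.comp_id] at e1
        rw [e1, hB.energy_eq_form hu, hB.energy_eq_form hu', h]
    exact congrFun (congrFun hσ p) r

end IsVertexBoundary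

/-- Functions of four potentials with separate arguments. -/
def curried (N : Fin 3 → (Fin 4 → ℝ) → ℝ) (s : Fin 3) (x₀ x₁ x₂ x₃ : ℝ) : ℝ :=
  N s ![x₀, x₁, x₂, x₃]

/-- The columns of the grid of the state `s` that contain vertices of the rectangle. -/
def vertexCol (s : Fin 3) (k : Fin 4) : ℕ := 4 * ((s + 1) * col k)

/-- The vertices `B s` are vertices of level one. -/
lemma IsVertexBoundary.subset_levelOneVertices {B : Fin 3 → Finset Plane}
    {A : Fin 3 → Finset (Fin 4)} (hB : IsVertexBoundary B A) (s : Fin 3) :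
    (B s : Set Plane) ⊆ levelOneVertices windmill B s := by
  have key : ∀ s k, ∃ e ∈ windmillCuts, e.1 = s ∧ k ∈ contactVertices e.2.1 ∧
      e.2.2.1 + (e.2.1 + 1) * col k = 4 * ((s + 1) * col k) ∧ e.2.2.2 + row k = 4 * row k := by
    decide
  rw [hB.coe_eq]
  rintro _ ⟨k, hk, rfl⟩
  obtain ⟨e, he, rfl, hke, h1, h2⟩ := key s k
  refine Set.mem_iUnion₂.2 ⟨⟨e, he⟩, rfl, vertex e.2.1 k, hB.vertex_mem (hB.contact _ hke), ?_⟩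
  change windmillPsi e _ = _
  rw [windmillPsi_vertex, h1, h2, vertex]

/-! ### Removing the quotients `c t / c s` from the renormalization factors -/

section Renormalization

variable {B : Fin 3 → Finset Plane} {A : Fin 3 → Finset (Fin 4)} {D : ∀ s, Matrix (B s) (B s) ℝ}
  {r : WindmillEdge → ℝ} {ρ : ℝ} {c : Fin 3 → ℝ}

/-- A change of gauge: the factor `(c t)⁻¹` is absorbed into the form of the child and `c s` is
common to all children, so the normalized forms `(c s)⁻¹ * form D s` are renormalized with the
single constant `ρ`. -/
lemma levelOneEnergy_eq (hB : IsVertexBoundary B A) (hc : ∀ s, c s ≠ 0)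
    (hr : ∀ e, r e = ρ * (c (windmill.fin e) / c (windmill.ini e))) (s : Fin 3)
    (u : Plane → ℝ) : levelOneEnergy windmill B D r s u =
      c s * (ρ⁻¹ * levelSum (curried fun s x => (c s)⁻¹ * form D s x) s
        (fun i j => u (point s i j))) := by
  have h1 : ∀ e : WindmillEdge, windmill.ini e = s → (r e)⁻¹ * energy (D (windmill.fin e))
      (fun x => u (windmill.ψ e x)) = c s * (ρ⁻¹ * ((c e.1.2.1)⁻¹ * form D e.1.2.1
        (fun k => u (point e.1.1 ((e.1.2.2.1 + (e.1.2.1 + 1) * col k : ℕ) : ℝ)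
          ((e.1.2.2.2 + row k : ℕ) : ℝ))))) := by
    rintro e rfl
    rw [hB.energy_eq_form (x := fun k => u (point e.1.1
      ((e.1.2.2.1 + (e.1.2.1 + 1) * col k : ℕ) : ℝ) ((e.1.2.2.2 + row k : ℕ) : ℝ)))
      fun k hk => by rw [← windmillPsi_vertex]; rfl, hr]
    change (ρ * (c e.1.2.1 / c e.1.1))⁻¹ * form D e.1.2.1 _ = _
    have := hc e.1.2.1
    rw [mul_inv, inv_div]
    change _ = c e.1.1 * _
    ring
  rw [levelOneEnergy, Finset.sum_congr rfl fun e he => h1 e (Finset.mem_filter.1 he).2,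
    levelSum, ← Finset.mul_sum, ← Finset.mul_sum, Finset.sum_filter, Finset.sum_filter,
    ← Finset.sum_coe_sort windmillCuts]
  congr 2
  refine Finset.sum_congr rfl fun e _ => ?_
  change (if e.1.1 = s then _ else _) = _
  split_ifs with hs
  · subst hs
    rw [curried]
    congr 2
    ext k
    fin_cases k <;> simp [col, row]
  · rfl

/-- The renormalization equations in grid coordinates. -/
lemma isHarmonicStructure_iff (hB : IsVertexBoundary B A) (hD : ∀ s, IsLaplacian (D s))
    (hρ : 0 < ρ) (hc : ∀ s, 0 < c s)
    (hr : ∀ e, r e = ρ * (c (windmill.fin e) / c (windmill.ini e))) :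
    IsHarmonicStructure windmill B D r ↔ ∀ s y m, (c s)⁻¹ * form D s y ≤ m ↔
      ∃ U : ℕ → ℕ → ℝ, (∀ k ∈ A s, U (vertexCol s k) (4 * row k) = y k) ∧
        levelSum (curried fun s x => (c s)⁻¹ * form D s x) s U ≤ ρ * m := by
  have hlevel := fun s u => levelOneEnergy_eq (D := D) hB (fun s => (hc s).ne') hr s u
  have hpt : ∀ s, Function.Injective fun ij : ℕ × ℕ => point s ij.1 ij.2 := by
    rintro s ⟨i, j⟩ ⟨i', j'⟩ h
    obtain ⟨h1, h2⟩ := point_inj h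
    exact Prod.ext (Nat.cast_injective h1) (Nat.cast_injective h2)
  have key : ∀ s (v : B s → ℝ) (y : Fin 4 → ℝ)
      (_ : ∀ k (hk : k ∈ A s), v ⟨vertex s k, hB.vertex_mem hk⟩ = y k),
      (IsLeast {m : ℝ | ∃ u : Plane → ℝ, (∀ x : B s, u x = v x) ∧
        levelOneEnergy windmill B D r s u = m} (energy (D s) v) ↔
      ∀ m, (c s)⁻¹ * form D s y ≤ m ↔
      ∃ U : ℕ → ℕ → ℝ, (∀ k ∈ A s, U (vertexCol s k) (4 * row k) = y k) ∧
        levelSum (curried fun s x => (c s)⁻¹ * form D s x) s U ≤ ρ * m) := by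
    intro s v y hvy
    rw [isLeast_iff_epigraph, hB.energy_eq_form hvy]
    have e1 : ∀ m, ((c s)⁻¹ * form D s y ≤ m ↔ form D s y ≤ c s * m) := fun m => by
      rw [inv_mul_le_iff₀ (hc s)]
    have e2 : ∀ m, (∃ u : Plane → ℝ, (∀ x : B s, u x = v x) ∧
        levelOneEnergy windmill B D r s u ≤ c s * m) ↔
        ∃ U : ℕ → ℕ → ℝ, (∀ k ∈ A s, U (vertexCol s k) (4 * row k) = y k) ∧
        levelSum (curried fun s x => (c s)⁻¹ * form D s x) s U ≤ ρ * m := by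
      intro m
      constructor
      · rintro ⟨u, hu, hm⟩
        refine ⟨fun i j => u (point s i j), fun k hk => ?_, ?_⟩
        · rw [← hvy k hk, ← hu]
          rfl
        · rwa [hlevel, mul_le_mul_iff_right₀ (hc s), inv_mul_le_iff₀ hρ] at hm
      · rintro ⟨U, hU, hm⟩
        have hx : ∀ i j : ℕ, Function.extend (fun ij : ℕ × ℕ => point s ij.1 ij.2)
            (fun ij => U ij.1 ij.2) 0 (point s i j) = U i j := fun i j =>
          (hpt s).extend_apply _ _ (i, j)
        refine ⟨Function.extend (fun ij : ℕ × ℕ => point s ij.1 ij.2) (fun ij => U ij.1 ij.2) 0,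
          fun p => ?_, ?_⟩
        · obtain ⟨i, hi⟩ := hB.exists_index s
          have hp : p = ⟨vertex s (i p), hB.vertex_mem (hi p).1⟩ := Subtype.ext (hi p).2.symm
          rw [hp, hvy _ (hi p).1, ← hU _ (hi p).1]
          exact hx _ _
        · rw [hlevel, mul_le_mul_iff_right₀ (hc s), inv_mul_le_iff₀ hρ]
          simpa only [hx] using hm
    constructor
    · intro h m
      rw [e1, h, e2]
    · intro h m
      obtain ⟨m, rfl⟩ : ∃ m', m = c s * m' := ⟨(c s)⁻¹ * m, by rw [mul_inv_cancel_left₀ (hc s).ne']⟩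
      rw [← e1, h, e2]
  constructor
  · intro h s y
    refine (key s (fun p => Function.extend (vertex s) y 0 p) y fun k hk => ?_).1
      (h.renormalization s _)
    exact (vertex_injective s).extend_apply _ _ _
  · intro h
    refine ⟨hD, fun e => ?_, hB.subset_levelOneVertices, fun s v => ?_⟩
    · rw [hr]
      exact mul_pos hρ (div_pos (hc _) (hc _))
    · exact (key s v (fun k => if hk : k ∈ A s then v ⟨vertex s k, hB.vertex_mem hk⟩ else 0)
        fun k hk => by simp [hk]).2 (h s _)

end Renormalization

/-! ### Self-consistency of the resistances -/

/-- For every state, `N` is the network that is obtained from the ladder with the factor `ρ` by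
restricting it to the vertices in `A`. -/
def IsLadderTrace (A : Fin 3 → Finset (Fin 4)) (N : Fin 3 → (Fin 4 → ℝ) → ℝ) (P M g f ρ : ℝ) :
    Prop :=
  ∀ s y m, N s y ≤ m ↔ ∃ z : Fin 4 → ℝ, (∀ k ∈ A s, z k = y k) ∧ Ladder s P M g f z (ρ * m)

/-- The networks of level one are equivalent to ladders whose resistances are determined by those
of the restrictions of the cells. -/
lemma HasTraces.levelSum_iff {E : Fin 3 → ℝ → ℝ → ℝ → ℝ → ℝ} {a b c d e : ℝ}
    (T : HasTraces E a b c d e) (ha : 0 ≤ a) (hb : 0 ≤ b) (hc : 0 ≤ c) (hd : 0 ≤ d) (he : 0 ≤ e)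
    (A : Finset (Fin 4)) (s : Fin 3) (y : Fin 4 → ℝ) (m : ℝ) :
    (∃ U : ℕ → ℕ → ℝ, (∀ k ∈ A, U (vertexCol s k) (4 * row k) = y k) ∧ levelSum E s U ≤ m) ↔
      ∃ z : Fin 4 → ℝ, (∀ k ∈ A, z k = y k) ∧
        Ladder s (b + d) (2 * a + c) (2 * c) (a + e + b) z m := by
  have key : ∀ z : Fin 4 → ℝ, (∃ U : ℕ → ℕ → ℝ, (∀ k, U (vertexCol s k) (4 * row k) = z k) ∧
      levelSum E s U ≤ m) ↔ Ladder s (b + d) (2 * a + c) (2 * c) (a + e + b) z m := by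
    intro z
    simp only [Fin.forall_fin_succ, IsEmpty.forall_iff, and_true]
    fin_cases s
    · exact T.levelSum_zero_iff ha hb hc hd _ _ _ _ _
    · exact T.levelSum_one_iff ha hb hc hd he _ _ _ _ _
    · exact T.levelSum_two_iff ha hb hc hd he _ _ _ _ _
  constructor
  · rintro ⟨U, hU, hm⟩
    exact ⟨fun k => U (vertexCol s k) (4 * row k), hU, (key _).1 ⟨U, fun k => rfl, hm⟩⟩
  · rintro ⟨z, hz, hm⟩
    obtain ⟨U, hU, hm⟩ := (key _).2 hm
    exact ⟨U, fun k hk => (hU k).trans (hz k hk), hm⟩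

/-- One application of renormalization to the five resistances. A budget `ρ * m` in place of `m`
multiplies every resistance by `ρ`. -/
lemma IsLadderTrace.hasTraces {A : Fin 3 → Finset (Fin 4)} (hA : ∀ s, contactVertices s ⊆ A s)
    {N : Fin 3 → (Fin 4 → ℝ) → ℝ} {P M g f ρ : ℝ} (h : IsLadderTrace A N P M g f ρ) (hP : 0 ≤ P)
    (hM : 0 ≤ M) (hg : 0 ≤ g) (hf : 0 < f) (hρ : 0 < ρ) :
    HasTraces (curried N) (ρ * M) (ρ * P) (ρ * (g + M)) (ρ * (2 * P + (f + g) / 2))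
      (ρ * (P + M + 2 * f * (f + g) / (2 * f + g))) := by
  have h0 : ∀ x₀ x₁ x₂ x₃ m, curried N 0 x₀ x₁ x₂ x₃ ≤ m ↔ LadderOne P M g x₀ x₁ x₂ x₃ (ρ * m) := by
    intro x₀ x₁ x₂ x₃ m
    rw [curried, h]
    constructor
    · rintro ⟨z, hz, hm⟩
      obtain rfl : z = ![x₀, x₁, x₂, x₃] := funext fun k => hz k (hA 0 (by revert k; decide))
      exact hm
    · exact fun hm => ⟨_, fun _ _ => rfl, hm⟩
  have h2 : ∀ x₀ x₁ x₂ x₃ m, curried N 2 x₀ x₁ x₂ x₃ ≤ m ↔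
      LadderThree P M g f x₀ x₁ x₂ x₃ (ρ * m) := by
    intro x₀ x₁ x₂ x₃ m
    rw [curried, h]
    constructor
    · rintro ⟨z, hz, hm⟩
      obtain rfl : z = ![x₀, x₁, x₂, x₃] := funext fun k => hz k (hA 2 (by revert k; decide))
      exact hm
    · exact fun hm => ⟨_, fun _ _ => rfl, hm⟩
  refine ⟨?_, ?_, ?_, ?_, ?_⟩
  · intro x₀ x₁ x₃ m
    simp only [h0]
    rw [LadderOne.exists_upperRight hM hg, Star.scale ρ hρ]
  · intro x₀ x₁ x₃ m
    simp only [h0]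
    rw [LadderOne.exists_lowerLeft hM hg, Star.scale ρ hρ]
  -- In state 1 only the two contact vertices are certain to belong to `A 1`; the potentials at the
  -- other two are free on both sides, which makes this sufficient.
  · intro x₀ x₂ m
    rw [Res.scale ρ hρ, ← LadderTwo.exists_antidiagonal hP hg hf]
    constructor
    · rintro ⟨x₁, x₃, hx⟩
      obtain ⟨z, hz, hm⟩ := (h _ _ _).1 hx
      obtain rfl : z 0 = x₀ := hz 0 (hA 1 (by decide))
      obtain rfl : z 2 = x₂ := hz 2 (hA 1 (by decide))
      exact ⟨z 1, z 3, hm⟩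
    · rintro ⟨x₁, x₃, hm⟩
      exact ⟨x₁, x₃, (h _ _ _).2 ⟨_, fun _ _ => rfl, hm⟩⟩
  · intro x₀ x₁ m
    simp only [h2]
    rw [LadderThree.exists_upper hP hM hg hf, Res.scale ρ hρ]
  · intro x₂ x₃ m
    simp only [h2]
    rw [LadderThree.exists_lower hP hM hg hf, Res.scale ρ hρ]

/-! ### Uniqueness and scaling of the five resistances -/

namespace HasTraces

variable {E : Fin 3 → ℝ → ℝ → ℝ → ℝ → ℝ} {a b c d e a' b' c' d' e' : ℝ}

lemma unique (T : HasTraces E a b c d e) (T' : HasTraces E a' b' c' d' e') (ha : 0 ≤ a)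
    (hb : 0 ≤ b) (hc : 0 ≤ c) (hd : 0 < d) (he : 0 < e) (hab : 0 < a + b) (hac : 0 < a + c)
    (hbc : 0 < b + c) (ha' : 0 ≤ a') (hb' : 0 ≤ b') (hc' : 0 ≤ c') :
    a = a' ∧ b = b' ∧ c = c' ∧ d = d' ∧ e = e' := by
  obtain ⟨h1, h2, h3⟩ := Star.eq_of_forall ha hb hc ha' hb' hc' hab hac hbc fun x y z m =>
    (T.star_lower y x z m).symm.trans (T'.star_lower y x z m)
  exact ⟨h1, h2, h3,
    Res.eq_of_forall hd fun x y t => (T.diagonal x y t).symm.trans (T'.diagonal x y t),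
    Res.eq_of_forall he fun x y t => (T.lower x y t).symm.trans (T'.lower x y t)⟩

lemma inv_scale (T : HasTraces E (a * a') (a * b') (a * c') (a * d') (a * e')) (ha : 0 < a) :
    HasTraces (fun s x₀ x₁ x₂ x₃ => a * E s x₀ x₁ x₂ x₃) a' b' c' d' e' := by
  have key : ∀ t m : ℝ, a * t ≤ m ↔ t ≤ a⁻¹ * m := fun t m => (le_inv_mul_iff₀ ha).symm
  have hk : ∀ m, a * (a⁻¹ * m) = m := mul_inv_cancel_left₀ ha.ne'
  refine ⟨?_, ?_, ?_, ?_, ?_⟩ <;> intros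
  · simp only [key, T.star_lower, Star.scale a ha, hk]
  · simp only [key, T.star_upper, Star.scale a ha, hk]
  · simp only [key, T.diagonal, Res.scale a ha, hk]
  · simp only [key, T.lower, Res.scale a ha, hk]
  · simp only [key, T.upper, Res.scale a ha, hk]

end HasTraces

/-- The solution of the equations that express the self-consistency of the resistances. -/
lemma solve_resistances {a b c d e ρ : ℝ} (hc : 0 ≤ c) (he : 0 < e)
    (hac : 0 < a + c) (h1 : a = ρ * (2 * a + c)) (h2 : b = ρ * (b + d))
    (h3 : c = ρ * (2 * c + (2 * a + c)))
    (h4 : d = ρ * (2 * (b + d) + (a + e + b + 2 * c) / 2))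
    (h5 : e = ρ * (b + d + (2 * a + c) +
      2 * (a + e + b) * (a + e + b + 2 * c) / (2 * (a + e + b) + 2 * c))) :
    ρ = 1 / 4 ∧ 0 < a ∧ b = a * ((13 + √73) / 16) ∧ c = a * 2 ∧ d = a * (3 * (13 + √73) / 16) ∧
      e = a * ((11 + 7 * √73) / 16) := by
  have hρ : ρ = 1 / 4 := by
    -- The pair `(a, c)` evolves by itself, and the sum of its two equations is `a + c = 4 * ρ * (a
    -- + c)`.
    have : (a + c) * (4 * ρ - 1) = 0 := by linear_combination -h1 - h3
    rcases mul_eq_zero.1 this with h | h <;> linarith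
  subst hρ
  have hc2 : c = a * 2 := by linarith
  have ha0 : 0 < a := by linarith
  have hd3 : d = 3 * b := by linarith
  subst hc2 hd3
  obtain rfl : e = 7 * b - 5 * a := by linarith
  -- All but one of the equations have become linear substitutions; the last one leaves this
  -- quadratic for `b / a`.
  have hq : 8 * b ^ 2 - 13 * (a * b) + 3 * a ^ 2 = 0 := by
    have hden : 2 * (a + (7 * b - 5 * a) + b) + 2 * (a * 2) ≠ 0 := by linarith
    have h6 : 2 * (a + (7 * b - 5 * a) + b) * (a + (7 * b - 5 * a) + b + 2 * (a * 2)) /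
        (2 * (a + (7 * b - 5 * a) + b) + 2 * (a * 2)) = 24 * b - 24 * a := by linarith
    rw [div_eq_iff hden] at h6
    linarith
  have hs : √73 ^ 2 = 73 := Real.sq_sqrt (by norm_num)
  have hs8 : 8 < √73 := Real.lt_sqrt_of_sq_lt (by norm_num)
  have hb : b = a * ((13 + √73) / 16) := by
    have : (16 * b - 13 * a - √73 * a) * (16 * b - 13 * a + √73 * a) = 0 := by
      linear_combination 32 * hq - a ^ 2 * hs
    rcases mul_eq_zero.1 this with h | h
    · linarith
    -- The smaller root would make `e = 7 * b - 5 * a` negative.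
    · have := mul_lt_mul_of_pos_right hs8 ha0
      linarith
  exact ⟨rfl, ha0, hb, rfl, by rw [hb]; ring, by rw [hb]; ring⟩

/-! ### Existence of traces -/

/-- Every symmetric structure has resistances `a, b, c, d, e`, by restriction and the Δ-Y
transformation. The half turn carries the lower restrictions to the upper ones, so both share the
same values. -/
lemma exists_hasTraces {N : Fin 3 → (Fin 4 → ℝ) → ℝ} (hnet : ∀ s, IsNet (N s))
    (hdef : ∀ s x, N s x ≤ 0 → ∀ k ∈ contactVertices s, ∀ l ∈ contactVertices s, x k = x l)
    (hrot : ∀ s x, N s (x ∘ opposite) = N s x) :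
    ∃ a b c d e, 0 ≤ a ∧ 0 ≤ b ∧ 0 ≤ c ∧ 0 < d ∧ 0 < e ∧ 0 < a + b ∧ 0 < a + c ∧ 0 < b + c ∧
      HasTraces (curried N) a b c d e := by
  have hrot' : ∀ s x₀ x₁ x₂ x₃, curried N s x₀ x₁ x₂ x₃ = curried N s x₂ x₃ x₀ x₁ := by
    intro s x₀ x₁ x₂ x₃
    rw [curried, curried, ← hrot]
    congr 1
    ext k
    fin_cases k <;> rfl
  obtain ⟨Q₀, n₀, h₀⟩ := (hnet 0).exists_trace ![(1 : Fin 4), 0, 3] (by decide)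
  obtain ⟨Q₁, n₁, h₁⟩ := (hnet 1).exists_trace ![(0 : Fin 4), 2] (by decide)
  obtain ⟨Q₂, n₂, h₂⟩ := (hnet 2).exists_trace ![(0 : Fin 4), 1] (by decide)
  obtain ⟨a, b, c, ha, hb, hc, hab, hac, hbc, hY⟩ := n₀.exists_star fun x hx => by
    obtain ⟨y, hy, hm⟩ := (h₀ _ _).1 hx
    rw [← hy, ← hy, ← hy]
    exact ⟨hdef 0 y hm _ (by decide) _ (by decide), hdef 0 y hm _ (by decide) _ (by decide)⟩
  obtain ⟨d, hd, hR⟩ := n₁.exists_resistance (by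
    by_contra hn
    obtain ⟨y, hy, hm⟩ := (h₁ _ _).1 (not_lt.1 hn)
    have h := hdef 1 y hm 0 (by decide) 2 (by decide)
    have e0 : y 0 = 1 := hy 0
    have e1 : y 2 = 0 := hy 1
    rw [e0, e1] at h
    exact one_ne_zero h)
  obtain ⟨e, he, hR'⟩ := n₂.exists_resistance (by
    by_contra hn
    obtain ⟨y, hy, hm⟩ := (h₂ _ _).1 (not_lt.1 hn)
    have h := hdef 2 y hm 0 (by decide) 1 (by decide)
    have e0 : y 0 = 1 := hy 0
    have e1 : y 1 = 0 := hy 1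
    rw [e0, e1] at h
    exact one_ne_zero h)
  have star : ∀ x₀ x₁ x₃ m, (∃ x₂, curried N 0 x₀ x₁ x₂ x₃ ≤ m) ↔ Star a b c x₁ x₀ x₃ m := by
    intro x₀ x₁ x₃ m
    rw [← hY, h₀]
    constructor
    · rintro ⟨x₂, hm⟩
      exact ⟨_, by simp [Fin.forall_fin_succ], hm⟩
    · rintro ⟨y, hy, hm⟩
      obtain rfl : y 1 = x₁ := hy 0
      obtain rfl : y 0 = x₀ := hy 1
      obtain rfl : y 3 = x₃ := hy 2
      refine ⟨y 2, le_of_eq_of_le (congrArg (N 0) ?_) hm⟩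
      ext k
      fin_cases k <;> rfl
  have lower : ∀ x₀ x₁ m, (∃ x₂ x₃, curried N 2 x₀ x₁ x₂ x₃ ≤ m) ↔ Res e x₀ x₁ m := by
    intro x₀ x₁ m
    rw [← hR', h₂]
    constructor
    · rintro ⟨x₂, x₃, hm⟩
      exact ⟨_, by simp [Fin.forall_fin_succ], hm⟩
    · rintro ⟨y, hy, hm⟩
      obtain rfl : y 0 = x₀ := hy 0
      obtain rfl : y 1 = x₁ := hy 1
      refine ⟨y 2, y 3, le_of_eq_of_le (congrArg (N 2) ?_) hm⟩
      ext k
      fin_cases k <;> rfl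
  refine ⟨a, b, c, d, e, ha, hb, hc, hd, he, hab, hac, hbc, star, ?_, ?_, lower, ?_⟩
  · intro x₁ x₂ x₃ m
    rw [← star]
    simp only [hrot' 0 _ x₁]
  · intro x₀ x₂ m
    rw [← hR, h₁]
    constructor
    · rintro ⟨x₁, x₃, hm⟩
      exact ⟨_, by simp [Fin.forall_fin_succ], hm⟩
    · rintro ⟨y, hy, hm⟩
      obtain rfl : y 0 = x₀ := hy 0
      obtain rfl : y 2 = x₂ := hy 1
      refine ⟨y 1, y 3, le_of_eq_of_le (congrArg (N 1) ?_) hm⟩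
      ext k
      fin_cases k <;> rfl
  · intro x₂ x₃ m
    rw [← lower]
    simp only [hrot' 2 _ _ x₂ x₃]

/-! ### The network of a ladder -/

lemma Res.eq_of_nonpos {r x y t : ℝ} (h : Res r x y t) (ht : t ≤ 0) : x = y := by
  obtain rfl := le_antisymm ht h.1
  have := h.2
  rw [mul_zero] at this
  exact sub_eq_zero.1 (pow_eq_zero_iff two_ne_zero |>.1 (le_antisymm this (sq_nonneg _)))

lemma Ladder.eq_of_nonpos {s : Fin 3} {P M g f : ℝ} {z : Fin 4 → ℝ} (h : Ladder s P M g f z 0)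
    (k l : Fin 4) : z k = z l := by
  suffices h : z 1 = z 0 ∧ z 2 = z 0 ∧ z 3 = z 0 by
    have h' : ∀ k, z k = z 0 := fun k => by
      fin_cases k
      exacts [rfl, h.1, h.2.1, h.2.2]
    rw [h', h' l]
  fin_cases s
  · obtain ⟨c₁, c₂, t₀, t₁, t₂, t₃, s, h0, h1, h2, h3, h4, h⟩ := h
    have := h0.1; have := h1.1; have := h2.1; have := h3.1; have := h4.1
    have e0 := h0.eq_of_nonpos (by linarith)
    have e1 := h1.eq_of_nonpos (by linarith)
    have e2 := h2.eq_of_nonpos (by linarith)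
    have e3 := h3.eq_of_nonpos (by linarith)
    have e4 := h4.eq_of_nonpos (by linarith)
    exact ⟨by linarith, by linarith, by linarith⟩
  · obtain ⟨c₁, c₂, c₃, c₄, t₀, t₁, t₂, t₃, s, s', l, u, h0, h1, h2, h3, h4, h5, h6, h7, h⟩ := h
    have := h0.1; have := h1.1; have := h2.1; have := h3.1; have := h4.1; have := h5.1
    have := h6.1; have := h7.1
    have e0 := h0.eq_of_nonpos (by linarith)
    have e1 := h1.eq_of_nonpos (by linarith)
    have e2 := h2.eq_of_nonpos (by linarith)
    have e3 := h3.eq_of_nonpos (by linarith)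
    have e4 := h4.eq_of_nonpos (by linarith)
    have e5 := h5.eq_of_nonpos (by linarith)
    have e6 := h6.eq_of_nonpos (by linarith)
    exact ⟨by linarith, by linarith, by linarith⟩
  · obtain ⟨c₁, c₂, c₃, c₄, c₅, c₆, t₀, t₁, t₂, t₃, s, s', s'', l, l', u, u', h0, h1, h2, h3, h4,
      h5, h6, h7, h8, h9, h10, h⟩ := h
    have := h0.1; have := h1.1; have := h2.1; have := h3.1; have := h4.1; have := h5.1
    have := h6.1; have := h7.1; have := h8.1; have := h9.1; have := h10.1
    have e0 := h0.eq_of_nonpos (by linarith)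
    have e1 := h1.eq_of_nonpos (by linarith)
    have e2 := h2.eq_of_nonpos (by linarith)
    have e3 := h3.eq_of_nonpos (by linarith)
    have e4 := h4.eq_of_nonpos (by linarith)
    have e6 := h6.eq_of_nonpos (by linarith)
    have e7 := h7.eq_of_nonpos (by linarith)
    have e8 := h8.eq_of_nonpos (by linarith)
    exact ⟨by linarith, by linarith, by linarith⟩

lemma exists_ladderNet (s : Fin 3) {P M g f : ℝ} (hP : 0 < P) (hM : 0 < M) (hg : 0 < g)
    (hf : 0 < f) : ∃ Q : (Fin 4 ⊕ Fin 6 → ℝ) → ℝ, IsNet Q ∧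
      ∀ z m, Ladder s P M g f z m ↔ ∃ y : Fin 4 ⊕ Fin 6 → ℝ, (∀ k, y (.inl k) = z k) ∧ Q y ≤ m := by
  have R := fun (r : ℝ) (hr : 0 < r) (i j : Fin 4 ⊕ Fin 6) => IsNet.resistor i j hr.le
  fin_cases s
  · refine ⟨_, ((((R P hP (.inl 0) (.inr 0)).add (R M hM (.inl 1) (.inr 0))).add
      (R P hP (.inl 2) (.inr 1))).add (R M hM (.inl 3) (.inr 1))).add
      (R g hg (.inr 0) (.inr 1)), fun z m => ⟨?_, ?_⟩⟩
    · rintro ⟨c₁, c₂, t₀, t₁, t₂, t₃, s, h0, h1, h2, h3, h4, h⟩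
      rw [Res.iff_div (by assumption)] at h0 h1 h2 h3 h4
      -- Six inner nodes accommodate all three ladders; the surplus nodes are isolated and their
      -- potentials arbitrary.
      refine ⟨Sum.elim z ![c₁, c₂, 0, 0, 0, 0], fun k => rfl, ?_⟩
      dsimp
      linarith
    · rintro ⟨y, hy, h⟩
      simp only [hy] at h
      exact ⟨y (.inr 0), y (.inr 1), _, _, _, _, _, (Res.iff_div hP).2 le_rfl,
        (Res.iff_div hM).2 le_rfl, (Res.iff_div hP).2 le_rfl, (Res.iff_div hM).2 le_rfl,
        (Res.iff_div hg).2 le_rfl, h⟩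
  · refine ⟨_, (((((((R P hP (.inl 0) (.inr 0)).add (R M hM (.inl 1) (.inr 2))).add
      (R P hP (.inl 2) (.inr 3))).add (R M hM (.inl 3) (.inr 1))).add
      (R g hg (.inr 0) (.inr 1))).add (R g hg (.inr 2) (.inr 3))).add
      (R f hf (.inr 0) (.inr 2))).add (R f hf (.inr 1) (.inr 3)), fun z m => ⟨?_, ?_⟩⟩
    · rintro ⟨c₁, c₂, c₃, c₄, t₀, t₁, t₂, t₃, s, s', l, u, h0, h1, h2, h3, h4, h5, h6, h7, h⟩
      rw [Res.iff_div (by assumption)] at h0 h1 h2 h3 h4 h5 h6 h7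
      refine ⟨Sum.elim z ![c₁, c₂, c₃, c₄, 0, 0], fun k => rfl, ?_⟩
      dsimp
      linarith
    · rintro ⟨y, hy, h⟩
      simp only [hy] at h
      exact ⟨y (.inr 0), y (.inr 1), y (.inr 2), y (.inr 3), _, _, _, _, _, _, _, _,
        (Res.iff_div hP).2 le_rfl, (Res.iff_div hM).2 le_rfl, (Res.iff_div hP).2 le_rfl,
        (Res.iff_div hM).2 le_rfl, (Res.iff_div hg).2 le_rfl, (Res.iff_div hg).2 le_rfl,
        (Res.iff_div hf).2 le_rfl, (Res.iff_div hf).2 le_rfl, h⟩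
  · refine ⟨_, ((((((((((R P hP (.inl 0) (.inr 0)).add (R M hM (.inl 1) (.inr 4))).add
      (R P hP (.inl 2) (.inr 5))).add (R M hM (.inl 3) (.inr 1))).add
      (R g hg (.inr 0) (.inr 1))).add (R g hg (.inr 2) (.inr 3))).add
      (R g hg (.inr 4) (.inr 5))).add (R f hf (.inr 0) (.inr 2))).add
      (R f hf (.inr 2) (.inr 4))).add (R f hf (.inr 1) (.inr 3))).add
      (R f hf (.inr 3) (.inr 5)), fun z m => ⟨?_, ?_⟩⟩
    · rintro ⟨c₁, c₂, c₃, c₄, c₅, c₆, t₀, t₁, t₂, t₃, s, s', s'', l, l', u, u', h0, h1, h2, h3, h4,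
        h5, h6, h7, h8, h9, h10, h⟩
      rw [Res.iff_div (by assumption)] at h0 h1 h2 h3 h4 h5 h6 h7 h8 h9 h10
      refine ⟨Sum.elim z ![c₁, c₂, c₃, c₄, c₅, c₆], fun k => rfl, ?_⟩
      dsimp
      linarith
    · rintro ⟨y, hy, h⟩
      simp only [hy] at h
      exact ⟨y (.inr 0), y (.inr 1), y (.inr 2), y (.inr 3), y (.inr 4), y (.inr 5),
        _, _, _, _, _, _, _, _, _, _, _,
        (Res.iff_div hP).2 le_rfl, (Res.iff_div hM).2 le_rfl, (Res.iff_div hP).2 le_rfl,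
        (Res.iff_div hM).2 le_rfl, (Res.iff_div hg).2 le_rfl, (Res.iff_div hg).2 le_rfl,
        (Res.iff_div hg).2 le_rfl, (Res.iff_div hf).2 le_rfl, (Res.iff_div hf).2 le_rfl,
        (Res.iff_div hf).2 le_rfl, (Res.iff_div hf).2 le_rfl, h⟩

/-! ### Laplacians obtained by restricting ladders -/

section LadderTrace

variable {B : Fin 3 → Finset Plane} {A : Fin 3 → Finset (Fin 4)} {P M g f ρ : ℝ}

/-- The ladder is a network with nonnegative conductances, so its trace on `B s` is one too;
connectedness of the ladder (`Ladder.eq_of_nonpos`) gives the trace the right kernel, hence a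
Laplacian. -/
lemma exists_isLadderTrace (hB : IsVertexBoundary B A) (hP : 0 < P) (hM : 0 < M) (hg : 0 < g)
    (hf : 0 < f) (hρ : 0 < ρ) : ∃ D : ∀ s, Matrix (B s) (B s) ℝ, (∀ s, IsLaplacian (D s)) ∧
      IsLadderTrace A (form D) P M g f ρ := by
  have key : ∀ s, ∃ D : Matrix (B s) (B s) ℝ, IsLaplacian D ∧ ∀ (y : Fin 4 → ℝ) m,
      energy D (fun p => Function.extend (vertex s) y 0 p) ≤ m ↔
        ∃ z : Fin 4 → ℝ, (∀ k ∈ A s, z k = y k) ∧ Ladder s P M g f z (ρ * m) := by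
    intro s
    obtain ⟨i, hi⟩ := hB.exists_index s
    obtain ⟨Q, hQ, h⟩ := exists_ladderNet s hP hM hg hf
    have hinj : Function.Injective fun p => (Sum.inl (i p) : Fin 4 ⊕ Fin 6) := by
      intro p p' hp
      rw [Sum.inl.injEq] at hp
      exact Subtype.ext (by rw [← (hi p).2, ← (hi p').2, hp])
    obtain ⟨Q', hQ', h'⟩ := hQ.exists_trace _ hinj
    have h2 : ∀ (x : B s → ℝ) m, Q' x ≤ m ↔ ∃ z : Fin 4 → ℝ, (∀ p, z (i p) = x p) ∧
        Ladder s P M g f z m := by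
      intro x m
      rw [h']
      constructor
      · rintro ⟨y, hy, hm⟩
        exact ⟨fun k => y (.inl k), hy, (h _ _).2 ⟨y, fun _ => rfl, hm⟩⟩
      · rintro ⟨z, hz, hm⟩
        obtain ⟨y, hy, hm⟩ := (h _ _).1 hm
        exact ⟨y, fun p => (hy _).trans (hz p), hm⟩
    obtain ⟨D, hD, hE⟩ := hQ'.exists_laplacian fun x hx p p' => by
      obtain ⟨z, hz, hm⟩ := (h2 _ _).1 hx
      rw [← hz, ← hz]
      exact hm.eq_of_nonpos _ _
    refine ⟨ρ⁻¹ • D, hD.smul (inv_pos.2 hρ), fun y m => ?_⟩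
    rw [energy_smul, inv_mul_le_iff₀ hρ, hE, h2]
    refine exists_congr fun z => and_congr_left fun _ => ⟨fun hz k hk => ?_, fun hz p => ?_⟩
    · have hk' : i ⟨vertex s k, hB.vertex_mem hk⟩ = k := vertex_injective s (hi _).2
      rw [← hk', hz, hk', (vertex_injective s).extend_apply]
    · rw [hz _ (hi p).1, ← (vertex_injective s).extend_apply y 0 (i p), (hi p).2]
  choose D hD h using key
  exact ⟨D, hD, fun s => h s⟩

lemma IsLadderTrace.rotate (hA : ∀ s, ∀ k ∈ A s, opposite k ∈ A s)
    {N : Fin 3 → (Fin 4 → ℝ) → ℝ} (h : IsLadderTrace A N P M g f ρ) (s : Fin 3) (x : Fin 4 → ℝ) :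
    N s (x ∘ opposite) = N s x := by
  have key : ∀ x : Fin 4 → ℝ, N s (x ∘ opposite) ≤ N s x := by
    intro x
    obtain ⟨z, hz, hm⟩ := (h s x _).1 le_rfl
    refine (h _ _ _).2 ⟨_, fun k hk => ?_, (Ladder.rotate s z).1 hm⟩
    rw [Function.comp, ← hz _ (hA s k hk)]
    fin_cases k <;> rfl
  refine le_antisymm (key x) ?_
  have := key (x ∘ opposite)
  rwa [Function.comp_assoc, show opposite ∘ opposite = id from
    funext IsVertexBoundary.opposite_opposite, Function.comp_id] at this

lemma IsLadderTrace.unique {N N' : Fin 3 → (Fin 4 → ℝ) → ℝ} (h : IsLadderTrace A N P M g f ρ)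
    (h' : IsLadderTrace A N' P M g f ρ) : N = N' := by
  ext s x
  have key : ∀ m, N s x ≤ m ↔ N' s x ≤ m := fun m => (h s x m).trans (h' s x m).symm
  exact le_antisymm ((key _).2 le_rfl) ((key _).1 le_rfl)

end LadderTrace

/-! ### Homogeneous renormalization factors -/

section Homogeneous

variable {r : WindmillEdge → ℝ}

/-- The similarity ratios telescope along a walk to `side 0 / side t * (1 / 4) ^ n`, so for a fixed
type the diameter encodes the length. -/
lemma diam_island_eq_iff {t : Fin 3} {w w' : List WindmillEdge}
    (hw : IsWalk windmill.ini windmill.fin 0 w t) (hw' : IsWalk windmill.ini windmill.fin 0 w' t) :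
    Metric.diam (windmill.island w t) = Metric.diam (windmill.island w' t) ↔
      w.length = w'.length := by
  rw [windmill.diam_island, windmill.diam_island,
    mul_left_inj' (show Metric.diam (windmill.K t) ≠ 0 from (diam_windmillK_pos t).ne')]
  have h1 := walkProd_ratio w 0 hw
  have h2 := walkProd_ratio w' 0 hw'
  change walkProd windmill.ratio w = _ at h1
  change walkProd windmill.ratio w' = _ at h2
  rw [h1, h2, mul_right_inj' (div_pos (side_pos _) (side_pos _)).ne']
  exact (pow_right_injective₀ (by norm_num : (0 : ℝ) < 1 / 4) (by norm_num)).eq_iff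

lemma exists_eq_of_isHomogeneous (h : IsHomogeneous windmill r 0) (hr : ∀ e, 0 < r e) :
    ∃ ρ : ℝ, ∃ c : Fin 3 → ℝ, 0 < ρ ∧ (∀ s, 0 < c s) ∧
      ∀ e, r e = ρ * (c (windmill.fin e) / c (windmill.ini e)) := by
  let e₁₁ : WindmillEdge := ⟨(0, 0, 3, 0), by decide⟩
  let e₁₂ : WindmillEdge := ⟨(0, 1, 0, 0), by decide⟩
  let e₂₃ : WindmillEdge := ⟨(1, 2, 3, 0), by decide⟩
  -- Reference walks of a common length to all states; length two is needed because state 2 is not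
  -- reached from the root in one step. For an edge `e` from `s` to `t`, the walks `w s ++ [e]` and
  -- `e₁₁ :: w t` have equal length and end, and comparing their products gives the formula for `r
  -- e`.
  let w : Fin 3 → List WindmillEdge := ![[e₁₁, e₁₁], [e₁₁, e₁₂], [e₁₂, e₂₃]]
  have hw : ∀ s, IsWalk windmill.ini windmill.fin 0 (w s) s := by
    intro s
    fin_cases s <;> exact ⟨rfl, rfl, rfl⟩
  have hl : ∀ s, (w s).length = 2 := by
    intro s
    fin_cases s <;> rfl
  have hpos : ∀ s, 0 < walkProd r (w s) := fun s =>
    List.prod_pos (by simp only [List.mem_map]; rintro _ ⟨e, -, rfl⟩; exact hr e)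
  refine ⟨r e₁₁, fun s => walkProd r (w s), hr _, hpos, fun e => ?_⟩
  have h1 : IsWalk windmill.ini windmill.fin 0 (w (windmill.ini e) ++ [e]) (windmill.fin e) :=
    isWalk_append.2 ⟨_, hw _, rfl, rfl⟩
  have h2 : IsWalk windmill.ini windmill.fin 0 (e₁₁ :: w (windmill.fin e)) (windmill.fin e) :=
    ⟨rfl, hw _⟩
  have h3 := h _ _ _ h1 h2 ((diam_island_eq_iff h1 h2).2 (by simp [hl]))
  rw [walkProd_append, walkProd_singleton] at h3
  rw [← mul_div_assoc, eq_div_iff (hpos _).ne', mul_comm, h3]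
  simp [walkProd]

lemma walkProd_eq {ρ : ℝ} {c : Fin 3 → ℝ} (hc : ∀ s, 0 < c s)
    (hr : ∀ e, r e = ρ * (c (windmill.fin e) / c (windmill.ini e))) {w : List WindmillEdge}
    {s t : Fin 3} (hw : IsWalk windmill.ini windmill.fin s w t) :
    walkProd r w = ρ ^ w.length * (c t / c s) := by
  induction w generalizing s with
  | nil =>
    obtain rfl : s = t := hw
    simp [walkProd, (hc s).ne']
  | cons e w ih =>
    obtain ⟨rfl, hw⟩ := hw
    have h1 := ih hw
    simp only [walkProd, List.map_cons, List.prod_cons, List.length_cons] at h1 ⊢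
    have h2 := (hc (windmill.fin e)).ne'
    rw [h1, hr, pow_succ]
    field_simp

end Homogeneous

/-! ### The resistances of the restricted networks -/

lemma iInf_star_le_iff {a b c : ℝ} (ha : 0 < a) (hb : 0 < b) (hc : 0 < c) (x y z m : ℝ) :
    (⨅ w : ℝ, ((x - w) ^ 2 / a + (y - w) ^ 2 / b + (z - w) ^ 2 / c)) ≤ m ↔ Star a b c x y z m := by
  obtain ⟨w₀, hw₀⟩ : ∃ w₀ : ℝ, ∀ w, (x - w₀) ^ 2 / a + (y - w₀) ^ 2 / b + (z - w₀) ^ 2 / c ≤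
      (x - w) ^ 2 / a + (y - w) ^ 2 / b + (z - w) ^ 2 / c := by
    -- The optimal centre potential is the conductance-weighted mean of the terminals; completing
    -- the square shows minimality.
    refine ⟨(x / a + y / b + z / c) / (1 / a + 1 / b + 1 / c), fun w => ?_⟩
    obtain ⟨w₀, hw₀⟩ : ∃ w₀, w₀ = (x / a + y / b + z / c) / (1 / a + 1 / b + 1 / c) := ⟨_, rfl⟩
    have hS : 0 < 1 / a + 1 / b + 1 / c := by positivity
    rw [← hw₀]
    rw [eq_div_iff hS.ne'] at hw₀
    have : 0 ≤ (1 / a + 1 / b + 1 / c) * (w - w₀) ^ 2 := by positivity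
    have e : (x - w) ^ 2 / a + (y - w) ^ 2 / b + (z - w) ^ 2 / c =
        (x - w₀) ^ 2 / a + (y - w₀) ^ 2 / b + (z - w₀) ^ 2 / c +
          (1 / a + 1 / b + 1 / c) * (w - w₀) ^ 2 := by
      linear_combination (2 * (w - w₀)) * hw₀
    linarith
  have hbdd : BddBelow (Set.range fun w : ℝ =>
      (x - w) ^ 2 / a + (y - w) ^ 2 / b + (z - w) ^ 2 / c) := ⟨_, by rintro _ ⟨w, rfl⟩; exact hw₀ w⟩
  constructor
  · intro h
    exact ⟨w₀, _, _, _, (Res.iff_div ha).2 le_rfl, (Res.iff_div hb).2 le_rfl,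
      (Res.iff_div hc).2 le_rfl, (le_ciInf hw₀).trans h⟩
  · rintro ⟨w, t₁, t₂, t₃, h1, h2, h3, h⟩
    rw [Res.iff_div (by assumption)] at h1 h2 h3
    exact (ciInf_le hbdd w).trans (by linarith)

section

variable {B : Fin 3 → Finset Plane} {A : Fin 3 → Finset (Fin 4)} {D : ∀ s, Matrix (B s) (B s) ℝ}

lemma IsVertexBoundary.hasTrace (hB : IsVertexBoundary B A) {s : Fin 3} {S : Finset (Fin 4)}
    (hS : S ⊆ contactVertices s) {T : Set Plane} (hT : T = vertex s '' S) {Q : (Plane → ℝ) → ℝ}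
    (h : ∀ v m, Q v ≤ m ↔
      ∃ y : Fin 4 → ℝ, (∀ k ∈ S, y k = v (vertex s k)) ∧ form D s y ≤ m) :
    HasTrace (D s) T Q := by
  have hSA : ∀ k ∈ S, k ∈ A s := fun k hk => hB.contact s (hS hk)
  subst hT
  refine ⟨?_, fun v => isLeast_iff_epigraph.2 fun m => ?_⟩
  · rintro _ ⟨k, hk, rfl⟩
    exact hB.vertex_mem (hSA k hk)
  · rw [h]
    constructor
    · rintro ⟨y, hy, hm⟩
      refine ⟨fun p => Function.extend (vertex s) y 0 p, ?_, hm⟩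
      rintro ⟨_, _⟩ ⟨k, hk, rfl⟩
      rw [← hy k hk]
      exact (vertex_injective s).extend_apply _ _ _
    · rintro ⟨u, hu, hm⟩
      have hy : ∀ k (hk : k ∈ A s), u ⟨vertex s k, hB.vertex_mem hk⟩ =
          (fun k => if hk : k ∈ A s then u ⟨vertex s k, hB.vertex_mem hk⟩ else 0) k :=
        fun k hk => by simp [hk]
      refine ⟨_, fun k hk => (hy k (hSA k hk)).symm.trans (hu _ ⟨k, hk, rfl⟩), ?_⟩
      rwa [← hB.energy_eq_form hy]

lemma hasResistances_of_hasTraces (hB : IsVertexBoundary B A) {a b c d e : ℝ}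
    (T : HasTraces (curried (form D)) a b c d e) (ha : 0 < a) (hb : 0 < b) (hc : 0 < c)
    (hd : 0 < d) (he : 0 < e) : HasResistances D a b c d e := by
  have hne : ∀ (s : Fin 3) {k l : Fin 4}, k ≠ l → vertex s k ≠ vertex s l :=
    fun s k l h => (vertex_injective s).ne h
  have hy : ∀ y : Fin 4 → ℝ, ![y 0, y 1, y 2, y 3] = y := fun y => by
    ext k; fin_cases k <;> rfl
  have hres : ∀ {r : ℝ}, 0 < r → ∀ x y m, (x - y) ^ 2 / r ≤ m ↔ Res r x y m :=
    fun hr x y m => (Res.iff_div hr).symm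
  refine ⟨?_, ?_, ?_, ?_, ?_⟩
  · simp only [q_eq_vertex]
    refine ⟨⟨hne _ (by decide), hne _ (by decide), hne _ (by decide)⟩, ⟨ha, hb, hc⟩,
      hB.hasTrace (S := {3, 2, 1}) (by decide) (by simp [Set.image_insert_eq]) fun v m => ?_⟩
    rw [iInf_star_le_iff ha hb hc, ← T.star_upper]
    constructor
    · rintro ⟨x, hm⟩
      exact ⟨_, by simp, hm⟩
    · rintro ⟨y, h, hm⟩
      simp only [Finset.mem_insert, Finset.mem_singleton, forall_eq_or_imp, forall_eq] at h
      rw [← h.1, ← h.2.1, ← h.2.2]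
      exact ⟨y 0, by rwa [curried, hy]⟩
  · simp only [q_eq_vertex]
    refine ⟨⟨hne _ (by decide), hne _ (by decide), hne _ (by decide)⟩, ⟨ha, hb, hc⟩,
      hB.hasTrace (S := {1, 0, 3}) (by decide) (by simp [Set.image_insert_eq]) fun v m => ?_⟩
    rw [iInf_star_le_iff ha hb hc, ← T.star_lower]
    constructor
    · rintro ⟨x, hm⟩
      exact ⟨_, by simp, hm⟩
    · rintro ⟨y, h, hm⟩
      simp only [Finset.mem_insert, Finset.mem_singleton, forall_eq_or_imp, forall_eq] at h
      rw [← h.1, ← h.2.1, ← h.2.2]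
      exact ⟨y 2, by rwa [curried, hy]⟩
  · rw [rect_one_eq_vertex.2.1, rect_one_eq_vertex.2.2.2]
    refine ⟨hne _ (by decide), hd,
      hB.hasTrace (S := {0, 2}) (by decide) (by simp [Set.image_insert_eq]) fun v m => ?_⟩
    rw [hres hd, ← T.diagonal]
    constructor
    · rintro ⟨x, x', hm⟩
      exact ⟨_, by simp, hm⟩
    · rintro ⟨y, h, hm⟩
      simp only [Finset.mem_insert, Finset.mem_singleton, forall_eq_or_imp, forall_eq] at h
      rw [← h.1, ← h.2]
      exact ⟨y 1, y 3, by rwa [curried, hy]⟩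
  · rw [rect_two_eq_vertex.1, rect_two_eq_vertex.2.1]
    refine ⟨hne _ (by decide), he,
      hB.hasTrace (S := {0, 1}) (by decide) (by simp [Set.image_insert_eq]) fun v m => ?_⟩
    rw [hres he, ← T.lower]
    constructor
    · rintro ⟨x, x', hm⟩
      exact ⟨_, by simp, hm⟩
    · rintro ⟨y, h, hm⟩
      simp only [Finset.mem_insert, Finset.mem_singleton, forall_eq_or_imp, forall_eq] at h
      rw [← h.1, ← h.2]
      exact ⟨y 2, y 3, by rwa [curried, hy]⟩
  · rw [rect_two_eq_vertex.2.2.1, rect_two_eq_vertex.2.2.2]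
    refine ⟨hne _ (by decide), he,
      hB.hasTrace (S := {3, 2}) (by decide) (by simp [Set.image_insert_eq]) fun v m => ?_⟩
    rw [hres he, Res.comm, ← T.upper]
    constructor
    · rintro ⟨x, x', hm⟩
      exact ⟨_, by simp, hm⟩
    · rintro ⟨y, h, hm⟩
      simp only [Finset.mem_insert, Finset.mem_singleton, forall_eq_or_imp, forall_eq] at h
      rw [← h.1, ← h.2]
      exact ⟨y 0, y 1, by rwa [curried, hy]⟩

/-! ### The harmonic structure of the windmill set -/

/-- The resistance `b`; the others are `a = 1`, `c = 2`, `d = 3 b`, `e = 7 b - 5`. -/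
def armResistance : ℝ := (13 + √73) / 16

local notation "β" => armResistance

lemma one_lt_armResistance : 1 < β := by
  have : 8 < √73 := Real.lt_sqrt_of_sq_lt (by norm_num)
  rw [armResistance]
  linarith

lemma armResistance_sq : 8 * β ^ 2 - 13 * β + 3 = 0 := by
  have hs : √73 ^ 2 = 73 := Real.sq_sqrt (by norm_num)
  rw [armResistance]
  linear_combination hs / 32

/-- The networks that are obtained from the ladders with the resistances of the solution. -/
def IsStandard (A : Fin 3 → Finset (Fin 4)) (N : Fin 3 → (Fin 4 → ℝ) → ℝ) : Prop :=
  IsLadderTrace A N (β + 3 * β) (2 * 1 + 2) (2 * 2) (1 + (7 * β - 5) + β) (1 / 4)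

/-- The proposed resistances are a fixed point of the renormalization; only the equation for `e`
uses the quadratic relation for `armResistance`. -/
lemma IsStandard.hasTraces {N : Fin 3 → (Fin 4 → ℝ) → ℝ} (hA : ∀ s, contactVertices s ⊆ A s)
    (h : IsStandard A N) : HasTraces (curried N) 1 β 2 (3 * β) (7 * β - 5) := by
  have hb := one_lt_armResistance
  have hq := armResistance_sq
  convert IsLadderTrace.hasTraces hA h (by positivity) (by norm_num) (by norm_num) (by linarith)
    (by norm_num) using 1
  · norm_num
  · ring
  · norm_num
  · ring
  · have hden : 2 * (1 + (7 * β - 5) + β) + 2 * 2 ≠ 0 := by linarith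
    have : 2 * (1 + (7 * β - 5) + β) * (1 + (7 * β - 5) + β + 2 * 2) /
        (2 * (1 + (7 * β - 5) + β) + 2 * 2) = 24 * β - 24 := by
      rw [div_eq_iff hden]
      linear_combination -32 * hq
    rw [this]
    ring

lemma isHarmonicStructure_iff_isLadderTrace (hB : IsVertexBoundary B A)
    (hD : ∀ s, IsLaplacian (D s)) {r : WindmillEdge → ℝ} {ρ : ℝ} (hρ : 0 < ρ) {κ : Fin 3 → ℝ}
    (hκ : ∀ s, 0 < κ s) (hr : ∀ e, r e = ρ * (κ (windmill.fin e) / κ (windmill.ini e)))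
    {a b c d e : ℝ} (T : HasTraces (curried fun s x => (κ s)⁻¹ * form D s x) a b c d e)
    (ha : 0 ≤ a) (hb : 0 ≤ b) (hc : 0 ≤ c) (hd : 0 ≤ d) (he : 0 ≤ e) :
    IsHarmonicStructure windmill B D r ↔
      IsLadderTrace A (fun s x => (κ s)⁻¹ * form D s x) (b + d) (2 * a + c) (2 * c) (a + e + b)
        ρ := by
  rw [isHarmonicStructure_iff hB hD hρ hκ hr]
  simp only [IsLadderTrace, T.levelSum_iff ha hb hc hd he]

variable {D₀ : ∀ s, Matrix (B s) (B s) ℝ} {r : WindmillEdge → ℝ}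

lemma isWindmillStructure_of_isStandard (hB : IsVertexBoundary B A)
    (hD₀ : ∀ s, IsLaplacian (D₀ s)) (h : IsStandard A (form D₀)) {κ : Fin 3 → ℝ}
    (hκ : ∀ s, 0 < κ s) (hD : ∀ s, D s = κ s • D₀ s)
    (hr : ∀ e, r e = 1 / 4 * (κ (windmill.fin e) / κ (windmill.ini e))) :
    IsWindmillStructure B D r := by
  have hb := one_lt_armResistance
  have hDL : ∀ s, IsLaplacian (D s) := fun s => hD s ▸ (hD₀ s).smul (hκ s)
  have hform : (fun s x => (κ s)⁻¹ * form D s x) = form D₀ := by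
    ext s x
    rw [form, hD, energy_smul, inv_mul_cancel_left₀ (hκ s).ne']
    rfl
  refine ⟨?_, ?_, ?_, ?_⟩
  · rw [isHarmonicStructure_iff_isLadderTrace hB hDL (by norm_num) hκ hr
      (by rw [hform]; exact h.hasTraces hB.contact) (by norm_num) (by positivity) (by norm_num)
      (by positivity) (by linarith), hform]
    exact h
  · intro s w hw hs
    rw [walkProd_eq hκ hr hs, div_self (hκ s).ne', mul_one]
    exact pow_lt_one₀ (by norm_num) (by norm_num) (by simpa using hw)
  · intro t w w' hw hw' hd
    rw [walkProd_eq hκ hr hw, walkProd_eq hκ hr hw', (diam_island_eq_iff hw hw').1 hd]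
  · rw [hB.isRotationSymmetric_iff hDL]
    intro s x
    have h1 : ∀ x, form D s x = κ s * form D₀ s x := fun x => by
      rw [form, hD, energy_smul]
      rfl
    rw [h1, h1, IsLadderTrace.rotate hB.opposite_mem h]

/-- Uniqueness: any structure has resistances, its ladders reproduce them, and so they solve the
self-consistency equations. After normalization to `a = 1` the structure is the trace of the same
ladders as `D₀`, hence equal to it up to the gauge. -/
lemma exists_smul_of_isWindmillStructure (hB : IsVertexBoundary B A)
    (hD₀ : ∀ s, IsLaplacian (D₀ s)) (h : IsStandard A (form D₀)) (H : IsWindmillStructure B D r) :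
    ∃ κ : Fin 3 → ℝ, (∀ s, 0 < κ s) ∧ (∀ s, D s = κ s • D₀ s) ∧
      ∀ e, r e = 1 / 4 * (κ (windmill.fin e) / κ (windmill.ini e)) := by
  have hβ := one_lt_armResistance
  have hD := H.harmonic.isLaplacian
  obtain ⟨ρ, μ, hρ, hμ, hr⟩ := exists_eq_of_isHomogeneous H.homogeneous H.harmonic.pos
  have hμ' : ∀ s, 0 < (μ s)⁻¹ := fun s => inv_pos.2 (hμ s)
  have hrot := (hB.isRotationSymmetric_iff hD).1 H.symmetric
  obtain ⟨a, b, c, d, e, ha, hb, hc, hd, he, hab, hac, hbc, T⟩ :=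
    exists_hasTraces (N := fun s x => (μ s)⁻¹ * form D s x)
      (fun s => (hB.isNet_form (hD s)).const_mul (hμ' s).le)
      (fun s x hx k hk l hl => hB.eq_of_form_nonpos (hD s)
        (nonpos_of_mul_nonpos_right hx (hμ' s)) (hB.contact s hk) (hB.contact s hl))
      (fun s x => by rw [hrot])
  have h1 := (isHarmonicStructure_iff_isLadderTrace hB hD hρ hμ hr T ha hb hc hd.le he.le).1
    H.harmonic
  have T' := h1.hasTraces hB.contact (by positivity) (by positivity) (by positivity)
    (by positivity) hρ
  obtain ⟨e1, e2, e3, e4, e5⟩ := T.unique T' ha hb hc hd he hab hac hbc (by positivity)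
    (by positivity) (by positivity)
  obtain ⟨rfl, ha0, hb', hc', hd', he'⟩ := solve_resistances hc he hac e1 e2 e3 e4 e5
  -- A common factor in `μ` does not change the quotients in `r`, so it can be used to normalize `a`
  -- to 1.
  let κ : Fin 3 → ℝ := fun s => μ s / a
  have hκ : ∀ s, 0 < κ s := fun s => div_pos (hμ s) ha0
  have hrκ : ∀ e, r e = 1 / 4 * (κ (windmill.fin e) / κ (windmill.ini e)) := fun e => by
    rw [hr, div_div_div_cancel_right₀ ha0.ne']
  have Tκ : HasTraces (curried fun s x => (κ s)⁻¹ * form D s x) 1 β 2 (3 * β) (7 * β - 5) := by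
    rw [show a = a * 1 from (mul_one a).symm, hb', hc', hd', he'] at T
    convert T.inv_scale ha0 using 1
    · ext s x₀ x₁ x₂ x₃
      simp only [curried, κ, inv_div]
      ring
    · rfl
    · rw [armResistance]; ring
    · rw [armResistance]; ring
  have hstd := (isHarmonicStructure_iff_isLadderTrace hB hD (by norm_num) hκ hrκ Tκ (by norm_num)
    (by positivity) (by norm_num) (by positivity) (by linarith)).1 H.harmonic
  have hform := IsLadderTrace.unique hstd h
  refine ⟨κ, hκ, fun s => hB.eq_smul_of_form_eq (hD s) (hD₀ s) (hκ s) fun x => ?_, hrκ⟩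
  rw [← hform, mul_inv_cancel_left₀ (hκ s).ne']

lemma isWindmillStructure_const_iff
    (h : ∀ (D : ∀ s, Matrix (B s) (B s) ℝ) (r : WindmillEdge → ℝ), IsWindmillStructure B D r ↔
      ∃ c : Fin 3 → ℝ, (∀ s, 0 < c s) ∧ (∀ s, D s = c s • D₀ s) ∧
        ∀ e, r e = 1 / 4 * (c (windmill.fin e) / c (windmill.ini e))) (ρ : ℝ) :
    IsWindmillStructure B D (fun _ => ρ) ↔ ρ = 1 / 4 ∧ ∃ c : ℝ, 0 < c ∧ ∀ s, D s = c • D₀ s := by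
  rw [h]
  constructor
  · rintro ⟨c, hc, hD, hr⟩
    -- A loop at state 0 fixes `ρ`; edges `0 → 1` and `1 → 2` then make all the scales equal.
    have e0 : ρ = 1 / 4 * (c 0 / c 0) := hr ⟨(0, 0, 3, 0), by decide⟩
    have e1 : ρ = 1 / 4 * (c 1 / c 0) := hr ⟨(0, 1, 0, 0), by decide⟩
    have e2 : ρ = 1 / 4 * (c 2 / c 1) := hr ⟨(1, 2, 3, 0), by decide⟩
    rw [div_self (hc 0).ne', mul_one] at e0
    have h1 : c 1 = c 0 := (div_eq_one_iff_eq (hc 0).ne').1 (by linarith)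
    have h2 : c 2 = c 1 := (div_eq_one_iff_eq (hc 1).ne').1 (by linarith)
    refine ⟨e0, c 0, hc 0, fun s => ?_⟩
    rw [hD]
    fin_cases s
    · rfl
    · exact congrArg (· • D₀ 1) h1
    · exact congrArg (· • D₀ 2) (h2.trans h1)
  · rintro ⟨rfl, c, hc, hD⟩
    exact ⟨fun _ => c, fun _ => hc, hD, fun _ => by rw [div_self hc.ne', mul_one]⟩

end

end Windmill

end

/-! ### The theorem, for both choices of boundary sets at once -/

open Windmill in
theorem theorem5p8 :
    (∀ s, (windmill.boundary 0 s).Finite) ∧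
    ∀ B : Fin 3 → Finset Plane,
      ((∀ s, (B s : Set Plane) = rectVertices s) ∨
        (∀ s, (B s : Set Plane) = windmill.boundary 0 s)) →
      ∃ D₀ : ∀ s, Matrix (B s) (B s) ℝ,
        IsWindmillStructure B D₀ (fun _ => 1 / 4) ∧
        HasResistances D₀ 1 ((13 + √73) / 16) 2 (3 * (13 + √73) / 16) ((11 + 7 * √73) / 16) ∧
        (∀ (D : ∀ s, Matrix (B s) (B s) ℝ) (ρ : ℝ),
          IsWindmillStructure B D (fun _ => ρ) ↔
            ρ = 1 / 4 ∧ ∃ c : ℝ, 0 < c ∧ ∀ s, D s = c • D₀ s) ∧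
        (∀ (D : ∀ s, Matrix (B s) (B s) ℝ) (r : WindmillEdge → ℝ),
          IsWindmillStructure B D r ↔
            ∃ c : Fin 3 → ℝ, (∀ s, 0 < c s) ∧ (∀ s, D s = c s • D₀ s) ∧
              ∀ e, r e = 1 / 4 * (c (windmill.fin e) / c (windmill.ini e))) := by
  refine ⟨fun s => ?_, fun B hB => ?_⟩
  · rw [boundary_eq]
    exact (Finset.finite_toSet _).image _
  -- The two triples differ only in state 1, where `V_2` omits one diagonal of the rectangle.
  obtain ⟨A, hA⟩ : ∃ A, IsVertexBoundary B A := by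
    rcases hB with hB | hB
    · exact ⟨fun _ => Finset.univ, fun s => by rw [hB, rectVertices_eq]; simp,
        fun _ => Finset.subset_univ _, fun _ _ _ => Finset.mem_univ _⟩
    · exact ⟨contactVertices, fun s => by rw [hB, boundary_eq], fun _ => subset_rfl, by decide⟩
  have hb := one_lt_armResistance
  obtain ⟨D₀, hD₀, h⟩ := exists_isLadderTrace (P := armResistance + 3 * armResistance)
    (M := 2 * 1 + 2) (g := 2 * 2) (f := 1 + (7 * armResistance - 5) + armResistance) (ρ := 1 / 4)
    hA (by positivity) (by norm_num) (by norm_num) (by linarith) (by norm_num)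
  have hall : ∀ (D : ∀ s, Matrix (B s) (B s) ℝ) (r : WindmillEdge → ℝ), IsWindmillStructure B D r ↔
      ∃ c : Fin 3 → ℝ, (∀ s, 0 < c s) ∧ (∀ s, D s = c s • D₀ s) ∧
        ∀ e, r e = 1 / 4 * (c (windmill.fin e) / c (windmill.ini e)) := fun D r =>
    ⟨exists_smul_of_isWindmillStructure hA hD₀ h,
      fun ⟨c, hc, hD, hr⟩ => isWindmillStructure_of_isStandard hA hD₀ h hc hD hr⟩
  refine ⟨D₀, ?_, ?_, fun D ρ => isWindmillStructure_const_iff hall ρ, hall⟩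
  · exact (isWindmillStructure_const_iff hall _).2 ⟨rfl, 1, one_pos, fun s => (one_smul ℝ _).symm⟩
  · convert hasResistances_of_hasTraces hA (IsStandard.hasTraces hA.contact h) one_pos
      (by positivity) two_pos (by positivity) (by linarith) using 1
    · rfl
    · rw [armResistance]; ring
    · rw [armResistance]; ring
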